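/- **Setting (the set theory AS of approximations).** Hereditarily finite sets have approximations $F(0,A)=\emptyset$, $F(n+1,A)=\{F(n,x)\mid x\in A\}$. A *set* is a sequence $A=(A_n)_{n\in\mathbb N}$ of hereditarily finite sets with $\operatorname{rank}A_n\le n$ and $F(n,A_{n+1})=A_n$ for every $n$; we write $F(n,A)=A_n$. Membership is defined by: $x\in A$ iff $F(n,x)\in F(n+1,A)$ for every $n$. The neighbourhoods of $x$ are $\{y\mid F(n,y)=F(n,x)\}$, $n\in\mathbb N$; a point $x$ is an accumulation point in $A$ if every neighbourhood of $x$ contains some $y\in A$, $y\ne x$; $A'$ is the set of all accumulation points in $A$. Ordered pairs are Kuratowski pairs; relations and functions are sets of ordered pairs. All objects below are sets in this sense. **Cardinality.** $A\le_c B$ means that there is an injection from $A$ into $B$; $A=_cB$ means $A\le_cB$ and $B\le_cA$; $A<_cB$ means $A\le_cB$ and not $A=_cB$. A set is infinite if it is in bijection with a proper subset of itself. **Orderings.** A linear ordering of $A$ is given by a set $R$ of ordered pairs of elements of $A$, namely the pairs $(x,y)$ with $x\le y$, where $\le$ is reflexive, antisymmetric, transitive and total on $A$; $x<y$ means $x\le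 y$ and $x\neq y$. It is a *well-ordering* if every nonempty subset of $A$ has a minimal element and every $x\in A$ has a neighbourhood that contains no $y\in A$ with $x<y$. An *ordinal* is a set with a well-ordering of it. An initial segment of $A$ is a set $S\subseteq A$ such that $x\in S$, $y\in A$, $y<x$ imply $y\in S$. $A\le_oB$ ($A<_oB$) means that $A$ is isomorphic to an initial segment (a proper initial segment) of $B$; $A=_oB$ means $A\le_oB$ and $B\le_oA$. An ordinal $\beta$ is a predecessor of an ordinal $\alpha$ if the elements of $\alpha$ other than $\max\alpha$ form a set and this set is isomorphic to $\beta$; a nonempty ordinal without a predecessor is a limit ordinal. The von Neumann ordinals are $0=\emptyset$, $n+1=n\cup\{n\}$, and $\omega$, the smallest set that contains all finite ones; its elements are the finite ones and $\omega$ itself, ordered by $0<1<2<\dots<\omega$. **Cantor–Bendixson degree.** $A^{(\emptyset)}=A$; $A^{(\alpha)}=(A^{(\beta)})'$ if $\beta$ is a predecessor of $\alpha$; $A^{(\alpha)}=\{x\mid x\in A^{(\beta)}\text{ for every }\beta<_o\alpha\}$ if $\alpha$ is a limit ordinal. A Cantor–Bendixson rank of $A$ is an ordinal $\alpha$, smallest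 with respect to $\le_o$, with $(A^{(\alpha)})'=\emptyset$; then $d_{CB}(A)=A^{(\alpha)}$ is the Cantor–Bendixson degree of $A$. **Cardinals.** A *well-ordered cardinal* is an ordinal $\kappa$ such that $\kappa=_cS$ for no proper initial segment $S$ of $\kappa$. A cardinal is a well-ordered cardinal or a set that cannot be well-ordered. A *limit cardinal* is a nonempty cardinal $\kappa$ without a predecessor, i.e. for every cardinal $\mu<_c\kappa$ there is a cardinal $\nu$ with $\mu<_c\nu<_c\kappa$. The sum $\sum_{j\in J}A_j$ of an indexed system of sets (a function $j\mapsto A_j$ on a set $J$) is the set of all $(j,a)$ with $j\in J$, $a\in A_j$. The *cofinality* $\mathrm{cf}(\kappa)$ of a well-ordered cardinal $\kappa$ is the shortest initial segment $\lambda$ of $\kappa$ for which there is an indexed system of sets $A_j<_c\kappa$, $j\in\lambda$, with $\kappa=_c\sum_{j\in\lambda}A_j$ (if there is one). **Theorem.** Let $\kappa$ be a well-ordered cardinal. 1. If $\mathrm{cf}(\kappa)$ exists, then $\mathrm{cf}(\kappa)\le_o\omega$. 2. $d_{CB}(\kappa)$ exists and is unique. Let $\kappa>_c1$. If $d_{CB}(\kappa)>_c1$,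 then $\mathrm{cf}(\kappa)$ exists, is unique, and $\mathrm{cf}(\kappa)=_o2$. If $d_{CB}(\kappa)=_c1$, then $\mathrm{cf}(\kappa)$ exists, is unique, and $\mathrm{cf}(\kappa)=_o\omega$. 3. If $\kappa$ is infinite, then $\kappa$ is a limit cardinal if and only if $\mathrm{cf}(\kappa)$ exists, is unique, and $\mathrm{cf}(\kappa)=_o\omega$. -/

import Mathlib

namespace AS

/-- Hereditarily finite sets of rank at most `n`: the empty set is the only one of rank `0`, and
those of rank at most `n + 1` are the sets of hereditarily finite sets of rank at most `n`
(every `HF n` is a finite type, so all these sets are finite). -/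
def HF : ℕ → Type
  | 0 => Unit
  | n + 1 => Set (HF n)

/-- The elements of a hereditarily finite set. -/
def HF.elems {n : ℕ} (A : HF (n + 1)) : Set (HF n) := A

/-- The hereditarily finite set with given elements. -/
def HF.mk {n : ℕ} (s : Set (HF n)) : HF (n + 1) := s

/-- The `n`-th approximation `F(n, A)` of a hereditarily finite set `A` of rank at most `n + 1`:
`F(0, A) = {}` and `F(n + 1, A) = {F(n, x) | x ∈ A}`. -/
def HF.trunc : (n : ℕ) → HF (n + 1) → HF n
  | 0, _ => ()
  | n + 1, A => HF.mk (HF.trunc n '' A.elems)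

end AS

/-- The sets of the theory of approximations. A set is an infinite path in the universal tree, that
is, a sequence of hereditarily finite sets `A_n` (its approximations `F(n, A)`) of rank at most `n`
with `F(n, A_{n+1}) = A_n`. The type `ASet` is the universe of all sets. -/
@[ext]
structure ASet where
  approx : (n : ℕ) → AS.HF n
  coherent : ∀ n, AS.HF.trunc n (approx (n + 1)) = approx n

namespace AS

/-- `x ∈ A` means `F(n, x) ∈ F(n + 1, A)` for every `n`. -/
instance : Membership ASet ASet where
  mem A x := ∀ n, x.approx n ∈ (A.approx (n + 1)).elems

/-- `B ⊆ A`. -/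
def Sub (B A : ASet) : Prop := ∀ x, x ∈ B → x ∈ A

def Nonempty (A : ASet) : Prop := ∃ x, x ∈ A

/-- The smallest set that contains all `x` with the property `P`; its approximations are
`F(n + 1, -) = {F(n, x) | P x}`. -/
def smallest (P : ASet → Prop) : ASet where
  approx
    | 0 => ()
    | n + 1 => HF.mk {a | ∃ x, P x ∧ x.approx n = a}
  coherent n := by
    cases n with
    | zero => rfl
    | succ n =>
      change HF.trunc n '' {a | ∃ x, P x ∧ x.approx (n + 1) = a} = {a | ∃ x, P x ∧ x.approx n = a}
      ext a
      constructor
      · rintro ⟨_, ⟨x, hx, rfl⟩, rfl⟩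
        exact ⟨x, hx, (x.coherent n).symm⟩
      · rintro ⟨x, hx, rfl⟩
        exact ⟨_, ⟨x, hx, rfl⟩, x.coherent n⟩

theorem mem_smallest {P : ASet → Prop} {x : ASet} :
    x ∈ smallest P ↔ ∀ n, ∃ y, P y ∧ y.approx n = x.approx n := Iff.rfl

theorem approx_eq_of_le {x y : ASet} {m n : ℕ} (hmn : m ≤ n) (h : x.approx n = y.approx n) :
    x.approx m = y.approx m := by
  induction n, hmn using Nat.le_induction with
  | base => exact h
  | succ n _ ih => exact ih (by rw [← x.coherent n, ← y.coherent n, h])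

/-- The empty set. -/
def empty : ASet := smallest fun _ => False

/-- The unordered pair `{a, b}`. -/
def pair (a b : ASet) : ASet := smallest fun x => x = a ∨ x = b

/-- The ordered pair `(a, b) = {{a}, {a, b}}`. -/
def opair (a b : ASet) : ASet := pair (pair a a) (pair a b)

/-- The set `A ∪ {a}`. -/
def adjoin (A a : ASet) : ASet := smallest fun x => x ∈ A ∨ x = a

theorem notMem_empty (x : ASet) : x ∉ empty := fun h => by
  obtain ⟨_, hy, _⟩ := mem_smallest.1 h 0
  exact hy

theorem mem_adjoin {A a x : ASet} : x ∈ adjoin A a ↔ x ∈ A ∨ x = a := by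
  refine ⟨fun h => ?_, fun h n => ⟨x, h, rfl⟩⟩
  by_contra hc
  rw [not_or] at hc
  obtain ⟨hA, ha⟩ := hc
  obtain ⟨n, hn⟩ : ∃ n, x.approx n ∉ (A.approx (n + 1)).elems := not_forall.1 hA
  obtain ⟨m, hm⟩ : ∃ m, x.approx m ≠ a.approx m := by
    by_contra hm
    push Not at hm
    exact ha (ASet.ext (funext hm))
  obtain ⟨y, hy, hyx⟩ := mem_smallest.1 h (max n m)
  rcases hy with hy | rfl
  · exact hn (approx_eq_of_le (le_max_left n m) hyx ▸ hy n)
  · exact hm (approx_eq_of_le (le_max_right n m) hyx).symm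

theorem mem_pair {a b x : ASet} : x ∈ pair a b ↔ x = a ∨ x = b := by
  refine ⟨fun h => ?_, fun h n => ⟨x, h, rfl⟩⟩
  by_contra hc
  rw [not_or] at hc
  have key : ∀ c : ASet, x ≠ c → ∃ n, x.approx n ≠ c.approx n := fun c hxc => by
    by_contra hm
    push Not at hm
    exact hxc (ASet.ext (funext hm))
  obtain ⟨n, hn⟩ := key a hc.1
  obtain ⟨m, hm⟩ := key b hc.2
  obtain ⟨y, hy, hyx⟩ := mem_smallest.1 h (max n m)
  rcases hy with rfl | rfl
  · exact hn (approx_eq_of_le (le_max_left n m) hyx).symm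
  · exact hm (approx_eq_of_le (le_max_right n m) hyx).symm

/-! Functions and cardinality -/

/-- `R` is a relation between the elements of `A` and `B`: a set of ordered pairs. -/
def IsRelation (R A B : ASet) : Prop :=
  ∀ p, p ∈ R → ∃ a b, a ∈ A ∧ b ∈ B ∧ p = opair a b

/-- `f : A → B`. -/
structure IsFunction (f A B : ASet) : Prop where
  relation : IsRelation f A B
  total : ∀ a, a ∈ A → ∃ b, b ∈ B ∧ opair a b ∈ f
  functional : ∀ a b b', opair a b ∈ f → opair a b' ∈ f → b = b'

structure IsInjection (f A B : ASet) : Prop extends IsFunction f A B where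
  injective : ∀ a a' b, opair a b ∈ f → opair a' b ∈ f → a = a'

structure IsBijection (f A B : ASet) : Prop extends IsInjection f A B where
  surjective : ∀ b, b ∈ B → ∃ a, a ∈ A ∧ opair a b ∈ f

/-- A set is infinite if it is in bijection with a proper subset of itself. -/
def IsInfinite (A : ASet) : Prop := ∃ B f, Sub B A ∧ B ≠ A ∧ IsBijection f A B

/-- `A ≤_c B`. -/
def CLe (A B : ASet) : Prop := ∃ f, IsInjection f A B

/-- `A =_c B`. -/
def CEq (A B : ASet) : Prop := CLe A B ∧ CLe B A

/-- `A <_c B`. -/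
def CLt (A B : ASet) : Prop := CLe A B ∧ ¬ CEq A B

/-! Well-orderings. An ordering is given by the set `R` of all pairs `(x, y)` with `x ≤ y`. -/

/-- The strict order `x < y` that belongs to `R`. -/
def Lt (R x y : ASet) : Prop := opair x y ∈ R ∧ x ≠ y

/-- `R` is a linear ordering of `A`. -/
structure LinearlyOrders (R A : ASet) : Prop where
  relation : IsRelation R A A
  refl : ∀ x, x ∈ A → opair x x ∈ R
  antisymm : ∀ x y, opair x y ∈ R → opair y x ∈ R → x = y
  trans : ∀ x y z, opair x y ∈ R → opair y z ∈ R → opair x z ∈ R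
  total : ∀ x y, x ∈ A → y ∈ A → opair x y ∈ R ∨ opair y x ∈ R

/-- `m` is the minimal element of `A`. -/
def IsMin (R A m : ASet) : Prop := m ∈ A ∧ ∀ x, x ∈ A → x ≠ m → Lt R m x

/-- `m` is the maximal element of `A`. -/
def IsMax (R A m : ASet) : Prop := m ∈ A ∧ ∀ x, x ∈ A → x ≠ m → Lt R x m

/-- `x` is upward isolated in `A`: some neighbourhood `{y | F(n, y) = F(n, x)}` of `x` contains no
element of `A` that is greater than `x`. -/
def UpwardIsolated (R A x : ASet) : Prop :=
  ∃ n, ∀ y, y ∈ A → y.approx n = x.approx n → ¬ Lt R x y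

/-- `R` is a well-ordering of `A`. -/
structure WellOrders (R A : ASet) : Prop where
  linear : LinearlyOrders R A
  exists_min : ∀ B, Sub B A → Nonempty B → ∃ m, IsMin R B m
  upward : ∀ x, x ∈ A → UpwardIsolated R A x

def WellOrderable (A : ASet) : Prop := ∃ R, WellOrders R A

/-- `S` is an initial segment of `A`. -/
def IsInitialSegment (R A S : ASet) : Prop :=
  Sub S A ∧ ∀ x y, x ∈ S → y ∈ A → Lt R y x → y ∈ S

def IsProperInitialSegment (R A S : ASet) : Prop := IsInitialSegment R A S ∧ S ≠ A

/-- `A`, ordered by `R`, and `B`, ordered by `Q`, are isomorphic. Here and in the comparisons below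
`A` and `B` may also be subsets of the sets that `R` and `Q` order; the induced orderings are
then meant. -/
def Isomorphic (R A Q B : ASet) : Prop :=
  ∃ f, IsBijection f A B ∧ ∀ x x' y y', opair x y ∈ f → opair x' y' ∈ f → Lt R x x' → Lt Q y y'

/-- `A ≤_o B`. -/
def OLe (R A Q B : ASet) : Prop := ∃ S, IsInitialSegment Q B S ∧ Isomorphic R A Q S

/-- `A =_o B`. -/
def OEq (R A Q B : ASet) : Prop := OLe R A Q B ∧ OLe Q B R A

/-- `A <_o B`. -/
def OLt (R A Q B : ASet) : Prop := ∃ S, IsProperInitialSegment Q B S ∧ Isomorphic R A Q S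

/-- An ordinal is a set together with a well-ordering of it. -/
structure Ord where
  carrier : ASet
  rel : ASet
  wellOrders : WellOrders rel carrier

/-- `β` is a predecessor of the ordinal `α`: the elements of `α` other than its maximal element
form a set, and this set is isomorphic to `β`. -/
def Ord.IsPred (β α : Ord) : Prop :=
  ∃ m C, IsMax α.rel α.carrier m ∧ (∀ x, x ∈ C ↔ x ∈ α.carrier ∧ x ≠ m) ∧
    OEq α.rel C β.rel β.carrier

/-- A limit ordinal is a nonempty ordinal without a predecessor. -/
def Ord.IsLimit (α : Ord) : Prop := Nonempty α.carrier ∧ ¬ ∃ β : Ord, β.IsPred α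

/-! Von Neumann ordinals -/

/-- The finite von Neumann ordinals. -/
def nOrd : ℕ → ASet
  | 0 => empty
  | n + 1 => adjoin (nOrd n) (nOrd n)

/-- The set `ω` of all finite von Neumann ordinals; it has itself as its only further element. -/
def omega : ASet := smallest fun x => ∃ n, x = nOrd n

/-- The natural ordering of `ω`, in which `0 < 1 < 2 < ⋯ < ω`. -/
def omegaLe : ASet := smallest fun p => ∃ m n, m ≤ n ∧ p = opair (nOrd m) (nOrd n)

/-! Cantor-Bendixson rank and degree -/

/-- `x` is an accumulation point in `A`. -/
def IsAcc (A x : ASet) : Prop := ∀ n, ∃ y, y ∈ A ∧ y ≠ x ∧ y.approx n = x.approx n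

/-- The derived set, that is, the set of all accumulation points in `A`. -/
def derived (A : ASet) : ASet := smallest (IsAcc A)

theorem mem_derived {A x : ASet} : x ∈ derived A ↔ IsAcc A x := by
  refine ⟨fun h n => ?_, fun h n => ⟨x, h, rfl⟩⟩
  obtain ⟨y, hy, hyx⟩ := mem_smallest.1 h n
  by_cases hxy : y = x
  · exact hxy ▸ hy n
  · obtain ⟨m, hm⟩ : ∃ m, y.approx m ≠ x.approx m := by
      by_contra hm
      push Not at hm
      exact hxy (ASet.ext (funext hm))
    obtain ⟨z, hz, _, hzy⟩ := hy (max n m)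
    refine ⟨z, hz, ?_, (approx_eq_of_le (le_max_left n m) hzy).trans hyx⟩
    rintro rfl
    exact hm (approx_eq_of_le (le_max_right n m) hzy).symm

/-- `IterDerived A α B` means that `B` is the iterated derived set `A^(α)`. -/
inductive IterDerived (A : ASet) : Ord → ASet → Prop
  | zero (α : Ord) : α.carrier = empty → IterDerived A α A
  | succ (α β : Ord) (B : ASet) : β.IsPred α → IterDerived A β B → IterDerived A α (derived B)
  | limit (α : Ord) (D : Ord → ASet) (B : ASet) : α.IsLimit →
      (∀ β : Ord, OLt β.rel β.carrier α.rel α.carrier → IterDerived A β (D β)) →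
      (∀ x, x ∈ B ↔ ∀ β : Ord, OLt β.rel β.carrier α.rel α.carrier → x ∈ D β) →
      IterDerived A α B

/-- `α` is a Cantor-Bendixson rank of `A`: a smallest ordinal `α` with `(A^(α))' = ∅`. -/
def IsCBRank (A : ASet) (α : Ord) : Prop :=
  (∃ B, IterDerived A α B ∧ derived B = empty) ∧
    ∀ β : Ord, (∃ B, IterDerived A β B ∧ derived B = empty) →
      OLe α.rel α.carrier β.rel β.carrier

/-- `D` is the Cantor-Bendixson degree of `A`: the set `A^(α)`, where `α` is a Cantor-Bendixson
rank of `A`. -/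
def IsCBDegree (A D : ASet) : Prop := ∃ α, IsCBRank A α ∧ IterDerived A α D

/-! Cardinals and cofinality -/

/-- `κ`, ordered by `R`, is a well-ordered cardinal: an ordinal that is not of the same cardinality
as any of its proper initial segments. -/
def IsWOCardinal (R κ : ASet) : Prop :=
  WellOrders R κ ∧ ∀ S, IsProperInitialSegment R κ S → ¬ CEq κ S

/-- A cardinal is a well-ordered cardinal or a set that cannot be well-ordered. -/
def IsCardinal (κ : ASet) : Prop := (∃ R, IsWOCardinal R κ) ∨ ¬ WellOrderable κ

/-- `μ` is a predecessor of the cardinal `κ`. -/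
def IsCardPred (μ κ : ASet) : Prop :=
  IsCardinal μ ∧ CLt μ κ ∧ ¬ ∃ ν, IsCardinal ν ∧ CLt μ ν ∧ CLt ν κ

/-- A limit cardinal is a nonempty cardinal without a predecessor. -/
def IsLimitCardinal (κ : ASet) : Prop :=
  IsCardinal κ ∧ Nonempty κ ∧ ¬ ∃ μ, IsCardPred μ κ

/-- `S` is the sum of the indexed system of sets `I = {(j, A_j) | j ∈ J}`, that is, the union of the
sets `{j} × A_j`. -/
def IsSum (I S : ASet) : Prop :=
  ∀ z, z ∈ S ↔ ∃ j A a, opair j A ∈ I ∧ a ∈ A ∧ z = opair j a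

/-- `κ =_c ∑_{j ∈ J} A_j` for some indexed system of sets `A_j <_c κ`, `j ∈ J`. -/
def IsSumOfSmaller (κ J : ASet) : Prop :=
  ∃ I 𝓕 S, IsFunction I J 𝓕 ∧ (∀ j A, opair j A ∈ I → CLt A κ) ∧ IsSum I S ∧ CEq κ S

/-- `L = cf(κ)`, where `κ` is ordered by `R`: the shortest initial segment `L` of `κ` such that `κ`
is of the same cardinality as a sum, indexed by `L`, of sets of smaller cardinality. -/
def IsCofinality (R κ L : ASet) : Prop :=
  IsInitialSegment R κ L ∧ IsSumOfSmaller κ L ∧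
    ∀ M, IsInitialSegment R κ M → IsSumOfSmaller κ M → OLe R L R M

/-- `cf(κ)` exists and `cf(κ) =_o B`, where `κ` is ordered by `R` and `B` is ordered by `Q`. -/
def CofinalityEq (R κ Q B : ASet) : Prop :=
  (∃! L, IsCofinality R κ L) ∧ ∀ L, IsCofinality R κ L → OEq R L Q B

end AS

namespace AS

open Set Topology Filter Order

/-! The universe is an inverse limit of finite discrete spaces, hence compact, Hausdorff and
zero-dimensional. Sets correspond to its closed subsets (`pts_injective`, `pts_ofSet`) and functions
between sets to continuous maps, since graphs are closed in a compact space. So `A ≤_c B` says that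
a continuous injection exists. A well-ordered set is a compact order with its order topology; its
order type is zero or a successor, and its derivative of order `o` keeps only positions `≥ o`, so it
is scattered (`WOSet.le_pos_of_mem_iter`). The ordinals of the theory thus omit limit order types,
and `idx` translates between them and the usual indexing of derivatives.

For scattered closed sets, cardinality is decided by `cbKey`: the rank, then the number of points of
the degree, compared lexicographically (`embeds_iff`). Continuous injections respect derivatives,
which is one direction. The other embeds clopen pieces of one set into annuli shrinking to a point
of the other, by transfinite induction (`embeds_of_iter_subset_singleton`).

If the degree of `κ` has two points, a clopen cut between them gives two parts, each with fewer
points of the degree and hence smaller; a single summand never suffices, so the cofinality is `2`.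
If the degree is `{m}`, every smaller set has empty derivative of order `rk κ`. An indexed system is
a continuous map on its index set. Over a finite index set each summand is open in the sum, so the
image of `m` would lie in that derivative of a summand, which is impossible. Over `ω`, the slices of
points that first differ from `m` at a given level, each with `m` added, are smaller than `κ`,
converge to `{m}`, and have a sum equinumerous to `κ`.

For limit cardinals: a degree with at least two points can be lowered by exactly one point inside an
initial segment, which gives a predecessor. If the degree is a point and the rank is positive, a
smaller `μ` has smaller rank, and some proper initial segment of `κ` contains more points of the
derivative of order `rk μ` than the degree of `μ` has, so a cardinal fits between. -/

instance HF.instFinite : (n : ℕ) → Finite (HF n)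
  | 0 => inferInstanceAs (Finite Unit)
  | n + 1 => by
    have := HF.instFinite n
    exact inferInstanceAs (Finite (Set (HF n)))

/-! ### The universe as a compact space and sets as its closed subsets -/

instance (n : ℕ) : TopologicalSpace (HF n) := ⊥

instance (n : ℕ) : DiscreteTopology (HF n) := ⟨rfl⟩

/-- The universe of sets, topologized by the neighbourhoods `{y | F(n, y) = F(n, x)}`. -/
instance : TopologicalSpace ASet := TopologicalSpace.induced ASet.approx inferInstance

theorem isInducing_approx : IsInducing ASet.approx := ⟨rfl⟩

theorem approx_injective : Function.Injective ASet.approx := fun _ _ h => ASet.ext h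

theorem isEmbedding_approx : IsEmbedding ASet.approx := ⟨isInducing_approx, approx_injective⟩

theorem continuous_approx (n : ℕ) : Continuous fun x : ASet => x.approx n :=
  (continuous_apply n).comp isInducing_approx.continuous

theorem range_approx :
    range ASet.approx = {s : ∀ n, HF n | ∀ n, HF.trunc n (s (n + 1)) = s n} := by
  ext s
  exact ⟨fun ⟨x, hx⟩ => hx ▸ x.coherent, fun h => ⟨⟨s, h⟩, rfl⟩⟩

/-- Coherence is a closed condition in a product of finite discrete spaces, so the universe inherits
compactness from Tychonoff's theorem. -/
theorem isClosedEmbedding_approx : IsClosedEmbedding ASet.approx := by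
  refine ⟨isEmbedding_approx, ?_⟩
  rw [range_approx, ofPred_forall]
  exact isClosed_iInter fun n => isClosed_eq
    ((continuous_of_discreteTopology (f := HF.trunc n)).comp (continuous_apply (n + 1)))
    (continuous_apply n)

instance : CompactSpace ASet := isClosedEmbedding_approx.compactSpace

instance : T2Space ASet := isEmbedding_approx.t2Space

/-- The neighbourhood `{y | F(n, y) = F(n, x)}` of `x`. -/
def nbhd (n : ℕ) (x : ASet) : Set ASet := {y | y.approx n = x.approx n}

theorem mem_nbhd_self (n : ℕ) (x : ASet) : x ∈ nbhd n x := rfl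

theorem isClopen_nbhd (n : ℕ) (x : ASet) : IsClopen (nbhd n x) :=
  (isClopen_discrete {x.approx n}).preimage (continuous_approx n)

theorem nbhd_mem_nhds (n : ℕ) (x : ASet) : nbhd n x ∈ 𝓝 x :=
  (isClopen_nbhd n x).isOpen.mem_nhds (mem_nbhd_self n x)

theorem nbhd_anti {m n : ℕ} (h : m ≤ n) (x : ASet) : nbhd n x ⊆ nbhd m x :=
  fun _ hy => approx_eq_of_le h hy

theorem mem_nhds_iff_nbhd {x : ASet} {U : Set ASet} : U ∈ 𝓝 x ↔ ∃ n, nbhd n x ⊆ U := by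
  refine ⟨fun h => ?_, fun ⟨n, hn⟩ => mem_of_superset (nbhd_mem_nhds n x) hn⟩
  rw [isInducing_approx.nhds_eq_comap, nhds_pi, mem_comap] at h
  obtain ⟨t, ht, htU⟩ := h
  rw [Filter.mem_pi] at ht
  obtain ⟨I, hI, s, hs, hst⟩ := ht
  obtain ⟨n, hn⟩ := hI.bddAbove
  refine ⟨n, fun y hy => htU (hst fun i hi => ?_)⟩
  rw [show y.approx i = x.approx i from approx_eq_of_le (hn hi) hy]
  exact mem_of_mem_nhds (hs i)

theorem exists_approx_ne {x y : ASet} (h : x ≠ y) : ∃ n, x.approx n ≠ y.approx n := by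
  by_contra! hc
  exact h (ASet.ext (funext hc))

theorem approx_surjective : ∀ n, Function.Surjective fun x : ASet => x.approx n
  | 0 => fun _ => ⟨empty, rfl⟩
  | n + 1 => fun s => by
    refine ⟨smallest fun x => x.approx n ∈ s.elems, ?_⟩
    change {a | ∃ x : ASet, x.approx n ∈ s.elems ∧ x.approx n = a} = s.elems
    ext a
    refine ⟨fun ⟨x, hx, h⟩ => h ▸ hx, fun ha => ?_⟩
    obtain ⟨x, hx⟩ := approx_surjective n a
    exact ⟨x, (show x.approx n = a from hx).symm ▸ ha, hx⟩

/-- The elements of a set. -/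
def pts (A : ASet) : Set ASet := {x | x ∈ A}

@[simp] theorem mem_pts {A x : ASet} : x ∈ pts A ↔ x ∈ A := Iff.rfl

theorem isClosed_pts (A : ASet) : IsClosed (pts A) := by
  have : pts A = ⋂ n, (fun x : ASet => x.approx n) ⁻¹' (A.approx (n + 1)).elems := by
    ext x
    simp only [mem_iInter]
    rfl
  rw [this]
  exact isClosed_iInter fun n => (isClosed_discrete _).preimage (continuous_approx n)

theorem isCompact_pts (A : ASet) : IsCompact (pts A) := (isClosed_pts A).isCompact

theorem exists_lift {A : ASet} {n : ℕ} {b : HF n} (hb : b ∈ (A.approx (n + 1)).elems) :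
    ∃ b' ∈ (A.approx (n + 2)).elems, HF.trunc n b' = b := by
  have h := A.coherent (n + 1)
  have h' : b ∈ HF.trunc n '' (A.approx (n + 2)).elems := by
    have : HF.trunc n '' (A.approx (n + 2)).elems = (A.approx (n + 1)).elems := h
    rwa [this]
  exact h'

/-- König's lemma: each node of the tree of `A` extends by one level, and compactness turns
arbitrarily long finite extensions into an infinite path. -/
theorem exists_mem_of_mem_approx {A : ASet} {n : ℕ} {a : HF n}
    (ha : a ∈ (A.approx (n + 1)).elems) : ∃ x ∈ A, x.approx n = a := by
  let C : ℕ → Set ASet := fun k =>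
    {y | y.approx (n + k) ∈ (A.approx (n + k + 1)).elems ∧ y.approx n = a}
  have key : (⋂ k, C k).Nonempty := by
    refine IsCompact.nonempty_iInter_of_sequence_nonempty_isCompact_isClosed C ?_ ?_ ?_ ?_
    · rintro k y ⟨hy, hya⟩
      refine ⟨?_, hya⟩
      have h : HF.trunc (n + k) '' (A.approx (n + k + 2)).elems = (A.approx (n + k + 1)).elems :=
        A.coherent (n + k + 1)
      rw [← h, ← y.coherent]
      exact ⟨_, hy, rfl⟩
    · intro k
      induction k with
      | zero =>
        obtain ⟨y, hy⟩ := approx_surjective n a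
        exact ⟨y, by simpa [← hy] using ha, hy⟩
      | succ k ih =>
        obtain ⟨y, hy, hya⟩ := ih
        obtain ⟨b, hb, hby⟩ := exists_lift hy
        obtain ⟨z, hz⟩ := approx_surjective (n + k + 1) b
        refine ⟨z, (show z.approx (n + k + 1) = b from hz).symm ▸ hb, ?_⟩
        rw [← hya]
        refine approx_eq_of_le (Nat.le_add_right n k) ?_
        rw [← hby, ← hz]
        exact (z.coherent _).symm
    · refine IsClosed.isCompact ?_
      exact ((isClosed_discrete _).preimage (continuous_approx (n + 0))).inter
        ((isClosed_discrete {a}).preimage (continuous_approx n))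
    · intro k
      exact ((isClosed_discrete _).preimage (continuous_approx (n + k))).inter
        ((isClosed_discrete {a}).preimage (continuous_approx n))
  obtain ⟨x, hx⟩ := key
  rw [mem_iInter] at hx
  refine ⟨x, fun k => ?_, (hx 0).2⟩
  have h := (hx k).1
  have down : ∀ m j, x.approx (j + m) ∈ (A.approx (j + m + 1)).elems →
      x.approx j ∈ (A.approx (j + 1)).elems := by
    intro m
    induction m with
    | zero => exact fun j h => h
    | succ m ih =>
      intro j hj
      refine ih j ?_
      have h : HF.trunc (j + m) '' (A.approx (j + m + 2)).elems = (A.approx (j + m + 1)).elems :=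
        A.coherent (j + m + 1)
      rw [← h, ← x.coherent]
      exact ⟨_, hj, rfl⟩
  refine down n k ?_
  rw [Nat.add_comm k n]
  exact h

theorem elems_approx_succ (A : ASet) (n : ℕ) :
    (A.approx (n + 1)).elems = (fun x : ASet => x.approx n) '' pts A :=
  Subset.antisymm (fun _ ha => exists_mem_of_mem_approx ha) (image_subset_iff.2 fun _ hx => hx n)

theorem pts_injective : Function.Injective pts := by
  intro A B h
  refine ASet.ext (funext fun n => ?_)
  cases n with
  | zero => rfl
  | succ n =>
    change (A.approx (n + 1)).elems = (B.approx (n + 1)).elems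
    rw [elems_approx_succ, elems_approx_succ, h]

theorem ext_iff_mem {A B : ASet} : A = B ↔ ∀ x, x ∈ A ↔ x ∈ B :=
  ⟨fun h _ => h ▸ Iff.rfl, fun h => pts_injective (Set.ext h)⟩

/-- The smallest set that contains the elements of `C`. -/
def ofSet (C : Set ASet) : ASet := smallest (· ∈ C)

/-- Being approximated at every level by elements of `C` means lying in the closure of `C`. Hence
every closed class is a set. -/
theorem pts_ofSet {C : Set ASet} (hC : IsClosed C) : pts (ofSet C) = C := by
  ext x
  refine ⟨fun h => ?_, fun h n => ⟨x, h, rfl⟩⟩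
  rw [← hC.closure_eq, mem_closure_iff_nhds]
  intro U hU
  obtain ⟨n, hn⟩ := mem_nhds_iff_nbhd.1 hU
  obtain ⟨y, hy, hyx⟩ := mem_smallest.1 h n
  exact ⟨y, hn hyx, hy⟩

theorem mem_ofSet {C : Set ASet} (hC : IsClosed C) {x : ASet} : x ∈ ofSet C ↔ x ∈ C := by
  rw [← mem_pts, pts_ofSet hC]

theorem ofSet_pts (A : ASet) : ofSet (pts A) = A := pts_injective (pts_ofSet (isClosed_pts A))

@[simp] theorem pts_empty : pts empty = ∅ := eq_empty_of_forall_notMem notMem_empty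

theorem pts_derived (A : ASet) : pts (derived A) = derivedSet (pts A) := by
  ext x
  rw [mem_pts, mem_derived, mem_derivedSet, accPt_iff_nhds]
  constructor
  · intro h U hU
    obtain ⟨n, hn⟩ := mem_nhds_iff_nbhd.1 hU
    obtain ⟨y, hyA, hyx, hy⟩ := h n
    exact ⟨y, ⟨hn hy, hyA⟩, hyx⟩
  · intro h n
    obtain ⟨y, ⟨hy, hyA⟩, hyx⟩ := h _ (nbhd_mem_nhds n x)
    exact ⟨y, hyA, hyx, hy⟩

/-! Pairs -/

theorem pair_congr {a a' b b' : ASet} {n : ℕ} (ha : a.approx n = a'.approx n)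
    (hb : b.approx n = b'.approx n) : (pair a b).approx n = (pair a' b').approx n := by
  refine approx_eq_of_le (Nat.le_succ n) ?_
  change {c | ∃ x, (x = a ∨ x = b) ∧ ASet.approx x n = c} =
    {c | ∃ x, (x = a' ∨ x = b') ∧ ASet.approx x n = c}
  simp only [or_and_right, exists_or, exists_eq_left, ha, hb]

theorem opair_congr {a a' b b' : ASet} {n : ℕ} (ha : a.approx n = a'.approx n)
    (hb : b.approx n = b'.approx n) : (opair a b).approx n = (opair a' b').approx n :=
  pair_congr (pair_congr ha ha) (pair_congr ha hb)

theorem pair_eq_pair {a b c d : ASet} :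
    pair a b = pair c d ↔ (a = c ∧ b = d) ∨ (a = d ∧ b = c) := by
  constructor
  · intro h
    have h1 : a = c ∨ a = d := mem_pair.1 (h ▸ mem_pair.2 (Or.inl rfl))
    have h2 : b = c ∨ b = d := mem_pair.1 (h ▸ mem_pair.2 (Or.inr rfl))
    have h3 : c = a ∨ c = b := mem_pair.1 (h ▸ mem_pair.2 (Or.inl rfl))
    have h4 : d = a ∨ d = b := mem_pair.1 (h ▸ mem_pair.2 (Or.inr rfl))
    grind
  · rintro (⟨rfl, rfl⟩ | ⟨rfl, rfl⟩)
    · rfl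
    · exact ext_iff_mem.2 fun x => by rw [mem_pair, mem_pair, or_comm]

theorem opair_inj {a b c d : ASet} : opair a b = opair c d ↔ a = c ∧ b = d := by
  refine ⟨fun h => ?_, fun ⟨h, h'⟩ => by rw [h, h']⟩
  rw [opair, opair, pair_eq_pair, pair_eq_pair, pair_eq_pair, pair_eq_pair, pair_eq_pair] at h
  grind

/-- The ordered pair as a function on the product. -/
def opairMap (p : ASet × ASet) : ASet := opair p.1 p.2

theorem opairMap_injective : Function.Injective opairMap := fun _ _ h =>
  Prod.ext (opair_inj.1 h).1 (opair_inj.1 h).2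

theorem continuous_opairMap : Continuous opairMap := by
  refine continuous_iff_continuousAt.2 fun p => ?_
  intro U hU
  obtain ⟨n, hn⟩ := mem_nhds_iff_nbhd.1 hU
  refine mem_map.2 (mem_of_superset (x := nbhd n p.1 ×ˢ nbhd n p.2)
    (prod_mem_nhds (nbhd_mem_nhds n p.1) (nbhd_mem_nhds n p.2)) ?_)
  exact fun q hq => hn (opair_congr hq.1 hq.2)

theorem isClosedEmbedding_opairMap : IsClosedEmbedding opairMap :=
  continuous_opairMap.isClosedEmbedding opairMap_injective

/-- The graph of a relation. -/
def pairs (R : ASet) : Set (ASet × ASet) := {p | opair p.1 p.2 ∈ R}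

theorem isClosed_pairs (R : ASet) : IsClosed (pairs R) :=
  (isClosed_pts R).preimage continuous_opairMap

/-- The relation with a given graph. -/
def ofPairs (G : Set (ASet × ASet)) : ASet := ofSet (opairMap '' G)

theorem mem_ofPairs {G : Set (ASet × ASet)} (hG : IsClosed G) {x : ASet} :
    x ∈ ofPairs G ↔ ∃ p ∈ G, opair p.1 p.2 = x :=
  mem_ofSet (isClosedEmbedding_opairMap.isClosedMap G hG)

theorem opair_mem_ofPairs {G : Set (ASet × ASet)} (hG : IsClosed G) {a b : ASet} :
    opair a b ∈ ofPairs G ↔ (a, b) ∈ G := by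
  rw [mem_ofPairs hG]
  constructor
  · rintro ⟨⟨c, d⟩, hp, h⟩
    obtain ⟨rfl, rfl⟩ := opair_inj.1 h
    exact hp
  · exact fun h => ⟨_, h, rfl⟩

/-! Functions -/

/-- The closed graph theorem for compact spaces: the preimage of a closed set is the projection of a
compact part of the graph. -/
theorem IsFunction.exists_continuousOn {f A B : ASet} (hf : IsFunction f A B) :
    ∃ F : ASet → ASet, ContinuousOn F (pts A) ∧ MapsTo F (pts A) (pts B) ∧
      ∀ a b, opair a b ∈ f ↔ a ∈ A ∧ F a = b := by
  classical
  choose! F hF using hf.total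
  have hFf : ∀ a b, opair a b ∈ f ↔ a ∈ A ∧ F a = b := by
    refine fun a b => ⟨fun h => ?_, fun ⟨h, h'⟩ => h' ▸ (hF a h).2⟩
    obtain ⟨a', b', ha', -, h'⟩ := hf.relation _ h
    obtain ⟨rfl, rfl⟩ := opair_inj.1 h'
    exact ⟨ha', hf.functional _ _ _ (hF a ha').2 h⟩
  refine ⟨F, ?_, fun a ha => (hF a ha).1, hFf⟩
  refine continuousOn_iff_isClosed.2 fun t ht => ⟨Prod.fst '' (pairs f ∩ univ ×ˢ t), ?_, ?_⟩
  · exact (((isClosed_pairs f).inter (isClosed_univ.prod ht)).isCompact.image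
      continuous_fst).isClosed
  · ext a
    constructor
    · rintro ⟨h, ha⟩
      exact ⟨⟨(a, F a), ⟨(hFf _ _).2 ⟨ha, rfl⟩, trivial, h⟩, rfl⟩, ha⟩
    · rintro ⟨⟨⟨a, b⟩, ⟨h, -, hb⟩, rfl⟩, ha⟩
      exact ⟨mem_preimage.2 (((hFf a b).1 h).2.symm ▸ hb), ha⟩

/-- The graph is a continuous image of the compact `pts A`, hence closed, hence a set. -/
theorem isFunction_ofPairs {F : ASet → ASet} {A B : ASet} (hc : ContinuousOn F (pts A))
    (hm : MapsTo F (pts A) (pts B)) :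
    ∃ f, IsFunction f A B ∧ ∀ a b, opair a b ∈ f ↔ a ∈ A ∧ F a = b := by
  have hG : IsClosed ((fun a => (a, F a)) '' pts A) :=
    ((isCompact_pts A).image_of_continuousOn (continuousOn_id.prodMk hc)).isClosed
  have key : ∀ a b, opair a b ∈ ofPairs ((fun a => (a, F a)) '' pts A) ↔ a ∈ A ∧ F a = b := by
    intro a b
    rw [opair_mem_ofPairs hG]
    simp only [mem_image, mem_pts, Prod.mk.injEq]
    grind
  refine ⟨_, ⟨?_, fun a ha => ⟨F a, hm ha, (key _ _).2 ⟨ha, rfl⟩⟩, ?_⟩, key⟩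
  · intro p hp
    obtain ⟨_, ⟨a, ha, rfl⟩, rfl⟩ := (mem_ofPairs hG).1 hp
    exact ⟨a, F a, ha, hm ha, rfl⟩
  · intro a b b' h h'
    exact ((key _ _).1 h).2.symm.trans ((key _ _).1 h').2

theorem cLe_iff {A B : ASet} : CLe A B ↔
    ∃ F : ASet → ASet, ContinuousOn F (pts A) ∧ InjOn F (pts A) ∧ MapsTo F (pts A) (pts B) := by
  constructor
  · rintro ⟨f, hf⟩
    obtain ⟨F, hc, hm, hF⟩ := hf.exists_continuousOn
    refine ⟨F, hc, fun a ha b hb hab => ?_, hm⟩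
    exact hf.injective a b (F b) ((hF _ _).2 ⟨ha, hab⟩) ((hF _ _).2 ⟨hb, rfl⟩)
  · rintro ⟨F, hc, hi, hm⟩
    obtain ⟨f, hf, hF⟩ := isFunction_ofPairs hc hm
    refine ⟨f, hf, fun a a' b h h' => ?_⟩
    obtain ⟨ha, rfl⟩ := (hF _ _).1 h
    obtain ⟨ha', h''⟩ := (hF _ _).1 h'
    exact hi ha ha' h''.symm

theorem CLe.of_sub {A B : ASet} (h : Sub A B) : CLe A B :=
  cLe_iff.2 ⟨id, continuousOn_id, injOn_id _, h⟩

/-! Iterated derived sets -/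

section Iter

variable {X Y : Type*} [TopologicalSpace X] [TopologicalSpace Y]

/-- The iterated derived sets of a subset of a topological space. -/
def iter (A : Set X) (o : Ordinal.{0}) : Set X :=
  {x | x ∈ A ∧ ∀ γ, ∀ _h : γ < o, x ∈ derivedSet (iter A γ)}
termination_by o

theorem mem_iter {A : Set X} {o : Ordinal.{0}} {x : X} :
    x ∈ iter A o ↔ x ∈ A ∧ ∀ γ < o, x ∈ derivedSet (iter A γ) := by
  rw [iter]
  rfl

theorem iter_subset (A : Set X) (o : Ordinal.{0}) : iter A o ⊆ A := fun _ h => (mem_iter.1 h).1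

@[simp] theorem iter_zero (A : Set X) : iter A 0 = A := by
  ext x
  rw [mem_iter]
  exact ⟨fun h => h.1, fun h => ⟨h, fun γ hγ => absurd hγ (not_lt_of_ge (zero_le))⟩⟩

theorem iter_anti (A : Set X) {o o' : Ordinal.{0}} (h : o ≤ o') : iter A o' ⊆ iter A o :=
  fun _ hx => mem_iter.2 ⟨iter_subset A _ hx, fun γ hγ => (mem_iter.1 hx).2 γ (hγ.trans_le h)⟩

/-- Closedness of `A` keeps accumulation points inside `A`, which `iter` demands at every stage. -/
theorem iter_succ {A : Set X} (hA : IsClosed A) (o : Ordinal.{0}) :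
    iter A (succ o) = derivedSet (iter A o) := by
  ext x
  constructor
  · exact fun h => (mem_iter.1 h).2 o (lt_succ o)
  · refine fun h => mem_iter.2 ⟨?_, fun γ hγ => derivedSet_mono _ _ (iter_anti A (lt_succ_iff.1 hγ)) h⟩
    exact (isClosed_iff_derivedSet_subset A).1 hA (derivedSet_mono _ _ (iter_subset A o) h)

theorem iter_limit {A : Set X} {o : Ordinal.{0}} (ho : IsSuccLimit o) :
    iter A o = ⋂ γ < o, iter A γ := by
  ext x
  simp only [mem_iInter]
  constructor
  · exact fun h γ hγ => iter_anti A hγ.le h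
  · intro h
    refine mem_iter.2 ⟨iter_subset A 0 (h 0 (by simpa using ho.bot_lt)), fun γ hγ => ?_⟩
    exact (mem_iter.1 (h _ (ho.succ_lt hγ))).2 γ (lt_succ γ)

theorem isClosed_iter [T1Space X] {A : Set X} (hA : IsClosed A) (o : Ordinal.{0}) :
    IsClosed (iter A o) := by
  have : iter A o = A ∩ ⋂ γ < o, derivedSet (iter A γ) := by
    ext x
    simp only [mem_inter_iff, mem_iInter]
    exact mem_iter
  rw [this]
  exact hA.inter (isClosed_iInter fun γ => isClosed_iInter fun _ => isClosed_derivedSet _)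

/-- Accumulation is a local property. This is what lets sets be cut into clopen pieces without
disturbing their derivatives. -/
theorem iter_inter_open (A : Set X) {U : Set X} (hU : IsOpen U) (o : Ordinal.{0}) :
    iter (A ∩ U) o = iter A o ∩ U := by
  induction o using WellFoundedLT.induction with
  | ind o ih =>
    ext x
    rw [mem_iter, mem_inter_iff, mem_inter_iff, mem_iter]
    have key : x ∈ U → ∀ γ < o, (x ∈ derivedSet (iter (A ∩ U) γ) ↔ x ∈ derivedSet (iter A γ)) := by
      intro hx γ hγ
      rw [ih γ hγ, mem_derivedSet, mem_derivedSet, accPt_iff_nhds, accPt_iff_nhds]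
      constructor
      · intro h V hV
        obtain ⟨y, hy, hyx⟩ := h V hV
        exact ⟨y, ⟨hy.1, hy.2.1⟩, hyx⟩
      · intro h V hV
        obtain ⟨y, hy, hyx⟩ := h (V ∩ U) (inter_mem hV (hU.mem_nhds hx))
        exact ⟨y, ⟨hy.1.1, hy.2, hy.1.2⟩, hyx⟩
    constructor
    · exact fun ⟨⟨hA, hx⟩, h⟩ => ⟨⟨hA, fun γ hγ => (key hx γ hγ).1 (h γ hγ)⟩, hx⟩
    · exact fun ⟨⟨hA, h⟩, hx⟩ => ⟨⟨hA, hx⟩, fun γ hγ => (key hx γ hγ).2 (h γ hγ)⟩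

/-- Continuous injections map iterated derived sets into iterated derived sets. -/
theorem map_mem_iter {A : Set X} {B : Set Y} {f : X → Y} (hc : ContinuousOn f A) (hi : InjOn f A)
    (hm : MapsTo f A B) (o : Ordinal.{0}) : ∀ x ∈ iter A o, f x ∈ iter B o := by
  induction o using WellFoundedLT.induction with
  | ind o ih =>
    intro x hx
    have hxA := iter_subset A o hx
    refine mem_iter.2 ⟨hm hxA, fun γ hγ => ?_⟩
    have h := (mem_iter.1 hx).2 γ hγ
    rw [mem_derivedSet, accPt_iff_nhds] at h ⊢
    intro U hU
    obtain ⟨V, hV, hVU⟩ := mem_nhdsWithin_iff_exists_mem_nhds_inter.1 (hc x hxA hU)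
    obtain ⟨y, ⟨hyV, hy⟩, hyx⟩ := h V hV
    have hyA := iter_subset A γ hy
    exact ⟨f y, ⟨hVU ⟨hyV, hyA⟩, ih γ hγ y hy⟩, fun h => hyx (hi hyA hxA h)⟩

theorem finite_of_derivedSet_eq_empty [CompactSpace X] [T1Space X] {A : Set X} (hA : IsClosed A)
    (h : derivedSet A = ∅) : A.Finite := by
  by_contra hi
  obtain ⟨x, -, hx⟩ := Set.Infinite.exists_accPt_of_subset_isCompact (K := A) hi hA.isCompact le_rfl
  exact (h ▸ (mem_derivedSet.2 hx) : x ∈ (∅ : Set X))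

theorem derivedSet_eq_empty_of_finite [T1Space X] {A : Set X} (h : A.Finite) :
    derivedSet A = ∅ := by
  refine eq_empty_of_forall_notMem fun x hx => ?_
  have hx' := accPt_iff_nhds.1 (mem_derivedSet.1 hx)
  obtain ⟨y, ⟨hy, hyA⟩, hyx⟩ := hx' (A \ {x})ᶜ
    ((h.subset sdiff_subset).isClosed.isOpen_compl.mem_nhds fun h => h.2 rfl)
  exact hy ⟨hyA, hyx⟩

end Iter

/-! Embeddings -/

/-- There is a continuous injection from `A` to `B`. -/
def Embeds (A B : Set ASet) : Prop :=
  ∃ f : ASet → ASet, ContinuousOn f A ∧ InjOn f A ∧ MapsTo f A B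

theorem cLe_iff_embeds {A B : ASet} : CLe A B ↔ Embeds (pts A) (pts B) := cLe_iff

instance : Inhabited (Σ n, HF n) := ⟨⟨0, ()⟩⟩

/-- A point other than `x` leaves the derivatives before stage `β`, so a basic clopen neighbourhood
of it meets some earlier derivative in at most that point. There are countably many basic sets, so
the suitable ones can be made disjoint. -/
theorem exists_clopen_partition {X : Set ASet} {x : ASet} {β : Ordinal.{0}} (hβ : 0 < β)
    (hX : iter X β ⊆ {x}) :
    ∃ V : ℕ → Set ASet, (∀ k, IsClopen (V k)) ∧ Pairwise (Function.onFun Disjoint V) ∧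
      (∀ k, x ∉ V k) ∧ (∀ y ∈ X, y ≠ x → ∃ k, y ∈ V k) ∧
      ∀ k, ∃ γ < β, ∃ z, iter (X ∩ V k) γ ⊆ {z} := by
  classical
  obtain ⟨e, he⟩ := exists_surjective_nat (Σ n, HF n)
  let W : (Σ n, HF n) → Set ASet := fun c => {y | y.approx c.1 = c.2}
  have hW : ∀ c, IsClopen (W c) := fun c =>
    (isClopen_discrete {c.2}).preimage (continuous_approx c.1)
  let good : Set ASet → Prop := fun U => x ∉ U ∧ ∃ γ < β, ∃ z, iter X γ ∩ U ⊆ {z}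
  let U : ℕ → Set ASet := fun k => if good (W (e k)) then W (e k) else ∅
  have hU : ∀ k, IsClopen (U k) := by
    intro k
    by_cases h : good (W (e k))
    · simpa [U, h] using hW _
    · simp [U, h, isClopen_empty]
  have hUg : ∀ k, good (U k) := by
    intro k
    by_cases h : good (W (e k))
    · simp [U, h]
    · simp only [U, h, if_false]
      -- Unsuitable basic sets were replaced by `∅`, for which stage `0` serves; this needs `0 < β`.
      exact ⟨id, 0, hβ, x, by simp⟩
  have hV : ∀ k, IsClopen (disjointed U k) := fun k =>
    disjointedRec (p := IsClopen) (fun t i ht => ht.diff (hU i)) (hU k)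
  refine ⟨disjointed U, hV, disjoint_disjointed U,
    fun k h => (hUg k).1 (disjointed_le U k h), ?_, ?_⟩
  · intro y hy hyx
    have : y ∈ ⋃ k, U k := by
      have hyn : y ∉ iter X β := fun h => hyx (hX h)
      rw [mem_iter] at hyn
      push Not at hyn
      obtain ⟨γ, hγ, h⟩ := hyn hy
      rw [mem_derivedSet, accPt_iff_nhds] at h
      push Not at h
      obtain ⟨T, hT, hTy⟩ := h
      obtain ⟨n, hn⟩ := mem_nhds_iff_nbhd.1 hT
      obtain ⟨m, hm⟩ := exists_approx_ne hyx
      obtain ⟨k, hk⟩ := he ⟨max n m, y.approx (max n m)⟩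
      have hg : good (W (e k)) := by
        rw [hk]
        refine ⟨fun h => hm (approx_eq_of_le (le_max_right n m) h).symm, γ, hγ, y, ?_⟩
        rintro z ⟨hz, hzy⟩
        exact hTy z ⟨hn (approx_eq_of_le (le_max_left n m) hzy), hz⟩
      refine mem_iUnion.2 ⟨k, ?_⟩
      simp only [U, hg, if_true]
      rw [hk]
      rfl
    rw [← iUnion_disjointed] at this
    exact mem_iUnion.1 this
  · intro k
    obtain ⟨-, γ, hγ, z, h⟩ := hUg k
    refine ⟨γ, hγ, z, ?_⟩
    rw [iter_inter_open X (hV k).isOpen]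
    exact (inter_subset_inter_right _ (disjointed_le U k)).trans h

/-- Since `p` accumulates every earlier derivative, each neighbourhood of `p` contains a point `q ≠
p` of the required derivative, and a smaller neighbourhood excludes `q`. Iterating this choice
yields the annuli. -/
theorem exists_annuli {Y : Set ASet} {p : ASet} {β : Ordinal.{0}} (hp : p ∈ iter Y β)
    (γ : ℕ → Ordinal.{0}) (hγ : ∀ k, γ k < β) :
    ∃ W : ℕ → Set ASet, Pairwise (Function.onFun Disjoint W) ∧ (∀ k, p ∉ W k) ∧
      (∀ k, W k ⊆ nbhd k p) ∧ ∀ k, ∃ q, q ∈ iter (Y ∩ W k) (γ k) := by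
  have h1 : ∀ k m, ∃ m', m < m' ∧ ∃ q ∈ iter Y (γ k), q ∈ nbhd m p ∧ q ∉ nbhd m' p := by
    intro k m
    have h := accPt_iff_nhds.1 (mem_derivedSet.1 ((mem_iter.1 hp).2 _ (hγ k)))
    obtain ⟨q, ⟨hqm, hq⟩, hqp⟩ := h _ (nbhd_mem_nhds m p)
    obtain ⟨j, hj⟩ := exists_approx_ne hqp
    refine ⟨max (m + 1) j, lt_max_of_lt_left (Nat.lt_succ_self m), q, hq, hqm, fun h => ?_⟩
    exact hj (approx_eq_of_le (le_max_right _ _) h)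
  choose next hnext q hq hqm hqn using h1
  let m : ℕ → ℕ := fun k => Nat.rec 0 (fun k m => next k m) k
  have hm : StrictMono m := strictMono_nat_of_lt_succ fun k => hnext k (m k)
  have hopen : ∀ k, IsOpen (nbhd (m k) p \ nbhd (m (k + 1)) p) := fun k =>
    ((isClopen_nbhd _ _).diff (isClopen_nbhd _ _)).isOpen
  refine ⟨fun k => nbhd (m k) p \ nbhd (m (k + 1)) p, ?_, ?_, ?_, ?_⟩
  · have key : ∀ i j, i < j → Disjoint (nbhd (m i) p \ nbhd (m (i + 1)) p)
        (nbhd (m j) p \ nbhd (m (j + 1)) p) := by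
      intro i j hij
      refine Set.disjoint_left.2 fun y hy hy' => hy.2 ?_
      exact nbhd_anti (hm.monotone hij) p hy'.1
    intro i j hij
    rcases lt_or_gt_of_ne hij with h | h
    · exact key i j h
    · exact (key j i h).symm
  · exact fun k h => h.2 (mem_nbhd_self _ _)
  · exact fun k => sdiff_subset.trans (nbhd_anti (hm.id_le k) p)
  · refine fun k => ⟨q k (m k), ?_⟩
    rw [iter_inter_open Y (hopen k)]
    exact ⟨hq _ _, hqm _ _, hqn _ _⟩

/-- Send `x` to `p` and, by induction, the `k`-th piece of the partition around `x` into the `k`-th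
annulus around `p`. The pieces have lower rank, and each annulus was chosen to have a point in the
derivative needed for its piece. -/
theorem embeds_of_iter_subset_singleton (β : Ordinal.{0}) : ∀ {X Y : Set ASet} {x p : ASet},
    iter X β ⊆ {x} → p ∈ iter Y β → Embeds X Y := by
  induction β using WellFoundedLT.induction with
  | ind β ih =>
    classical
    intro X Y x p hX hp
    rcases eq_or_ne β 0 with rfl | hβ
    · rw [iter_zero] at hX hp
      exact ⟨fun _ => p, continuousOn_const, fun a ha b hb _ => (hX ha).trans (hX hb).symm,
        fun _ _ => hp⟩
    obtain ⟨V, hVc, hVd, hxV, hcov, hγ⟩ := exists_clopen_partition (pos_of_ne_zero hβ) hX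
    choose γ hγβ z hz using hγ
    obtain ⟨W, hWd, hpW, hWn, hq⟩ := exists_annuli hp γ hγβ
    choose q hq using hq
    choose f hfc hfi hfm using fun k => ih (γ k) (hγβ k) (hz k) (hq k)
    choose! k hk using hcov
    let F : ASet → ASet := fun y => if y = x then p else f (k y) y
    have hFx : F x = p := if_pos rfl
    have hF : ∀ i, ∀ y ∈ X ∩ V i, F y = f i y := by
      intro i y ⟨hyX, hyV⟩
      have hyx : y ≠ x := fun h => hxV i (h ▸ hyV)
      have : k y = i := by
        by_contra hne
        exact Set.disjoint_left.1 (hVd hne) (hk y hyX hyx) hyV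
      simp [F, hyx, this]
    have hcase : ∀ y ∈ X, y = x ∨ ∃ i, y ∈ X ∩ V i := fun y hy => by
      by_cases h : y = x
      · exact Or.inl h
      · exact Or.inr ⟨k y, hy, hk y hy h⟩
    have hFW : ∀ i, ∀ y ∈ X ∩ V i, F y ∈ Y ∩ W i := fun i y hy => hF i y hy ▸ hfm i hy
    refine ⟨F, ?_, ?_, ?_⟩
    · intro y hy
      rcases hcase y hy with rfl | ⟨i, hi⟩
      · intro U hU
        rw [hFx] at hU
        obtain ⟨n, hn⟩ := mem_nhds_iff_nbhd.1 hU
        -- Continuity at the centre: avoiding the first `n` pieces forces the images into annuli of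
        -- index at least `n`, which lie in `nbhd n p`.
        have hN : (⋂ i ∈ Finset.range n, (V i)ᶜ) ∈ 𝓝 y :=
          (Filter.biInter_finset_mem _).2 fun i _ => (hVc i).compl.isOpen.mem_nhds (hxV i)
        refine mem_nhdsWithin_iff_exists_mem_nhds_inter.2 ⟨_, hN, ?_⟩
        rintro z ⟨hz, hzX⟩
        refine hn ?_
        rcases hcase z hzX with rfl | ⟨i, hi⟩
        · rw [hFx]
          exact mem_nbhd_self _ _
        · have hni : n ≤ i := by
            by_contra! h
            exact mem_iInter₂.1 hz i (Finset.mem_range.2 h) hi.2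
          exact nbhd_anti hni _ (hWn i (hFW i z hi).2)
      · have h1 : ContinuousWithinAt (f i) X y := by
          have := hfc i y hi
          rwa [continuousWithinAt_inter ((hVc i).isOpen.mem_nhds hi.2)] at this
        refine h1.congr_of_eventuallyEq ?_ (hF i y hi)
        filter_upwards [self_mem_nhdsWithin, mem_nhdsWithin_of_mem_nhds
          ((hVc i).isOpen.mem_nhds hi.2)] with a ha ha'
        exact hF i a ⟨ha, ha'⟩
    · intro a ha b hb hab
      rcases hcase a ha with rfl | ⟨i, hi⟩
      · rcases hcase b hb with rfl | ⟨j, hj⟩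
        · rfl
        · exact absurd (hFW j b hj).2 (by rw [← hab, hFx]; exact hpW j)
      · rcases hcase b hb with rfl | ⟨j, hj⟩
        · exact absurd (hFW i a hi).2 (by rw [hab, hFx]; exact hpW i)
        · have hij : i = j := by
            by_contra hne
            exact Set.disjoint_left.1 (hWd hne) (hFW i a hi).2 (hab ▸ (hFW j b hj).2)
          subst hij
          refine hfi i hi hj ?_
          rw [← hF i a hi, ← hF i b hj, hab]
    · intro y hy
      rcases hcase y hy with rfl | ⟨i, hi⟩
      · rw [hFx]
        exact iter_subset _ _ hp
      · exact (hFW i y hi).1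

theorem Embeds.glue {X Y U W : Set ASet} (hU : IsClopen U) (h1 : Embeds (X ∩ U) (Y ∩ W))
    (h2 : Embeds (X ∩ Uᶜ) (Y ∩ Wᶜ)) : Embeds X Y := by
  classical
  obtain ⟨f, hfc, hfi, hfm⟩ := h1
  obtain ⟨g, hgc, hgi, hgm⟩ := h2
  let F : ASet → ASet := U.piecewise f g
  have hFf : ∀ y ∈ U, F y = f y := fun y hy => piecewise_eq_of_mem _ _ _ hy
  have hFg : ∀ y ∈ Uᶜ, F y = g y := fun y hy => piecewise_eq_of_notMem _ _ _ hy
  refine ⟨F, ?_, ?_, ?_⟩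
  · intro y hy
    by_cases hyU : y ∈ U
    · have h1 : ContinuousWithinAt f X y := by
        have := hfc y ⟨hy, hyU⟩
        rwa [continuousWithinAt_inter (hU.isOpen.mem_nhds hyU)] at this
      refine h1.congr_of_eventuallyEq ?_ (hFf y hyU)
      filter_upwards [mem_nhdsWithin_of_mem_nhds (hU.isOpen.mem_nhds hyU)] with a ha
      exact hFf a ha
    · have h1 : ContinuousWithinAt g X y := by
        have := hgc y ⟨hy, hyU⟩
        rwa [continuousWithinAt_inter (hU.compl.isOpen.mem_nhds hyU)] at this
      refine h1.congr_of_eventuallyEq ?_ (hFg y hyU)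
      filter_upwards [mem_nhdsWithin_of_mem_nhds (hU.compl.isOpen.mem_nhds hyU)] with a ha
      exact hFg a ha
  · intro a ha b hb hab
    by_cases haU : a ∈ U <;> by_cases hbU : b ∈ U
    · rw [hFf a haU, hFf b hbU] at hab
      exact hfi ⟨ha, haU⟩ ⟨hb, hbU⟩ hab
    · rw [hFf a haU, hFg b hbU] at hab
      exact absurd (hab ▸ (hfm ⟨ha, haU⟩).2) (hgm ⟨hb, hbU⟩).2
    · rw [hFg a haU, hFf b hbU] at hab
      exact absurd (hab ▸ (hfm ⟨hb, hbU⟩).2) (hgm ⟨ha, haU⟩).2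
    · rw [hFg a haU, hFg b hbU] at hab
      exact hgi ⟨ha, haU⟩ ⟨hb, hbU⟩ hab
  · intro y hy
    by_cases hyU : y ∈ U
    · rw [hFf y hyU]
      exact (hfm ⟨hy, hyU⟩).1
    · rw [hFg y hyU]
      exact (hgm ⟨hy, hyU⟩).1

theorem exists_clopen_separating (s : Finset ASet) (x : ASet) :
    ∃ U, IsClopen U ∧ x ∈ U ∧ ∀ y ∈ s, y ∈ U → y = x := by
  classical
  have h : (↑(s.erase x) : Set ASet)ᶜ ∈ 𝓝 x :=
    (s.erase x).finite_toSet.isClosed.isOpen_compl.mem_nhds (by simp)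
  obtain ⟨n, hn⟩ := mem_nhds_iff_nbhd.1 h
  refine ⟨nbhd n x, isClopen_nbhd n x, mem_nbhd_self n x, fun y hy hyU => ?_⟩
  by_contra hne
  exact hn hyU (by simp [hne, hy])

/-- Split off one point of `s` and one of `t` by clopen sets, embed these parts by the one-point
case, and treat the complements by induction. -/
theorem embeds_of_iter_subset_finset (β : Ordinal.{0}) (n : ℕ) :
    ∀ {X Y : Set ASet} {s t : Finset ASet}, iter X β ⊆ s → ↑t ⊆ iter Y β → t.card = n + 1 →
      s.card ≤ n + 1 → Embeds X Y := by
  classical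
  induction n with
  | zero =>
    intro X Y s t hs ht htc hsc
    obtain ⟨p, rfl⟩ := Finset.card_eq_one.1 htc
    have : _root_.Nonempty ASet := ⟨p⟩
    obtain ⟨x, hx⟩ := Finset.card_le_one_iff_subset_singleton.1 hsc
    exact embeds_of_iter_subset_singleton β (x := x) (p := p)
      (hs.trans (by exact_mod_cast hx)) (ht (by simp))
  | succ n ih =>
    intro X Y s t hs ht htc hsc
    obtain ⟨p, hp⟩ : t.Nonempty := Finset.card_pos.1 (by omega)
    rcases s.eq_empty_or_nonempty with rfl | ⟨x, hx⟩
    · exact embeds_of_iter_subset_singleton β (x := p) (hs.trans (by simp)) (ht hp)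
    obtain ⟨U, hU, hxU, hsU⟩ := exists_clopen_separating s x
    obtain ⟨W, hW, hpW, htW⟩ := exists_clopen_separating t p
    refine Embeds.glue (U := U) (W := W) hU ?_ ?_
    · refine embeds_of_iter_subset_singleton β (x := x) (p := p) ?_ ?_
      · rw [iter_inter_open _ hU.isOpen]
        exact fun y hy => hsU y (hs hy.1) hy.2
      · rw [iter_inter_open _ hW.isOpen]
        exact ⟨ht hp, hpW⟩
    · refine ih (s := s.erase x) (t := t.erase p) ?_ ?_ ?_ ?_
      · rw [iter_inter_open _ hU.compl.isOpen]
        intro y hy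
        have : y ≠ x := fun h => hy.2 (h ▸ hxU)
        simpa [this] using hs hy.1
      · rw [iter_inter_open _ hW.compl.isOpen]
        intro y hy
        rw [Finset.mem_coe, Finset.mem_erase] at hy
        exact ⟨ht hy.2, fun h => hy.1 (htW y hy.2 h)⟩
      · rw [Finset.card_erase_of_mem hp, htc]
        rfl
      · rw [Finset.card_erase_of_mem hx]
        omega

/-! The Cantor-Bendixson invariants -/

/-- Some iterated derived set is empty. -/
def Scattered (X : Set ASet) : Prop := ∃ o, iter X o = ∅

theorem Scattered.of_embeds {X Y : Set ASet} (hY : Scattered Y) (h : Embeds X Y) :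
    Scattered X := by
  obtain ⟨o, ho⟩ := hY
  obtain ⟨f, hc, hi, hm⟩ := h
  refine ⟨o, eq_empty_of_forall_notMem fun x hx => ?_⟩
  have := map_mem_iter hc hi hm o x hx
  rwa [ho] at this

/-- The Cantor-Bendixson rank: the smallest `o` such that the `o`-th derived set has no accumulation
points. -/
noncomputable def rk (X : Set ASet) : Ordinal.{0} := sInf {o | derivedSet (iter X o) = ∅}

/-- The Cantor-Bendixson degree, as a set. -/
noncomputable def top (X : Set ASet) : Set ASet := iter X (rk X)

theorem Scattered.derivedSet_top {X : Set ASet} (h : Scattered X) : derivedSet (top X) = ∅ := by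
  have hne : {o | derivedSet (iter X o) = ∅}.Nonempty := by
    obtain ⟨o, ho⟩ := h
    exact ⟨o, by rw [mem_ofPred_eq, ho]; exact derivedSet_eq_empty_of_finite finite_empty⟩
  exact csInf_mem hne

theorem rk_le {X : Set ASet} {o : Ordinal.{0}} (h : derivedSet (iter X o) = ∅) : rk X ≤ o :=
  csInf_le' h

theorem Scattered.finite_top {X : Set ASet} (hX : IsClosed X) (h : Scattered X) :
    (top X).Finite :=
  finite_of_derivedSet_eq_empty (isClosed_iter hX _) h.derivedSet_top

/-- At limit stages compactness makes the intersection of the decreasing nonempty derivatives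
nonempty; at successors minimality of the rank does. -/
theorem nonempty_iter_of_le_rk {X : Set ASet} (hX : IsClosed X) (hne : X.Nonempty) :
    ∀ {o : Ordinal.{0}}, o ≤ rk X → (iter X o).Nonempty := by
  intro o ho
  have hd : ∀ γ < o, (derivedSet (iter X γ)).Nonempty := by
    intro γ hγ
    by_contra h
    exact absurd (rk_le (not_nonempty_iff_eq_empty.1 h)) (not_le_of_gt (hγ.trans_le ho))
  rcases Ordinal.zero_or_succ_or_isSuccLimit o with rfl | ⟨γ, rfl⟩ | hl
  · rwa [iter_zero]
  · rw [iter_succ hX]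
    exact hd γ (lt_succ γ)
  · have hpos : 0 < o := by simpa using hl.bot_lt
    have heq : (⋂ γ < o, iter X γ) = ⋂ γ : Set.Iio o, iter X γ := by
      ext x
      simp
    rw [iter_limit hl, heq]
    have : _root_.Nonempty (Set.Iio o) := ⟨⟨0, hpos⟩⟩
    refine IsCompact.nonempty_iInter_of_directed_nonempty_isCompact_isClosed
      (fun γ : Set.Iio o => iter X γ) ?_ ?_ ?_ ?_
    · exact directed_of_isDirected_le fun a b hab => iter_anti X hab
    · intro γ
      have := hd γ γ.2
      rw [← iter_succ hX] at this
      exact this.mono (iter_anti X (le_succ _))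
    · exact fun γ => (isClosed_iter hX _).isCompact
    · exact fun γ => isClosed_iter hX _

theorem top_nonempty {X : Set ASet} (hX : IsClosed X) (hne : X.Nonempty) : (top X).Nonempty :=
  nonempty_iter_of_le_rk hX hne le_rfl

/-- The rank and the cardinality of the degree, ordered lexicographically. -/
noncomputable def cbKey (X : Set ASet) : Ordinal.{0} ×ₗ ℕ := toLex (rk X, (top X).ncard)

theorem infinite_iter_of_lt_rk {X : Set ASet} {o : Ordinal.{0}} (h : o < rk X) :
    (iter X o).Infinite := fun hf =>
  absurd (rk_le (derivedSet_eq_empty_of_finite hf)) (not_le_of_gt h)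

/-- An injection carries each derivative of `X` into that of `Y`, so finiteness and size at a stage
transfer back to `X`. Conversely, it is enough to find in the derivative of `Y` of order `rk X` as
many points as the degree of `X` has. -/
theorem embeds_iff {X Y : Set ASet} (hX : IsClosed X) (hY : IsClosed Y) (sX : Scattered X)
    (sY : Scattered Y) : Embeds X Y ↔ cbKey X ≤ cbKey Y := by
  rw [cbKey, cbKey, Prod.Lex.toLex_le_toLex]
  constructor
  · rintro ⟨f, hc, hi, hm⟩
    have hmap := map_mem_iter hc hi hm
    have hcard : ∀ o, (iter Y o).Finite → (iter X o).Finite ∧ (iter X o).ncard ≤ (iter Y o).ncard := by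
      intro o ho
      have hsub : f '' iter X o ⊆ iter Y o := image_subset_iff.2 (hmap o)
      have hinj : InjOn f (iter X o) := hi.mono (iter_subset X o)
      exact ⟨Finite.of_finite_image (ho.subset hsub) hinj,
        hinj.ncard_image.symm.trans_le (ncard_le_ncard hsub ho)⟩
    have hle : rk X ≤ rk Y :=
      rk_le (derivedSet_eq_empty_of_finite (hcard _ (sY.finite_top hY)).1)
    rcases hle.lt_or_eq with h | h
    · exact Or.inl h
    · refine Or.inr ⟨h, ?_⟩
      dsimp only
      rw [top, h]
      exact (hcard _ (sY.finite_top hY)).2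
  · intro h
    rcases X.eq_empty_or_nonempty with rfl | hne
    · exact ⟨id, continuousOn_id, injOn_id _, mapsTo_empty _ _⟩
    have hf := sX.finite_top hX
    have hpos : 0 < (top X).ncard := (ncard_pos hf).2 (top_nonempty hX hne)
    have hs : iter X (rk X) ⊆ hf.toFinset := by
      rw [Finite.coe_toFinset]
      exact le_rfl
    have hsc : hf.toFinset.card = (top X).ncard := (ncard_eq_toFinset_card _ hf).symm
    rcases h with h | ⟨h, h'⟩
    -- Below its rank `Y` has infinite derivatives, so the number of points needed is always
    -- available.
    · obtain ⟨t, ht, htc⟩ := (infinite_iter_of_lt_rk h).exists_subset_card_eq (top X).ncard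
      exact embeds_of_iter_subset_finset (rk X) ((top X).ncard - 1) hs ht (by omega) (by omega)
    · dsimp only at h h'
      have hf' := sY.finite_top hY
      have hsc' : hf'.toFinset.card = (top Y).ncard := (ncard_eq_toFinset_card _ hf').symm
      refine embeds_of_iter_subset_finset (rk X) ((top Y).ncard - 1) hs (t := hf'.toFinset) ?_
        (by omega) (by omega)
      rw [Finite.coe_toFinset, h]
      exact le_rfl

theorem Embeds.refl (X : Set ASet) : Embeds X X := ⟨id, continuousOn_id, injOn_id _, mapsTo_id _⟩

theorem Embeds.of_subset {X Y : Set ASet} (h : X ⊆ Y) : Embeds X Y :=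
  ⟨id, continuousOn_id, injOn_id _, h⟩

/-! ### Well-ordered sets as compact orders, and their order types -/

theorem orderTopology_of_compactSpace {α : Type*} [LinearOrder α] [t : TopologicalSpace α]
    [CompactSpace α] [OrderClosedTopology α] : OrderTopology α := by
  have hle : t ≤ Preorder.topology α := le_generateFrom fun s hs => by
    obtain ⟨a, rfl | rfl⟩ := hs
    · exact isOpen_Ioi
    · exact isOpen_Iio
  have : @OrderTopology α (Preorder.topology α) _ := @OrderTopology.mk α (Preorder.topology α) _ rfl
  have h2 : @T2Space α (Preorder.topology α) := by
    clear hle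
    clear! t
    let _ := Preorder.topology α
    infer_instance
  -- The identity from a compact topology to a coarser Hausdorff one is a closed embedding, so the
  -- two topologies coincide.
  have h := @Continuous.isClosedEmbedding α α t (Preorder.topology α) _ h2 id
    (continuous_id_iff_le.2 hle) Function.injective_id
  have h3 := @IsInducing.eq_induced α α t (Preorder.topology α) id
    (@IsClosedEmbedding.isInducing α α id t (Preorder.topology α) h)
  exact ⟨h3.trans (@induced_id α (Preorder.topology α))⟩

theorem IsInitialSegment.sub {R A S : ASet} (h : IsInitialSegment R A S) : Sub S A := h.1

theorem IsInitialSegment.mem_of_lt {R A S : ASet} (h : IsInitialSegment R A S) {x y : ASet}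
    (hx : x ∈ S) (hy : y ∈ A) (hyx : Lt R y x) : y ∈ S := h.2 x y hx hy hyx

theorem IsProperInitialSegment.isInitialSegment {R A S : ASet}
    (h : IsProperInitialSegment R A S) : IsInitialSegment R A S := h.1

/-- A set together with a relation that well-orders some larger set. -/
structure WOSet where
  carrier : ASet
  rel : ASet
  exists_wellOrders : ∃ A, Sub carrier A ∧ WellOrders rel A

namespace WOSet

variable (W V : WOSet)

/-- The type of elements of a well-ordered set. -/
@[ext]
structure El where
  val : ASet
  mem : val ∈ W.carrier

instance : TopologicalSpace W.El := TopologicalSpace.induced El.val inferInstance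

theorem isClosedEmbedding_val : IsClosedEmbedding (El.val : W.El → ASet) := by
  refine ⟨⟨⟨rfl⟩, fun _ _ => El.ext⟩, ?_⟩
  have : range (El.val : W.El → ASet) = pts W.carrier :=
    Set.ext fun x => ⟨fun ⟨y, hy⟩ => hy ▸ y.2, fun hx => ⟨⟨x, hx⟩, rfl⟩⟩
  rw [this]
  exact isClosed_pts W.carrier

instance : CompactSpace W.El := W.isClosedEmbedding_val.compactSpace

noncomputable instance : LinearOrder W.El where
  le x y := opair x.1 y.1 ∈ W.rel
  lt x y := Lt W.rel x.1 y.1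
  le_refl x := by
    obtain ⟨A, hA, h⟩ := W.exists_wellOrders
    exact h.linear.refl _ (hA _ x.2)
  le_trans x y z := by
    obtain ⟨A, hA, h⟩ := W.exists_wellOrders
    exact h.linear.trans _ _ _
  le_antisymm x y hx hy := by
    obtain ⟨A, hA, h⟩ := W.exists_wellOrders
    exact El.ext (h.linear.antisymm _ _ hx hy)
  le_total x y := by
    obtain ⟨A, hA, h⟩ := W.exists_wellOrders
    exact h.linear.total _ _ (hA _ x.2) (hA _ y.2)
  lt_iff_le_not_ge x y := by
    obtain ⟨A, hA, h⟩ := W.exists_wellOrders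
    exact ⟨fun hxy => ⟨hxy.1, fun hyx => hxy.2 (h.linear.antisymm _ _ hxy.1 hyx)⟩,
      fun hxy => ⟨hxy.1, fun heq => hxy.2 (heq ▸ h.linear.refl _ (hA _ x.2))⟩⟩
  toDecidableLE := Classical.decRel _

variable {W V}

instance : OrderClosedTopology W.El where
  isClosed_le' := (isClosed_pairs W.rel).preimage
    (W.isClosedEmbedding_val.continuous.prodMap W.isClosedEmbedding_val.continuous)

instance : OrderTopology W.El := orderTopology_of_compactSpace

theorem exists_nbhd_le (x : W.El) : ∃ n, ∀ y : W.El, y.1 ∈ nbhd n x.1 → y ≤ x := by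
  obtain ⟨A, hA, h⟩ := W.exists_wellOrders
  obtain ⟨n, hn⟩ := h.upward x.1 (hA _ x.2)
  exact ⟨n, fun y hy => not_lt.1 (hn y.1 (hA _ y.2) hy)⟩

/-- The closure of `s` has a least element by compactness. Upward isolation gives it a neighbourhood
without larger elements, so it can only be approximated by itself and lies in `s`. Thus minima exist
for arbitrary subclasses, not only for sets. -/
theorem exists_isLeast (s : Set W.El) (hs : s.Nonempty) : ∃ m, IsLeast s m := by
  obtain ⟨m, hm, hml⟩ := isClosed_closure.isCompact.exists_isLeast (s := closure s) hs.closure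
  refine ⟨m, ?_, fun y hy => hml (subset_closure hy)⟩
  obtain ⟨n, hn⟩ := exists_nbhd_le m
  have hN : (El.val : W.El → ASet) ⁻¹' nbhd n m.1 ∈ 𝓝 m :=
    W.isClosedEmbedding_val.continuous.continuousAt.preimage_mem_nhds (nbhd_mem_nhds n m.1)
  obtain ⟨y, hyn, hys⟩ := mem_closure_iff_nhds.1 hm _ hN
  rwa [le_antisymm (hml (subset_closure hys)) (hn y hyn)]

instance : WellFoundedLT W.El :=
  ⟨WellFounded.wellFounded_iff_has_min.2 fun s hs => by
    obtain ⟨m, hm, hml⟩ := exists_isLeast s hs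
    exact ⟨m, hm, fun x hx => not_lt.2 (hml hx)⟩⟩

/-- The order type. -/
noncomputable def type (W : WOSet) : Ordinal.{0} := Ordinal.type (α := W.El) (· < ·)

/-- The position of an element. -/
noncomputable def pos (x : W.El) : Ordinal.{0} := Ordinal.typein (α := W.El) (· < ·) x

theorem pos_lt_type (x : W.El) : pos x < W.type := Ordinal.typein_lt_type _ x

theorem pos_lt_pos {x y : W.El} : pos x < pos y ↔ x < y := Ordinal.typein_lt_typein _

theorem pos_le_pos {x y : W.El} : pos x ≤ pos y ↔ x ≤ y := by
  rw [← not_lt, pos_lt_pos, not_lt]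

theorem pos_injective : Function.Injective (pos : W.El → Ordinal) := Ordinal.typein_injective _

theorem exists_pos_eq {o : Ordinal.{0}} (h : o < W.type) : ∃ x : W.El, pos x = o :=
  Ordinal.typein_surj _ h

theorem exists_isMax (s : Set W.El) (hs : IsClosed s) (hne : s.Nonempty) : ∃ m, IsGreatest s m :=
  hs.isCompact.exists_isGreatest hne

theorem type_eq_of_isGreatest {m : W.El} (h : ∀ y, y ≤ m) : W.type = succ (pos m) := by
  refine le_antisymm (le_of_forall_lt fun o ho => ?_) (succ_le_of_lt (pos_lt_type m))
  obtain ⟨x, rfl⟩ := exists_pos_eq ho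
  exact lt_succ_iff.2 (pos_le_pos.2 (h x))

/-- Compactness supplies a greatest element; this is why limit order types do not occur. -/
theorem exists_max (h : W.type ≠ 0) : ∃ m : W.El, (∀ y, y ≤ m) ∧ W.type = succ (pos m) := by
  obtain ⟨x, -⟩ := exists_pos_eq (pos_of_ne_zero h)
  obtain ⟨m, -, hm⟩ := exists_isMax (univ : Set W.El) isClosed_univ ⟨x, trivial⟩
  exact ⟨m, fun y => hm trivial, type_eq_of_isGreatest fun y => hm trivial⟩

theorem type_eq_zero : W.type = 0 ↔ W.carrier = empty := by
  constructor
  · intro h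
    refine ext_iff_mem.2 fun x => ⟨fun hx => ?_, fun hx => absurd hx (notMem_empty x)⟩
    exact absurd (pos_lt_type (W := W) ⟨x, hx⟩) (h ▸ not_lt_of_ge (zero_le))
  · intro h
    by_contra hne
    obtain ⟨m, -⟩ := exists_max hne
    exact notMem_empty m.1 (h ▸ m.2)

/-- A subset with the induced ordering. -/
def sub (W : WOSet) (S : ASet) (h : Sub S W.carrier) : WOSet where
  carrier := S
  rel := W.rel
  exists_wellOrders := by
    obtain ⟨A, hA, hW⟩ := W.exists_wellOrders
    exact ⟨A, fun x hx => hA x (h x hx), hW⟩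

theorem pos_sub {S : ASet} (h : IsInitialSegment W.rel W.carrier S) {x : ASet} (hx : x ∈ S) :
    pos (W := W.sub S h.sub) ⟨x, hx⟩ = pos (W := W) ⟨x, h.sub x hx⟩ := by
  let f : @InitialSeg (W.sub S h.sub).El W.El (· < ·) (· < ·) :=
    { toFun := fun y => ⟨y.1, h.sub _ y.2⟩
      inj' := fun y z hyz => El.ext (congrArg (fun w : W.El => w.1) hyz :)
      map_rel_iff' := Iff.rfl
      mem_range_of_rel' := fun y z hz => ⟨⟨z.1, h.mem_of_lt y.2 z.2 hz⟩, rfl⟩ }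
  exact (Ordinal.typein_apply f ⟨x, hx⟩).symm

theorem type_sub_le {S : ASet} (h : IsInitialSegment W.rel W.carrier S) :
    (W.sub S h.sub).type ≤ W.type := by
  refine le_of_forall_lt fun o ho => ?_
  obtain ⟨x, rfl⟩ := exists_pos_eq ho
  exact (pos_sub h x.2).trans_lt (pos_lt_type _)

theorem type_sub_lt {S : ASet} (h : IsProperInitialSegment W.rel W.carrier S) :
    (W.sub S h.isInitialSegment.sub).type < W.type := by
  obtain ⟨b, hb, hbS⟩ : ∃ b, b ∈ W.carrier ∧ b ∉ S := by
    by_contra! hc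
    exact h.2 (ext_iff_mem.2 fun x => ⟨h.1.1 x, hc x⟩)
  refine lt_of_le_of_lt (le_of_forall_lt fun o ho => ?_) (pos_lt_type (W := W) ⟨b, hb⟩)
  obtain ⟨x, rfl⟩ := exists_pos_eq ho
  refine (pos_sub h.1 x.2).trans_lt (pos_lt_pos.2 ?_)
  by_contra hle
  rcases (not_lt.1 hle).lt_or_eq with hlt | heq
  · exact hbS (h.1.mem_of_lt x.2 hb hlt)
  · have : b = x.1 := congrArg El.val heq
    exact hbS (this.symm ▸ x.2)

/-- The initial segment of all elements up to `x`. -/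
def seg (x : W.El) : ASet := ofSet (El.val '' Iic x)

theorem mem_seg {x : W.El} {y : ASet} : y ∈ seg x ↔ ∃ h : y ∈ W.carrier, (⟨y, h⟩ : W.El) ≤ x := by
  rw [seg, mem_ofSet (W.isClosedEmbedding_val.isClosedMap _ isClosed_Iic)]
  exact ⟨fun ⟨z, hz, h⟩ => h ▸ ⟨z.2, hz⟩, fun ⟨h, h'⟩ => ⟨_, h', rfl⟩⟩

theorem isInitialSegment_seg (x : W.El) : IsInitialSegment W.rel W.carrier (seg x) :=
  ⟨fun _ hy => (mem_seg.1 hy).1, fun y z hy hz hzy => mem_seg.2 ⟨hz, by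
    obtain ⟨h, h'⟩ := mem_seg.1 hy
    exact (le_of_lt (show (⟨z, hz⟩ : W.El) < ⟨y, h⟩ from hzy)).trans h'⟩⟩

theorem isInitialSegment_empty : IsInitialSegment W.rel W.carrier empty :=
  ⟨fun x hx => absurd hx (notMem_empty x), fun x _ hx => absurd hx (notMem_empty x)⟩

theorem isInitialSegment_self : IsInitialSegment W.rel W.carrier W.carrier :=
  ⟨fun _ h => h, fun _ _ _ h _ => h⟩

theorem mem_seg_self (x : W.El) : x.1 ∈ seg x := mem_seg.2 ⟨x.2, le_rfl⟩

theorem type_seg (x : W.El) : (W.sub (seg x) (isInitialSegment_seg x).sub).type = succ (pos x) := by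
  have h : ∀ y : (W.sub (seg x) (isInitialSegment_seg x).sub).El, y ≤ ⟨x.1, mem_seg_self x⟩ :=
    fun y => (mem_seg.1 y.2).2
  exact (type_eq_of_isGreatest h).trans (congrArg succ (pos_sub (isInitialSegment_seg x) (mem_seg_self x)))

/-- An initial segment is empty or consists of all elements up to some `x`. -/
theorem eq_seg_of_isInitialSegment {S : ASet} (h : IsInitialSegment W.rel W.carrier S) :
    S = empty ∨ ∃ x : W.El, S = seg x := by
  by_cases h0 : (W.sub S h.sub).type = 0
  · exact Or.inl (type_eq_zero.1 h0)
  · obtain ⟨m, hm, -⟩ := exists_max h0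
    refine Or.inr ⟨⟨m.1, h.sub _ m.2⟩, ext_iff_mem.2 fun y => ?_⟩
    rw [mem_seg]
    constructor
    · exact fun hy => ⟨h.sub _ hy, hm ⟨y, hy⟩⟩
    · rintro ⟨hy, hle⟩
      rcases hle.lt_or_eq with hlt | heq
      · exact h.mem_of_lt m.2 hy hlt
      · have : y = m.1 := congrArg El.val heq
        exact this.symm ▸ m.2

theorem seg_eq_carrier {x : W.El} : seg x = W.carrier ↔ ∀ y, y ≤ x := by
  constructor
  · exact fun h y => (mem_seg.1 (h.symm ▸ y.2 : y.1 ∈ seg x)).2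
  · exact fun h => ext_iff_mem.2 fun y => ⟨fun hy => (mem_seg.1 hy).1,
      fun hy => mem_seg.2 ⟨hy, h ⟨y, hy⟩⟩⟩

theorem exists_initialSegment_of_type_lt (h : V.type < W.type) :
    ∃ S, ∃ hS : IsProperInitialSegment W.rel W.carrier S, (W.sub S hS.isInitialSegment.sub).type = V.type := by
  by_cases h0 : V.type = 0
  · have hS : IsProperInitialSegment W.rel W.carrier empty :=
      ⟨isInitialSegment_empty, fun he => by
        rw [type_eq_zero.2 he.symm] at h
        exact absurd h (not_lt_of_ge (zero_le))⟩
    exact ⟨empty, hS, (type_eq_zero.2 rfl).trans h0.symm⟩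
  · obtain ⟨m, -, hm⟩ := exists_max h0
    obtain ⟨x, hx⟩ := exists_pos_eq ((pos_lt_type m).trans h)
    refine ⟨seg x, ⟨isInitialSegment_seg x, fun he => ?_⟩, ?_⟩
    · rw [seg_eq_carrier] at he
      rw [type_eq_of_isGreatest he, hx, ← hm] at h
      exact lt_irrefl _ h
    · rw [type_seg, hx, hm]

/-- An order isomorphism is automatically continuous because both sides carry the order topology, so
it is a function of the theory. -/
theorem isomorphic_iff :
    Isomorphic W.rel W.carrier V.rel V.carrier ↔ W.type = V.type := by
  constructor
  · rintro ⟨f, hf, hlt⟩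
    obtain ⟨F, hc, hm, hF⟩ := hf.toIsFunction.exists_continuousOn
    let e : W.El → V.El := fun x => ⟨F x.1, hm x.2⟩
    have he : StrictMono e := fun x y hxy =>
      hlt x.1 y.1 _ _ ((hF _ _).2 ⟨x.2, rfl⟩) ((hF _ _).2 ⟨y.2, rfl⟩) hxy
    have hs : Function.Surjective e := fun y => by
      obtain ⟨a, ha, h⟩ := hf.surjective y.1 y.2
      exact ⟨⟨a, ha⟩, El.ext ((hF _ _).1 h).2⟩
    exact (StrictMono.orderIsoOfSurjective e he hs).ordinalType_congr
  · intro h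
    classical
    obtain ⟨e⟩ := Ordinal.type_eq.1 h
    let e : W.El ≃o V.El := OrderIso.ofRelIsoLT e
    let F : ASet → ASet := fun a => if h : a ∈ W.carrier then (e ⟨a, h⟩).1 else a
    have hFe : ∀ x : W.El, F x.1 = (e x).1 := fun x => dif_pos x.2
    have hc : ContinuousOn F (pts W.carrier) := by
      rw [continuousOn_iff_continuous_domRestrict]
      have hj : Continuous fun x : pts W.carrier => (⟨x.1, x.2⟩ : W.El) :=
        W.isClosedEmbedding_val.isInducing.continuous_iff.2 continuous_subtype_val
      exact (V.isClosedEmbedding_val.continuous.comp (e.continuous.comp hj)).congr fun x =>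
        (hFe ⟨x.1, x.2⟩).symm
    have hm : MapsTo F (pts W.carrier) (pts V.carrier) := fun x hx => by
      rw [hFe ⟨x, hx⟩]
      exact (e ⟨x, hx⟩).2
    obtain ⟨f, hf, hfF⟩ := isFunction_ofPairs hc hm
    refine ⟨f, ⟨⟨hf, ?_⟩, ?_⟩, ?_⟩
    · intro a a' b h h'
      obtain ⟨ha, h⟩ := (hfF _ _).1 h
      obtain ⟨ha', h'⟩ := (hfF _ _).1 h'
      rw [← h, hFe ⟨a, ha⟩, hFe ⟨a', ha'⟩] at h'
      exact (congrArg El.val (e.injective (El.ext h'))).symm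
    · intro b hb
      refine ⟨(e.symm ⟨b, hb⟩).1, (e.symm ⟨b, hb⟩).2, (hfF _ _).2 ⟨(e.symm ⟨b, hb⟩).2, ?_⟩⟩
      rw [hFe, e.apply_symm_apply]
    · intro x x' y y' h h' hlt
      obtain ⟨ha, rfl⟩ := (hfF _ _).1 h
      obtain ⟨ha', rfl⟩ := (hfF _ _).1 h'
      rw [hFe ⟨x, ha⟩, hFe ⟨x', ha'⟩]
      exact e.lt_iff_lt.2 (show (⟨x, ha⟩ : W.El) < ⟨x', ha'⟩ from hlt)

theorem oLt_iff : OLt W.rel W.carrier V.rel V.carrier ↔ W.type < V.type := by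
  constructor
  · rintro ⟨S, hS, h⟩
    exact (isomorphic_iff (V := V.sub S hS.isInitialSegment.sub).1 h).trans_lt (type_sub_lt hS)
  · intro h
    obtain ⟨S, hS, hST⟩ := exists_initialSegment_of_type_lt h
    exact ⟨S, hS, isomorphic_iff (V := V.sub S hS.isInitialSegment.sub).2 hST.symm⟩

theorem oLe_iff : OLe W.rel W.carrier V.rel V.carrier ↔ W.type ≤ V.type := by
  constructor
  · rintro ⟨S, hS, h⟩
    exact (isomorphic_iff (V := V.sub S hS.sub).1 h).trans_le (type_sub_le hS)
  · intro h
    rcases h.lt_or_eq with h | h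
    · obtain ⟨S, hS, h⟩ := oLt_iff.2 h
      exact ⟨S, hS.1, h⟩
    · exact ⟨V.carrier, isInitialSegment_self, isomorphic_iff.2 h⟩

theorem oEq_iff : OEq W.rel W.carrier V.rel V.carrier ↔ W.type = V.type := by
  rw [OEq, oLe_iff, oLe_iff, le_antisymm_iff]

/-- A well-ordered set as an ordinal. -/
def toOrd (W : WOSet) : Ord where
  carrier := W.carrier
  rel := ofPairs (pairs W.rel ∩ pts W.carrier ×ˢ pts W.carrier)
  wellOrders := by
    have hG := (isClosed_pairs W.rel).inter ((isClosed_pts W.carrier).prod (isClosed_pts W.carrier))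
    have hmem : ∀ {x y}, opair x y ∈ ofPairs (pairs W.rel ∩ pts W.carrier ×ˢ pts W.carrier) ↔
        opair x y ∈ W.rel ∧ x ∈ W.carrier ∧ y ∈ W.carrier := opair_mem_ofPairs hG
    obtain ⟨A, hA, h⟩ := W.exists_wellOrders
    refine ⟨⟨?_, ?_, ?_, ?_, ?_⟩, ?_, ?_⟩
    · intro p hp
      obtain ⟨q, ⟨-, hq⟩, rfl⟩ := (mem_ofPairs hG).1 hp
      exact ⟨q.1, q.2, hq.1, hq.2, rfl⟩
    · exact fun x hx => hmem.2 ⟨h.linear.refl x (hA x hx), hx, hx⟩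
    · exact fun x y h1 h2 => h.linear.antisymm x y (hmem.1 h1).1 (hmem.1 h2).1
    · exact fun x y z h1 h2 => hmem.2 ⟨h.linear.trans x y z (hmem.1 h1).1 (hmem.1 h2).1,
        (hmem.1 h1).2.1, (hmem.1 h2).2.2⟩
    · exact fun x y hx hy => (h.linear.total x y (hA x hx) (hA y hy)).imp
        (fun h => hmem.2 ⟨h, hx, hy⟩) (fun h => hmem.2 ⟨h, hy, hx⟩)
    · intro B hB hne
      obtain ⟨m, hm, hmin⟩ := h.exists_min B (fun x hx => hA x (hB x hx)) hne
      exact ⟨m, hm, fun x hx hxm => ⟨hmem.2 ⟨(hmin x hx hxm).1, hB m hm, hB x hx⟩,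
        (hmin x hx hxm).2⟩⟩
    · intro x hx
      obtain ⟨n, hn⟩ := h.upward x (hA x hx)
      exact ⟨n, fun y hy hyx hlt => hn y (hA y hy) hyx ⟨(hmem.1 hlt.1).1, hlt.2⟩⟩

theorem rel_toOrd {x y : ASet} : opair x y ∈ W.toOrd.rel ↔
    opair x y ∈ W.rel ∧ x ∈ W.carrier ∧ y ∈ W.carrier :=
  opair_mem_ofPairs
    ((isClosed_pairs W.rel).inter ((isClosed_pts W.carrier).prod (isClosed_pts W.carrier)))

end WOSet

/-- An ordinal as a well-ordered set. -/
def Ord.toWOSet (α : Ord) : WOSet := ⟨α.carrier, α.rel, α.carrier, fun _ h => h, α.wellOrders⟩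

/-- The order type of an ordinal. -/
noncomputable def Ord.type (α : Ord) : Ordinal.{0} := α.toWOSet.type

theorem WOSet.type_toOrd (W : WOSet) : W.toOrd.type = W.type := by
  let e : W.toOrd.toWOSet.El → W.El := fun x => ⟨x.1, x.2⟩
  have he : StrictMono e := fun x y h => ⟨(rel_toOrd.1 h.1).1, h.2⟩
  exact (StrictMono.orderIsoOfSurjective e he fun y => ⟨⟨y.1, y.2⟩, rfl⟩).ordinalType_congr

namespace WOSet

variable {W : WOSet}

theorem mem_iff_pos_lt {S : ASet} (h : IsInitialSegment W.rel W.carrier S) (x : W.El) :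
    x.1 ∈ S ↔ pos x < (W.sub S h.sub).type := by
  constructor
  · exact fun hx => (pos_sub h hx).symm.trans_lt (pos_lt_type _)
  · intro hx
    obtain ⟨y, hy⟩ := exists_pos_eq hx
    have : (⟨y.1, h.sub _ y.2⟩ : W.El) = x := pos_injective ((pos_sub h y.2).symm.trans hy)
    exact this ▸ y.2

theorem sub_iff_type_le {S T : ASet} (hS : IsInitialSegment W.rel W.carrier S)
    (hT : IsInitialSegment W.rel W.carrier T) :
    Sub S T ↔ (W.sub S hS.sub).type ≤ (W.sub T hT.sub).type := by
  constructor
  · intro h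
    refine le_of_forall_lt fun o ho => ?_
    obtain ⟨x, rfl⟩ := exists_pos_eq ho
    exact (pos_sub hS x.2).trans_lt ((mem_iff_pos_lt hT ⟨x.1, hS.sub _ x.2⟩).1 (h _ x.2))
  · exact fun h x hx => (mem_iff_pos_lt hT ⟨x, hS.sub x hx⟩).2
      (((mem_iff_pos_lt hS ⟨x, hS.sub x hx⟩).1 hx).trans_le h)

theorem type_zero_or_succ (W : WOSet) : W.type = 0 ∨ ∃ s, W.type = succ s := by
  by_cases h : W.type = 0
  · exact Or.inl h
  · obtain ⟨m, -, hm⟩ := exists_max h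
    exact Or.inr ⟨_, hm⟩

theorem exists_ord_type_eq {o : Ordinal.{0}} (ho : o ≤ W.type) (h : o = 0 ∨ ∃ r, o = succ r) :
    ∃ α : Ord, α.type = o := by
  rcases h with rfl | ⟨r, rfl⟩
  · exact ⟨(W.sub empty isInitialSegment_empty.sub).toOrd,
      (type_toOrd _).trans (type_eq_zero.2 rfl)⟩
  · obtain ⟨x, rfl⟩ := exists_pos_eq ((lt_succ r).trans_le ho)
    exact ⟨(W.sub (seg x) (isInitialSegment_seg x).sub).toOrd, (type_toOrd _).trans (type_seg x)⟩

/-- Near `x` there are only elements below `x`, which by induction have already left the derivative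
of order `pos x`. -/
theorem le_pos_of_mem_iter (x : W.El) : ∀ {o : Ordinal.{0}}, x.1 ∈ iter (pts W.carrier) o →
    o ≤ pos x := by
  induction x using WellFoundedLT.induction with
  | ind x ih =>
    intro o ho
    by_contra! hlt
    obtain ⟨n, hn⟩ := exists_nbhd_le x
    obtain ⟨y, ⟨hyn, hy⟩, hyx⟩ := accPt_iff_nhds.1 (mem_derivedSet.1 ((mem_iter.1 ho).2 _ hlt)) _
      (nbhd_mem_nhds n x.1)
    have hlt' : (⟨y, iter_subset _ _ hy⟩ : W.El) < x :=
      lt_of_le_of_ne (hn ⟨y, _⟩ hyn) fun h => hyx (congrArg El.val h)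
    exact absurd (ih _ hlt' hy) (not_le_of_gt (pos_lt_pos.2 hlt'))

theorem scattered (W : WOSet) : Scattered (pts W.carrier) :=
  ⟨W.type, eq_empty_of_forall_notMem fun x hx =>
    absurd (le_pos_of_mem_iter (W := W) ⟨x, iter_subset _ _ hx⟩ hx) (not_le_of_gt (pos_lt_type _))⟩

end WOSet

/-! The position of an iterated derived set in the sequence indexed by ordinals -/

/-- The index of the iterated derived set that belongs to an ordinal of order type `t`. -/
noncomputable def idx (t : Ordinal.{0}) : Ordinal.{0} :=
  open Classical in if t < Ordinal.omega0 then t else sInf {o | t ≤ succ o}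

theorem idx_of_lt {t : Ordinal.{0}} (h : t < Ordinal.omega0) : idx t = t := if_pos h

theorem idx_succ_of_le {s : Ordinal.{0}} (h : Ordinal.omega0 ≤ s) : idx (succ s) = s := by
  rw [idx, if_neg (not_lt_of_ge (h.trans (le_succ s)))]
  have : {o | succ s ≤ succ o} = Set.Ici s := by
    ext o
    exact succ_le_succ_iff (a := s) (b := o)
  rw [this]
  exact csInf_Ici

theorem lt_omega0_or_eq_succ {t : Ordinal.{0}} (h : t = 0 ∨ ∃ s, t = succ s) :
    t < Ordinal.omega0 ∨ ∃ s, Ordinal.omega0 ≤ s ∧ t = succ s := by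
  rcases lt_or_ge t Ordinal.omega0 with hlt | hge
  · exact Or.inl hlt
  · rcases h with rfl | ⟨s, rfl⟩
    · exact Or.inl Ordinal.omega0_pos
    · refine Or.inr ⟨s, ?_, rfl⟩
      by_contra! hs
      exact absurd (Ordinal.isSuccLimit_omega0.succ_lt hs) (not_lt_of_ge hge)

theorem idx_succ {t : Ordinal.{0}} (h : t = 0 ∨ ∃ s, t = succ s) :
    idx (succ t) = succ (idx t) := by
  rcases lt_omega0_or_eq_succ h with h | ⟨s, hs, rfl⟩
  · rw [idx_of_lt h, idx_of_lt (Ordinal.isSuccLimit_omega0.succ_lt h)]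
  · rw [idx_succ_of_le hs, idx_succ_of_le (hs.trans (le_succ s))]

theorem idx_le {t : Ordinal.{0}} (h : t = 0 ∨ ∃ s, t = succ s) : idx t ≤ t := by
  rcases lt_omega0_or_eq_succ h with h | ⟨s, hs, rfl⟩
  · rw [idx_of_lt h]
  · rw [idx_succ_of_le hs]
    exact le_succ s

theorem le_idx_succ (r : Ordinal.{0}) : r ≤ idx (succ r) := by
  rcases lt_omega0_or_eq_succ (Or.inr ⟨r, rfl⟩) with h | ⟨s, hs, h⟩
  · rw [idx_of_lt h]
    exact le_succ r
  · rw [h, idx_succ_of_le hs]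
    exact (succ_injective h).le

theorem le_of_idx_le {t t' : Ordinal.{0}} (h : t = 0 ∨ ∃ s, t = succ s)
    (h' : t' = 0 ∨ ∃ s, t' = succ s) (hle : idx t ≤ idx t') : t ≤ t' := by
  rcases lt_omega0_or_eq_succ h with h | ⟨s, hs, rfl⟩ <;>
    rcases lt_omega0_or_eq_succ h' with h' | ⟨s', hs', rfl⟩
  · rwa [idx_of_lt h, idx_of_lt h'] at hle
  · exact (h.trans_le (hs'.trans (le_succ s'))).le
  · rw [idx_succ_of_le hs, idx_of_lt h'] at hle
    exact absurd (hs.trans hle) (not_le_of_gt h')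
  · rw [idx_succ_of_le hs, idx_succ_of_le hs'] at hle
    exact succ_le_succ hle

/-! Ordinals and iterated derived sets -/

theorem Ord.type_zero_or_succ (α : Ord) : α.type = 0 ∨ ∃ s, α.type = succ s :=
  α.toWOSet.type_zero_or_succ

theorem Ord.oLt_iff {α β : Ord} :
    OLt α.rel α.carrier β.rel β.carrier ↔ α.type < β.type :=
  WOSet.oLt_iff (W := α.toWOSet) (V := β.toWOSet)

theorem Ord.oLe_iff {α β : Ord} :
    OLe α.rel α.carrier β.rel β.carrier ↔ α.type ≤ β.type :=
  WOSet.oLe_iff (W := α.toWOSet) (V := β.toWOSet)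

theorem Ord.isPred_iff {α β : Ord} : β.IsPred α ↔ α.type = succ β.type := by
  constructor
  · rintro ⟨m, C, hm, hC, hβ⟩
    let m' : α.toWOSet.El := ⟨m, hm.1⟩
    have hlt : ∀ x : α.toWOSet.El, x.1 ≠ m → x < m' := fun x hx => hm.2 x.1 x.2 hx
    have hmax : ∀ x : α.toWOSet.El, x ≤ m' := fun x => by
      by_cases hx : x.1 = m
      · exact (WOSet.El.ext hx : x = m').le
      · exact (hlt x hx).le
    have hI : IsInitialSegment α.toWOSet.rel α.toWOSet.carrier C := by
      refine ⟨fun x hx => ((hC x).1 hx).1, fun x y hx hy hyx => (hC y).2 ⟨hy, ?_⟩⟩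
      rintro rfl
      exact not_lt_of_ge (hmax ⟨x, ((hC x).1 hx).1⟩)
        (show (⟨y, hy⟩ : α.toWOSet.El) < ⟨x, ((hC x).1 hx).1⟩ from hyx)
    have hT : (α.toWOSet.sub C hI.sub).type = WOSet.pos m' := by
      refine eq_of_forall_lt_iff fun o => ?_
      constructor
      · intro ho
        obtain ⟨x, rfl⟩ := WOSet.exists_pos_eq ho
        rw [WOSet.pos_sub hI x.2, WOSet.pos_lt_pos]
        exact hlt _ ((hC _).1 x.2).2
      · intro ho
        obtain ⟨x, rfl⟩ := WOSet.exists_pos_eq (ho.trans (WOSet.pos_lt_type m'))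
        rw [← WOSet.mem_iff_pos_lt hI]
        refine (hC _).2 ⟨x.2, fun h => ?_⟩
        rw [show x = m' from WOSet.El.ext h] at ho
        exact lt_irrefl _ ho
    have h := WOSet.oEq_iff (W := α.toWOSet.sub C hI.sub) (V := β.toWOSet) |>.1 hβ
    rw [Ord.type, Ord.type, WOSet.type_eq_of_isGreatest hmax, ← h, hT]
  · intro h
    have h0 : α.toWOSet.type ≠ 0 := fun h0 => succ_ne_bot β.type (h.symm.trans h0)
    obtain ⟨m, hmax, hm⟩ := WOSet.exists_max h0
    have hlt : β.toWOSet.type < α.toWOSet.type := (lt_succ β.type).trans_eq h.symm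
    obtain ⟨C, hC, hCT⟩ := WOSet.exists_initialSegment_of_type_lt hlt
    have hpos : WOSet.pos m = β.toWOSet.type := succ_injective (hm.symm.trans h)
    refine ⟨m.1, C, ⟨m.2, fun x hx hxm => ?_⟩, fun x => ?_, ?_⟩
    · exact lt_of_le_of_ne (hmax ⟨x, hx⟩) fun he => hxm (congrArg WOSet.El.val he)
    · constructor
      · intro hx
        have hxα := hC.isInitialSegment.sub x hx
        refine ⟨hxα, ?_⟩
        rintro rfl
        have := (WOSet.mem_iff_pos_lt hC.isInitialSegment m).1 hx
        rw [hCT, hpos] at this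
        exact lt_irrefl _ this
      · rintro ⟨hx, hxm⟩
        refine (WOSet.mem_iff_pos_lt hC.isInitialSegment ⟨x, hx⟩).2 ?_
        rw [hCT, ← hpos, WOSet.pos_lt_pos]
        exact lt_of_le_of_ne (hmax ⟨x, hx⟩) fun he => hxm (congrArg WOSet.El.val he)
    · exact WOSet.oEq_iff (W := α.toWOSet.sub C hC.isInitialSegment.sub) (V := β.toWOSet) |>.2 hCT

/-- The order type is some `succ s`. If `s` were zero or a successor, an initial segment would
realize it and be a predecessor. -/
theorem Ord.IsLimit.exists_type_eq {α : Ord} (h : α.IsLimit) :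
    ∃ s, IsSuccLimit s ∧ α.type = succ s := by
  have h0 : α.type ≠ 0 := by
    intro h0
    obtain ⟨x, hx⟩ := h.1
    exact notMem_empty x ((show α.carrier = empty from WOSet.type_eq_zero.1 h0) ▸ hx)
  obtain ⟨s, hs⟩ := α.type_zero_or_succ.resolve_left h0
  have hns : ¬ (s = 0 ∨ ∃ r, s = succ r) := by
    intro hc
    obtain ⟨β, hβ⟩ := α.toWOSet.exists_ord_type_eq ((le_succ s).trans_eq hs.symm) hc
    exact h.2 ⟨β, Ord.isPred_iff.2 (hβ.symm ▸ hs)⟩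
  rcases Ordinal.zero_or_succ_or_isSuccLimit s with hc | ⟨r, hr⟩ | hl
  · exact absurd (Or.inl hc) hns
  · exact absurd (Or.inr ⟨r, hr.symm⟩) hns
  · exact ⟨s, hl, hs⟩

/-- The ordinals below a limit of type `succ s` realize every successor `succ r` with `r < s`. Their
derivatives are therefore cofinal among those of order below `s`. -/
theorem mem_iter_idx_limit {A : Set ASet} {α : Ord} (h : α.IsLimit) (x : ASet) :
    x ∈ iter A (idx α.type) ↔
      ∀ β : Ord, OLt β.rel β.carrier α.rel α.carrier → x ∈ iter A (idx β.type) := by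
  obtain ⟨s, hs, hα⟩ := h.exists_type_eq
  rw [hα, idx_succ_of_le (Ordinal.omega0_le_of_isSuccLimit hs)]
  constructor
  · intro hx β hβ
    rw [Ord.oLt_iff, hα, lt_succ_iff] at hβ
    exact iter_anti A ((idx_le β.type_zero_or_succ).trans hβ) hx
  · intro hx
    rw [iter_limit hs]
    refine mem_iInter₂.2 fun r hr => ?_
    have hr' : succ r < α.type := by
      rw [hα]
      exact succ_lt_succ hr
    obtain ⟨β, hβ⟩ := WOSet.exists_ord_type_eq (W := α.toWOSet) hr'.le (Or.inr ⟨r, rfl⟩)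
    have := hx β (Ord.oLt_iff.2 (hβ.symm ▸ hr'))
    rw [hβ] at this
    exact iter_anti A (le_idx_succ r) this

theorem IterDerived.pts_eq {A B : ASet} {α : Ord} (h : IterDerived A α B) :
    pts B = iter (pts A) (idx α.type) := by
  induction h with
  | zero α hα =>
    rw [Ord.type, WOSet.type_eq_zero.2 hα, idx_of_lt Ordinal.omega0_pos, iter_zero]
  | succ α β B hβ _ ih =>
    rw [Ord.isPred_iff.1 hβ, idx_succ β.type_zero_or_succ, iter_succ (isClosed_pts A), ← ih,
      pts_derived]
  | limit α D B hα _ hB ih =>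
    ext x
    rw [mem_iter_idx_limit hα, mem_pts, hB]
    exact forall₂_congr fun β hβ => by rw [← ih β hβ, mem_pts]

theorem iterDerived_ofSet (A : ASet) (o : Ordinal.{0}) : ∀ α : Ord, α.type = o →
    IterDerived A α (ofSet (iter (pts A) (idx α.type))) := by
  induction o using WellFoundedLT.induction with
  | ind o ih =>
    rintro α rfl
    have hcl := isClosed_iter (isClosed_pts A)
    by_cases h0 : α.type = 0
    · rw [h0, idx_of_lt Ordinal.omega0_pos, iter_zero, ofSet_pts]
      exact IterDerived.zero α (WOSet.type_eq_zero.1 h0)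
    by_cases hp : ∃ β : Ord, β.IsPred α
    · obtain ⟨β, hβ⟩ := hp
      have hT := Ord.isPred_iff.1 hβ
      have := IterDerived.succ α β _ hβ (ih β.type (hT ▸ lt_succ β.type) β rfl)
      convert this using 1
      apply pts_injective
      rw [pts_ofSet (hcl _), pts_derived, pts_ofSet (hcl _), hT, idx_succ β.type_zero_or_succ,
        iter_succ (isClosed_pts A)]
    · have hl : α.IsLimit := by
        refine ⟨?_, hp⟩
        obtain ⟨m, -⟩ := WOSet.exists_max h0
        exact ⟨m.1, m.2⟩
      refine IterDerived.limit α (fun β => ofSet (iter (pts A) (idx β.type))) _ hl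
        (fun β hβ => ih β.type (Ord.oLt_iff.1 hβ) β rfl) fun x => ?_
      rw [mem_ofSet (hcl _), mem_iter_idx_limit hl]
      exact forall₂_congr fun β hβ => (mem_ofSet (hcl _)).symm

theorem isCBRank_iff {A : ASet} {α : Ord} : IsCBRank A α ↔
    derivedSet (iter (pts A) (idx α.type)) = ∅ ∧
      ∀ β : Ord, derivedSet (iter (pts A) (idx β.type)) = ∅ → α.type ≤ β.type := by
  have key : ∀ β : Ord, (∃ B, IterDerived A β B ∧ derived B = empty) ↔
      derivedSet (iter (pts A) (idx β.type)) = ∅ := by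
    intro β
    constructor
    · rintro ⟨B, hB, h⟩
      rw [← hB.pts_eq, ← pts_derived, h, pts_empty]
    · intro h
      refine ⟨_, iterDerived_ofSet A _ β rfl, pts_injective ?_⟩
      rw [pts_derived, pts_ofSet (isClosed_iter (isClosed_pts A) _), h, pts_empty]
  rw [IsCBRank, key]
  simp only [key, Ord.oLe_iff]

/-- The rank is at most the position of the maximum, because beyond that position at most the
maximum survives. So an initial segment of `W` is long enough to have the rank as its index. -/
theorem exists_ord_idx_eq_rk (W : WOSet) : ∃ α : Ord, idx α.type = rk (pts W.carrier) := by
  by_cases h0 : W.type = 0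
  · refine ⟨W.toOrd, ?_⟩
    rw [W.type_toOrd, h0, idx_of_lt Ordinal.omega0_pos]
    refine (le_antisymm (rk_le ?_) (zero_le)).symm
    rw [iter_zero, WOSet.type_eq_zero.1 h0, pts_empty]
    exact derivedSet_eq_empty_of_finite finite_empty
  · obtain ⟨m, hmax, hm⟩ := WOSet.exists_max h0
    have hle : rk (pts W.carrier) ≤ WOSet.pos m := by
      refine rk_le (derivedSet_eq_empty_of_finite ((finite_singleton m.1).subset fun x hx => ?_))
      have hx' := WOSet.le_pos_of_mem_iter (W := W) ⟨x, iter_subset _ _ hx⟩ hx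
      exact congrArg WOSet.El.val (le_antisymm (hmax _) (WOSet.pos_le_pos.1 hx'))
    rcases lt_or_ge (rk (pts W.carrier)) Ordinal.omega0 with hlt | hge
    · obtain ⟨α, hα⟩ := W.exists_ord_type_eq (o := rk (pts W.carrier))
        (hle.trans (WOSet.pos_lt_type m).le) (by
          obtain ⟨n, hn⟩ := Ordinal.lt_omega0.1 hlt
          rw [hn]
          cases n with
          | zero => exact Or.inl Nat.cast_zero
          | succ n => exact Or.inr ⟨n, by rw [Nat.cast_succ, succ_eq_add_one]⟩)
      exact ⟨α, by rw [hα, idx_of_lt hlt]⟩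
    · obtain ⟨α, hα⟩ := W.exists_ord_type_eq (o := succ (rk (pts W.carrier)))
        ((succ_le_succ hle).trans_eq hm.symm) (Or.inr ⟨_, rfl⟩)
      exact ⟨α, by rw [hα, idx_succ_of_le hge]⟩

/-- Since `idx` reflects the order and attains the rank, minimizing over internal ordinals gives the
same derivative as minimizing over all ordinals. -/
theorem isCBDegree_iff (W : WOSet) {D : ASet} :
    IsCBDegree W.carrier D ↔ pts D = top (pts W.carrier) := by
  obtain ⟨α₀, h₀⟩ := exists_ord_idx_eq_rk W
  have hd : derivedSet (iter (pts W.carrier) (idx α₀.type)) = ∅ := h₀ ▸ W.scattered.derivedSet_top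
  constructor
  · rintro ⟨α, hα, hD⟩
    rw [isCBRank_iff] at hα
    have hT : α.type = α₀.type := le_antisymm (hα.2 α₀ hd)
      (le_of_idx_le α₀.type_zero_or_succ α.type_zero_or_succ (h₀ ▸ rk_le hα.1))
    rw [hD.pts_eq, hT, h₀, top]
  · intro h
    refine ⟨α₀, isCBRank_iff.2 ⟨hd, fun β hβ => ?_⟩, ?_⟩
    · exact le_of_idx_le α₀.type_zero_or_succ β.type_zero_or_succ (h₀ ▸ rk_le hβ)
    · have := iterDerived_ofSet W.carrier _ α₀ rfl
      rwa [h₀, ← top, ← h, ofSet_pts] at this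

theorem existsUnique_isCBDegree (W : WOSet) : ∃! D, IsCBDegree W.carrier D := by
  refine ⟨ofSet (top (pts W.carrier)), (isCBDegree_iff W).2 ?_, fun D hD => pts_injective ?_⟩
  · exact pts_ofSet (isClosed_iter (isClosed_pts _) _)
  · exact ((isCBDegree_iff W).1 hD).trans (pts_ofSet (isClosed_iter (isClosed_pts _) _)).symm

/-! ### The set `ω` as a convergent sequence with its limit -/

theorem mem_of_mem_smallest {P : ASet → Prop} {C : Set ASet} (hC : IsClosed C)
    (h : ∀ x, P x → x ∈ C) {x : ASet} (hx : x ∈ smallest P) : x ∈ C := by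
  rw [← mem_ofSet hC]
  refine mem_smallest.2 fun n => ?_
  obtain ⟨y, hy, hyx⟩ := mem_smallest.1 hx n
  exact ⟨y, h y hy, hyx⟩

theorem mem_nOrd {n : ℕ} {x : ASet} : x ∈ nOrd n ↔ ∃ m < n, x = nOrd m := by
  induction n with
  | zero => exact ⟨fun h => absurd h (notMem_empty x), fun ⟨m, hm, _⟩ => absurd hm m.not_lt_zero⟩
  | succ n ih =>
    rw [nOrd, mem_adjoin, ih]
    constructor
    · rintro (⟨m, hm, rfl⟩ | rfl)
      · exact ⟨m, hm.trans (Nat.lt_succ_self n), rfl⟩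
      · exact ⟨n, Nat.lt_succ_self n, rfl⟩
    · rintro ⟨m, hm, rfl⟩
      rcases Nat.lt_succ_iff_lt_or_eq.1 hm with h | rfl
      · exact Or.inl ⟨m, h, rfl⟩
      · exact Or.inr rfl

theorem nOrd_mem_omega (n : ℕ) : nOrd n ∈ omega := mem_smallest.2 fun _ => ⟨_, ⟨n, rfl⟩, rfl⟩

/-- An element `m ≥ n` of `ω` agrees at level `k` with `k`, which does belong to `n` when `n ≥ k +
1`. So the finite ordinals converge to `ω`. -/
theorem approx_nOrd_eq_omega : ∀ {k n : ℕ}, k ≤ n → (nOrd n).approx k = omega.approx k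
  | 0, _, _ => rfl
  | k + 1, n, h => by
    change ((nOrd n).approx (k + 1)).elems = (omega.approx (k + 1)).elems
    rw [elems_approx_succ]
    ext a
    change _ ↔ ∃ x : ASet, (∃ n, x = nOrd n) ∧ x.approx k = a
    constructor
    · rintro ⟨x, hx, rfl⟩
      obtain ⟨m, -, rfl⟩ := mem_nOrd.1 hx
      exact ⟨_, ⟨m, rfl⟩, rfl⟩
    · rintro ⟨_, ⟨m, rfl⟩, rfl⟩
      rcases lt_or_ge m n with hm | hm
      · exact ⟨nOrd m, mem_nOrd.2 ⟨m, hm, rfl⟩, rfl⟩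
      · refine ⟨nOrd k, mem_nOrd.2 ⟨k, h, rfl⟩, ?_⟩
        exact (approx_nOrd_eq_omega le_rfl).trans
          (approx_nOrd_eq_omega ((Nat.le_of_succ_le h).trans hm)).symm

/-- Since `m ∈ n`, equality would make `m` agree at level `m` with some `i < m`, which the induction
excludes already at level `i + 1`. -/
theorem approx_nOrd_ne {m : ℕ} : ∀ {n : ℕ}, m < n →
    (nOrd n).approx (m + 1) ≠ (nOrd m).approx (m + 1) := by
  induction m using Nat.strong_induction_on with
  | _ m ih =>
    intro n hmn heq
    have h1 : (nOrd m).approx m ∈ ((nOrd n).approx (m + 1)).elems := mem_nOrd.2 ⟨m, hmn, rfl⟩ m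
    rw [heq, elems_approx_succ] at h1
    obtain ⟨x, hx, hxm⟩ := h1
    obtain ⟨i, hi, rfl⟩ := mem_nOrd.1 hx
    exact ih i hi hi (approx_eq_of_le (Nat.succ_le_of_lt hi) hxm.symm)

/-- The elements of `ω`, enumerated by the extended natural numbers. -/
noncomputable def omegaMap : ℕ∞ → ASet := ENat.recTopCoe omega nOrd

@[simp] theorem omegaMap_top : omegaMap ⊤ = omega := rfl

theorem approx_omegaMap_eq {k : ℕ} {i : ℕ∞} (h : (k : ℕ∞) ≤ i) :
    (omegaMap i).approx k = omega.approx k := by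
  induction i using ENat.recTopCoe with
  | top => rfl
  | coe n => exact approx_nOrd_eq_omega (by exact_mod_cast h)

theorem approx_omegaMap_ne {m : ℕ} {i : ℕ∞} (h : (m : ℕ∞) < i) :
    (omegaMap i).approx (m + 1) ≠ (nOrd m).approx (m + 1) := by
  induction i using ENat.recTopCoe with
  | top =>
    rw [omegaMap_top, ← approx_nOrd_eq_omega le_rfl]
    exact approx_nOrd_ne (Nat.lt_succ_self m)
  | coe n => exact approx_nOrd_ne (by exact_mod_cast h)

theorem omegaMap_injective : Function.Injective omegaMap := by
  have key : ∀ {i j : ℕ∞}, i < j → omegaMap i ≠ omegaMap j := by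
    intro i j hij heq
    obtain ⟨m, rfl⟩ := ENat.ne_top_iff_exists.1 hij.ne_top
    exact approx_omegaMap_ne hij (congrArg (fun x : ASet => x.approx (m + 1)) heq.symm)
  intro i j h
  rcases lt_trichotomy i j with hij | hij | hij
  · exact absurd h (key hij)
  · exact hij
  · exact absurd h.symm (key hij)

theorem continuous_omegaMap : Continuous omegaMap := by
  refine continuous_iff_continuousAt.2 fun i => ?_
  induction i using ENat.recTopCoe with
  | top =>
    intro U hU
    obtain ⟨k, hk⟩ := mem_nhds_iff_nbhd.1 hU
    refine mem_map.2 (mem_of_superset (Ioi_mem_nhds (ENat.natCast_lt_top k)) fun j hj => hk ?_)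
    exact approx_omegaMap_eq (le_of_lt hj)
  | coe n =>
    rw [ContinuousAt, ENat.nhds_natCast]
    exact tendsto_pure_nhds _ _

theorem mem_omega {x : ASet} : x ∈ omega ↔ ∃ i, x = omegaMap i := by
  constructor
  · intro h
    have : x ∈ range omegaMap := mem_of_mem_smallest (isCompact_range continuous_omegaMap).isClosed
      (fun x ⟨n, hn⟩ => ⟨n, hn.symm⟩) h
    obtain ⟨i, hi⟩ := this
    exact ⟨i, hi.symm⟩
  · rintro ⟨i, rfl⟩
    refine mem_smallest.2 fun k => ?_
    induction i using ENat.recTopCoe with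
    | top => exact ⟨_, ⟨k, rfl⟩, approx_nOrd_eq_omega le_rfl⟩
    | coe n => exact ⟨_, ⟨n, rfl⟩, rfl⟩

theorem mem_omegaLe {p : ASet} :
    p ∈ omegaLe ↔ ∃ i j, i ≤ j ∧ p = opair (omegaMap i) (omegaMap j) := by
  constructor
  · intro h
    have hcl : IsClosed ((fun q : ℕ∞ × ℕ∞ => opairMap (omegaMap q.1, omegaMap q.2)) ''
        {q | q.1 ≤ q.2}) := by
      refine (IsCompact.image (isClosed_le continuous_fst continuous_snd).isCompact ?_).isClosed
      exact continuous_opairMap.comp ((continuous_omegaMap.comp continuous_fst).prodMk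
        (continuous_omegaMap.comp continuous_snd))
    obtain ⟨q, hq, rfl⟩ := mem_of_mem_smallest hcl (fun x ⟨m, n, hmn, hx⟩ =>
      ⟨((m : ℕ∞), (n : ℕ∞)), by simpa using hmn, hx.symm⟩) h
    exact ⟨q.1, q.2, hq, rfl⟩
  · rintro ⟨i, j, hij, rfl⟩
    refine mem_smallest.2 fun k => ?_
    obtain ⟨m, n, hmn, hm, hn⟩ : ∃ m n : ℕ, m ≤ n ∧ (nOrd m).approx k = (omegaMap i).approx k ∧
        (nOrd n).approx k = (omegaMap j).approx k := by
      induction i using ENat.recTopCoe with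
      | top =>
        rw [top_le_iff] at hij
        exact ⟨k, k, le_rfl, approx_nOrd_eq_omega le_rfl, hij ▸ approx_nOrd_eq_omega le_rfl⟩
      | coe m =>
        induction j using ENat.recTopCoe with
        | top => exact ⟨m, max m k, le_max_left _ _, rfl, approx_nOrd_eq_omega (le_max_right _ _)⟩
        | coe n => exact ⟨m, n, by exact_mod_cast hij, rfl, rfl⟩
    exact ⟨_, ⟨m, n, hmn, rfl⟩, opair_congr hm hn⟩

theorem opair_mem_omegaLe {i j : ℕ∞} :
    opair (omegaMap i) (omegaMap j) ∈ omegaLe ↔ i ≤ j := by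
  rw [mem_omegaLe]
  constructor
  · rintro ⟨i', j', h, he⟩
    obtain ⟨h1, h2⟩ := opair_inj.1 he
    rwa [omegaMap_injective h1, omegaMap_injective h2]
  · exact fun h => ⟨i, j, h, rfl⟩

theorem lt_omegaLe {i j : ℕ∞} : Lt omegaLe (omegaMap i) (omegaMap j) ↔ i < j := by
  rw [Lt, opair_mem_omegaLe, omegaMap_injective.ne_iff, lt_iff_le_and_ne]

theorem wellOrders_omegaLe : WellOrders omegaLe omega := by
  have hrel : IsRelation omegaLe omega omega := by
    intro p hp
    obtain ⟨i, j, -, rfl⟩ := mem_omegaLe.1 hp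
    exact ⟨_, _, mem_omega.2 ⟨i, rfl⟩, mem_omega.2 ⟨j, rfl⟩, rfl⟩
  have hex : ∀ {x y}, opair x y ∈ omegaLe → ∃ i j, x = omegaMap i ∧ y = omegaMap j := by
    intro x y h
    obtain ⟨i, j, -, he⟩ := mem_omegaLe.1 h
    exact ⟨i, j, opair_inj.1 he⟩
  refine ⟨⟨hrel, ?_, ?_, ?_, ?_⟩, ?_, ?_⟩
  · intro x hx
    obtain ⟨i, rfl⟩ := mem_omega.1 hx
    exact opair_mem_omegaLe.2 le_rfl
  · intro x y h h'
    obtain ⟨i, j, rfl, rfl⟩ := hex h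
    rw [le_antisymm (opair_mem_omegaLe.1 h) (opair_mem_omegaLe.1 h')]
  · intro x y z h h'
    obtain ⟨i, j, rfl, rfl⟩ := hex h
    obtain ⟨-, k, -, rfl⟩ := hex h'
    exact opair_mem_omegaLe.2 ((opair_mem_omegaLe.1 h).trans (opair_mem_omegaLe.1 h'))
  · intro x y hx hy
    obtain ⟨i, rfl⟩ := mem_omega.1 hx
    obtain ⟨j, rfl⟩ := mem_omega.1 hy
    rw [opair_mem_omegaLe, opair_mem_omegaLe]
    exact le_total i j
  · rintro B hB ⟨x, hx⟩
    obtain ⟨i, rfl⟩ := mem_omega.1 (hB x hx)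
    obtain ⟨m, hm, hmin⟩ := WellFounded.has_min (wellFounded_lt (α := ℕ∞))
      {i | omegaMap i ∈ B} ⟨i, hx⟩
    refine ⟨omegaMap m, hm, fun y hy hne => ?_⟩
    obtain ⟨j, rfl⟩ := mem_omega.1 (hB y hy)
    exact lt_omegaLe.2 (lt_of_le_of_ne (not_lt.1 (hmin j hy)) fun h => hne (h ▸ rfl))
  · intro x hx
    obtain ⟨i, rfl⟩ := mem_omega.1 hx
    induction i using ENat.recTopCoe with
    | top =>
      refine ⟨0, fun y hy _ hlt => ?_⟩
      obtain ⟨j, rfl⟩ := mem_omega.1 hy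
      exact not_top_lt (lt_omegaLe.1 hlt)
    | coe n =>
      -- Level `n` would not do: there `n` agrees with all larger elements.
      refine ⟨n + 1, fun y hy hyn hlt => ?_⟩
      obtain ⟨j, rfl⟩ := mem_omega.1 hy
      exact approx_omegaMap_ne (lt_omegaLe.1 hlt) hyn

/-- `ω` with its natural ordering. -/
def omegaW : WOSet := ⟨omega, omegaLe, omega, fun _ h => h, wellOrders_omegaLe⟩

/-- The natural numbers as an initial segment of `ω`. -/
noncomputable def natSeg : @PrincipalSeg ℕ omegaW.El (· < ·) (· < ·) where
  toFun n := ⟨omegaMap n, mem_omega.2 ⟨n, rfl⟩⟩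
  inj' m n h := by
    have h' : omegaMap m = omegaMap n := congrArg WOSet.El.val h
    exact_mod_cast omegaMap_injective h'
  map_rel_iff' {m n} := by
    refine Iff.trans (lt_omegaLe (i := m) (j := n)) ?_
    exact Nat.cast_lt
  top := ⟨omegaMap ⊤, mem_omega.2 ⟨⊤, rfl⟩⟩
  mem_range_iff_rel' := by
    rintro ⟨x, hx⟩
    obtain ⟨i, rfl⟩ := mem_omega.1 hx
    refine Iff.trans ?_ (lt_omegaLe (i := i) (j := ⊤)).symm
    constructor
    · rintro ⟨n, hn⟩
      have h' : omegaMap n = omegaMap i := congrArg WOSet.El.val hn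
      rw [← omegaMap_injective h']
      exact ENat.natCast_lt_top n
    · intro h
      obtain ⟨n, rfl⟩ := ENat.ne_top_iff_exists.1 h.ne
      exact ⟨n, rfl⟩

theorem pos_omega : WOSet.pos natSeg.top = Ordinal.omega0 :=
  (Ordinal.typein_top natSeg).trans Ordinal.type_nat_lt

/-- The set `ω` is its own largest element, so its order type is `ω + 1` and not `ω`. -/
theorem type_omegaW : omegaW.type = succ Ordinal.omega0 := by
  rw [← pos_omega]
  refine WOSet.type_eq_of_isGreatest ?_
  rintro ⟨x, hx⟩
  obtain ⟨i, rfl⟩ := mem_omega.1 hx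
  exact opair_mem_omegaLe.2 le_top

theorem pos_nOrd (n : ℕ) : WOSet.pos (natSeg n) = n :=
  (Ordinal.typein_apply (natSeg : @InitialSeg ℕ omegaW.El (· < ·) (· < ·)) n).trans
    (Ordinal.typein_lt_nat n)

theorem nOrd_succ_eq_seg (n : ℕ) : nOrd (n + 1) = WOSet.seg (natSeg n) := by
  refine ext_iff_mem.2 fun x => ?_
  rw [mem_nOrd, WOSet.mem_seg]
  constructor
  · rintro ⟨m, hm, rfl⟩
    refine ⟨nOrd_mem_omega m, opair_mem_omegaLe (i := m) (j := n) |>.2 ?_⟩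
    exact_mod_cast Nat.lt_succ_iff.1 hm
  · rintro ⟨hx, hle⟩
    obtain ⟨i, rfl⟩ := mem_omega.1 hx
    have hle' : i ≤ n := opair_mem_omegaLe.1 hle
    obtain ⟨m, rfl⟩ := ENat.ne_top_iff_exists.1 (hle'.trans_lt (ENat.natCast_lt_top n)).ne
    exact ⟨m, Nat.lt_succ_iff.2 (by exact_mod_cast hle'), rfl⟩

/-- The ordinal `2` with the ordering inherited from `ω`. -/
def twoW : WOSet := omegaW.sub (nOrd 2) fun x hx => by
  obtain ⟨m, -, rfl⟩ := mem_nOrd.1 hx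
  exact nOrd_mem_omega m

theorem type_twoW : twoW.type = 2 := by
  have h := WOSet.type_seg (natSeg 1)
  rw [pos_nOrd] at h
  have h2 : twoW = omegaW.sub (WOSet.seg (natSeg 1)) (WOSet.isInitialSegment_seg _).sub := by
    have := nOrd_succ_eq_seg 1
    unfold twoW WOSet.sub
    congr 1
  rw [h2, h, succ_eq_add_one, Nat.cast_one, one_add_one_eq_two]

/-- Together with compactness this lets disjoint closed sets be separated by a clopen set, as in
`WOSet.exists_clopen_seg`. -/
instance : TotallyDisconnectedSpace ASet :=
  ⟨isTotallyDisconnected_of_image isEmbedding_approx.continuous.continuousOn approx_injective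
    (isTotallyDisconnected_of_totallyDisconnectedSpace _)⟩

/-! Sums of indexed systems -/

/-- The elements of the sum of the sets `A j`, `j ∈ J`. -/
def sumSet (J : ASet) (A : ASet → ASet) : Set ASet := opairMap '' {p | p.1 ∈ J ∧ p.2 ∈ A p.1}

theorem opair_mem_sumSet {J : ASet} {A : ASet → ASet} {j a : ASet} :
    opair j a ∈ sumSet J A ↔ j ∈ J ∧ a ∈ A j := by
  constructor
  · rintro ⟨⟨j', a'⟩, h, he⟩
    obtain ⟨rfl, rfl⟩ := opair_inj.1 he
    exact h
  · exact fun h => ⟨(j, a), h, rfl⟩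

/-- Membership `a ∈ A j` is tested level by level, and each test depends continuously on `j` and
`a`. -/
theorem isClosed_sumSet {J : ASet} {A : ASet → ASet} (hA : ContinuousOn A (pts J)) :
    IsClosed (sumSet J A) := by
  refine isClosedEmbedding_opairMap.isClosedMap _ ?_
  have hJ : IsClosed (pts J ×ˢ (univ : Set ASet)) := (isClosed_pts J).prod isClosed_univ
  have : {p : ASet × ASet | p.1 ∈ J ∧ p.2 ∈ A p.1} = ⋂ n, (pts J ×ˢ univ) ∩
      (fun p : ASet × ASet => (p.2.approx n, (A p.1).approx (n + 1))) ⁻¹'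
        {q | q.1 ∈ q.2.elems} := by
    ext p
    simp only [mem_iInter]
    exact ⟨fun h n => ⟨⟨h.1, trivial⟩, h.2 n⟩, fun h => ⟨(h 0).1.1, fun n => (h n).2⟩⟩
  rw [this]
  refine isClosed_iInter fun n => ContinuousOn.preimage_isClosed_of_isClosed ?_ hJ
    (isClosed_discrete _)
  refine ContinuousOn.prodMk ((continuous_approx n).comp continuous_snd).continuousOn ?_
  exact (continuous_approx (n + 1)).comp_continuousOn
    (hA.comp continuous_fst.continuousOn fun p hp => hp.1)

/-- An indexed system is a function of the theory, so the summands vary continuously with the index.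
-/
theorem isSumOfSmaller_iff {κ J : ASet} : IsSumOfSmaller κ J ↔
    ∃ A : ASet → ASet, ContinuousOn A (pts J) ∧ (∀ j ∈ J, CLt (A j) κ) ∧
      Embeds (pts κ) (sumSet J A) ∧ Embeds (sumSet J A) (pts κ) := by
  constructor
  · rintro ⟨I, 𝓕, S, hI, hlt, hS, h1, h2⟩
    obtain ⟨A, hc, -, hA⟩ := hI.exists_continuousOn
    have hSA : pts S = sumSet J A := by
      ext z
      rw [mem_pts, hS]
      constructor
      · rintro ⟨j, B, a, hj, ha, rfl⟩
        obtain ⟨hj', rfl⟩ := (hA _ _).1 hj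
        exact opair_mem_sumSet.2 ⟨hj', ha⟩
      · rintro ⟨⟨j, a⟩, ⟨hj, ha⟩, rfl⟩
        exact ⟨j, A j, a, (hA _ _).2 ⟨hj, rfl⟩, ha, rfl⟩
    rw [cLe_iff_embeds, hSA] at h1 h2
    exact ⟨A, hc, fun j hj => hlt j _ ((hA _ _).2 ⟨hj, rfl⟩), h1, h2⟩
  · rintro ⟨A, hc, hlt, h1, h2⟩
    -- The whole universe is closed, hence a set, and can serve as codomain.
    obtain ⟨I, hI, hA⟩ := isFunction_ofPairs (B := ofSet univ) hc
      fun x _ => (mem_ofSet isClosed_univ).2 trivial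
    have hcl := isClosed_sumSet hc
    refine ⟨I, _, ofSet (sumSet J A), hI, ?_, ?_, ?_⟩
    · intro j B hj
      obtain ⟨hj', rfl⟩ := (hA _ _).1 hj
      exact hlt j hj'
    · intro z
      rw [mem_ofSet hcl]
      constructor
      · rintro ⟨⟨j, a⟩, ⟨hj, ha⟩, rfl⟩
        exact ⟨j, A j, a, (hA _ _).2 ⟨hj, rfl⟩, ha, rfl⟩
      · rintro ⟨j, B, a, hj, ha, rfl⟩
        obtain ⟨hj', rfl⟩ := (hA _ _).1 hj
        exact opair_mem_sumSet.2 ⟨hj', ha⟩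
    · rw [CEq, cLe_iff_embeds, cLe_iff_embeds, pts_ofSet hcl]
      exact ⟨h1, h2⟩

instance : Inhabited (ASet × ASet) := ⟨(empty, empty)⟩

/-- The second component of an ordered pair. -/
noncomputable def osnd (z : ASet) : ASet := (Function.invFun opairMap z).2

@[simp] theorem osnd_opair (a b : ASet) : osnd (opair a b) = b :=
  congrArg Prod.snd (Function.leftInverse_invFun opairMap_injective (a, b))

theorem continuousOn_osnd : ContinuousOn osnd (range opairMap) := by
  refine continuousOn_iff_isClosed.2 fun t ht => ⟨opairMap '' (univ ×ˢ t),
    isClosedEmbedding_opairMap.isClosedMap _ (isClosed_univ.prod ht), ?_⟩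
  ext z
  constructor
  · rintro ⟨hz, ⟨a, b⟩, rfl⟩
    rw [mem_preimage] at hz
    exact ⟨⟨(a, b), ⟨trivial, osnd_opair a b ▸ hz⟩, rfl⟩, mem_range_self _⟩
  · rintro ⟨⟨⟨a, b⟩, ⟨-, hb⟩, rfl⟩, h⟩
    exact ⟨mem_preimage.2 ((osnd_opair a b).symm ▸ hb), h⟩

theorem sumSet_subset_range (J : ASet) (A : ASet → ASet) : sumSet J A ⊆ range opairMap :=
  image_subset_range _ _

/-- At an isolated index, a sum looks like the summand. -/
theorem mem_iter_of_opair_mem {J : ASet} {A : ASet → ASet} {j a : ASet} {U : Set ASet}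
    (hU : IsOpen U) (hjU : j ∈ U) (hiso : ∀ i ∈ J, i ∈ U → i = j) {o : Ordinal.{0}}
    (h : opair j a ∈ iter (sumSet J A) o) : a ∈ iter (pts (A j)) o := by
  -- In this open part of the universe only pairs of the sum with first component `j` remain, and
  -- there `osnd` is a continuous injection into `A j`.
  have hV : IsOpen (opairMap '' (Uᶜ ×ˢ univ))ᶜ :=
    (isClosedEmbedding_opairMap.isClosedMap _ (hU.isClosed_compl.prod isClosed_univ)).isOpen_compl
  have hmem : ∀ z ∈ sumSet J A ∩ (opairMap '' (Uᶜ ×ˢ univ))ᶜ, ∃ b ∈ A j, z = opair j b := by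
    rintro _ ⟨⟨⟨i, b⟩, ⟨hi, hb⟩, rfl⟩, hz⟩
    have hiU : i ∈ U := by
      by_contra hiU
      exact hz ⟨(i, b), ⟨hiU, trivial⟩, rfl⟩
    obtain rfl := hiso i hi hiU
    exact ⟨b, hb, rfl⟩
  have h' : opair j a ∈ iter (sumSet J A ∩ (opairMap '' (Uᶜ ×ˢ univ))ᶜ) o := by
    rw [iter_inter_open _ hV]
    refine ⟨h, ?_⟩
    rintro ⟨⟨i, b⟩, ⟨hi, -⟩, he⟩
    exact hi ((opair_inj.1 he).1.symm ▸ hjU)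
  have := map_mem_iter (f := osnd) (B := pts (A j))
    (continuousOn_osnd.mono (inter_subset_left.trans (sumSet_subset_range J A))) ?_ ?_ o _ h'
  · rwa [osnd_opair] at this
  · intro x hx y hy hxy
    obtain ⟨b, -, rfl⟩ := hmem x hx
    obtain ⟨c, -, rfl⟩ := hmem y hy
    rw [osnd_opair, osnd_opair] at hxy
    rw [hxy]
  · intro x hx
    obtain ⟨b, hb, rfl⟩ := hmem x hx
    rwa [osnd_opair]

theorem embeds_sumSet {X : Set ASet} {J : ASet} {A : ASet → ASet} {g : ASet → ASet}
    (hc : ContinuousOn g X) (hg : ∀ x ∈ X, g x ∈ J ∧ x ∈ A (g x)) : Embeds X (sumSet J A) :=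
  ⟨fun x => opairMap (g x, x), continuous_opairMap.comp_continuousOn (hc.prodMk continuousOn_id),
    fun _ _ _ _ h => (opair_inj.1 h).2, fun x hx => ⟨(g x, x), hg x hx, rfl⟩⟩

/-! Comparison of cardinalities -/

theorem Embeds.trans {X Y Z : Set ASet} : Embeds X Y → Embeds Y Z → Embeds X Z :=
  fun ⟨f, hc, hi, hm⟩ ⟨g, hc', hi', hm'⟩ => ⟨g ∘ f, hc'.comp hc hm, hi'.comp hi hm, hm'.comp hm⟩

theorem cLt_iff_of_scattered {A B : ASet} (hA : Scattered (pts A)) (hB : Scattered (pts B)) :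
    CLt A B ↔ cbKey (pts A) < cbKey (pts B) := by
  rw [CLt, CEq, cLe_iff_embeds, cLe_iff_embeds,
    embeds_iff (isClosed_pts A) (isClosed_pts B) hA hB,
    embeds_iff (isClosed_pts B) (isClosed_pts A) hB hA, lt_iff_le_not_ge]
  tauto

theorem iter_eq_empty_of_rk_lt {X : Set ASet} (hX : IsClosed X) (sX : Scattered X)
    {o : Ordinal.{0}} (h : rk X < o) : iter X o = ∅ := by
  refine subset_empty_iff.1 ((iter_anti X (succ_le_of_lt h)).trans ?_)
  rw [iter_succ hX, ← top, sX.derivedSet_top]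

theorem le_rk_of_nonempty {X : Set ASet} (hX : IsClosed X) (sX : Scattered X) {o : Ordinal.{0}}
    (h : (iter X o).Nonempty) : o ≤ rk X := by
  by_contra! hlt
  rw [iter_eq_empty_of_rk_lt hX sX hlt] at h
  exact not_nonempty_empty h

theorem cbKey_lt_of_ncard_lt {X Y : Set ASet} (hf : (iter X (rk Y)).Finite)
    (h : (iter X (rk Y)).ncard < (top Y).ncard) : cbKey X < cbKey Y := by
  rw [cbKey, cbKey, Prod.Lex.toLex_lt_toLex]
  rcases (rk_le (derivedSet_eq_empty_of_finite hf)).lt_or_eq with hlt | heq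
  · exact Or.inl hlt
  · refine Or.inr ⟨heq, ?_⟩
    dsimp only
    rwa [top, heq]

/-- Either the rank drops, or the rank is the same and the degree has fewer than one point. -/
theorem iter_eq_empty_of_cbKey_lt {X Y : Set ASet} (hX : IsClosed X) (sX : Scattered X)
    {m : ASet} (hY : top Y = {m}) (h : cbKey X < cbKey Y) : iter X (rk Y) = ∅ := by
  rw [cbKey, cbKey, Prod.Lex.toLex_lt_toLex, hY, ncard_singleton] at h
  rcases h with h | ⟨h, h'⟩
  · exact iter_eq_empty_of_rk_lt hX sX h
  · dsimp only at h h'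
    rw [← h]
    exact (ncard_eq_zero (sX.finite_top hX)).1 (Nat.lt_one_iff.1 h')

theorem pts_nOrd_one : pts (nOrd 1) = {empty} := by
  ext x
  rw [mem_pts, mem_nOrd]
  constructor
  · rintro ⟨m, hm, rfl⟩
    rw [Nat.lt_one_iff.1 hm]
    rfl
  · rintro rfl
    exact ⟨0, Nat.one_pos, rfl⟩

theorem cLe_nOrd_one_iff {A : ASet} : CLe A (nOrd 1) ↔ (pts A).Subsingleton := by
  rw [cLe_iff_embeds, pts_nOrd_one]
  constructor
  · rintro ⟨f, -, hi, hm⟩ x hx y hy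
    exact hi hx hy ((hm hx).trans (hm hy).symm)
  · exact fun h => ⟨fun _ => empty, continuousOn_const, fun x hx y hy _ => h hx hy, fun _ _ => rfl⟩

theorem nOrd_one_cLe_iff {A : ASet} : CLe (nOrd 1) A ↔ (pts A).Nonempty := by
  rw [cLe_iff_embeds, pts_nOrd_one]
  constructor
  · rintro ⟨f, -, -, hm⟩
    exact ⟨_, hm rfl⟩
  · rintro ⟨x, hx⟩
    exact ⟨fun _ => x, continuousOn_const, fun a ha b hb _ => ha.trans hb.symm, fun _ _ => hx⟩

theorem nOrd_one_cLt_iff {A : ASet} : CLt (nOrd 1) A ↔ (pts A).Nontrivial := by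
  rw [CLt, CEq, cLe_nOrd_one_iff, nOrd_one_cLe_iff, ← Set.not_subsingleton_iff]
  constructor
  · tauto
  · intro h
    exact ⟨(Set.not_subsingleton_iff.1 h).nonempty, fun h' => h h'.2⟩

theorem cEq_nOrd_one_iff {A : ASet} : CEq A (nOrd 1) ↔ ∃ m, pts A = {m} := by
  rw [CEq, cLe_nOrd_one_iff, nOrd_one_cLe_iff, exists_eq_singleton_iff_nonempty_subsingleton,
    and_comm]

theorem infinite_of_isInfinite {A : ASet} (h : IsInfinite A) : (pts A).Infinite := by
  intro hf
  obtain ⟨B, f, hBA, hne, hb⟩ := h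
  obtain ⟨F, -, hm, hF⟩ := hb.toIsFunction.exists_continuousOn
  have hi : InjOn F (pts A) := fun a ha a' ha' he =>
    hb.injective a a' (F a') ((hF _ _).2 ⟨ha, he⟩) ((hF _ _).2 ⟨ha', rfl⟩)
  have hlt : (pts B).ncard < (pts A).ncard :=
    ncard_lt_ncard (lt_of_le_of_ne (show pts B ≤ pts A from hBA) fun h => hne (pts_injective h)) hf
  have hle : (F '' pts A).ncard ≤ (pts B).ncard :=
    ncard_le_ncard (image_subset_iff.2 hm) (hf.subset hBA)
  rw [hi.ncard_image] at hle
  exact absurd hlt (not_lt_of_ge hle)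

/-! ### Clopen initial segments and finite order types -/

namespace WOSet

variable {W : WOSet}

/-- Initial segments with a largest element are relatively clopen. -/
theorem exists_clopen_seg (x : W.El) : ∃ U, IsClopen U ∧ ∀ y : W.El, y.1 ∈ U ↔ y ≤ x := by
  have hopen : IsOpen (Iic x) := by
    rw [isOpen_iff_mem_nhds]
    intro y hy
    rcases (mem_Iic.1 hy).lt_or_eq with hlt | rfl
    · exact mem_of_superset (isOpen_Iio.mem_nhds hlt) fun z hz => le_of_lt (mem_Iio.1 hz)
    · obtain ⟨n, hn⟩ := exists_nbhd_le y
      refine mem_of_superset (W.isClosedEmbedding_val.continuous.continuousAt.preimage_mem_nhds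
        (nbhd_mem_nhds n y.1)) fun z hz => hn z hz
  have h1 : IsClosed (El.val '' Iic x) := W.isClosedEmbedding_val.isClosedMap _ isClosed_Iic
  have h2 : IsClosed (El.val '' (Iic x)ᶜ) :=
    W.isClosedEmbedding_val.isClosedMap _ hopen.isClosed_compl
  obtain ⟨U, hU, hsub, hsup⟩ := exists_clopen_of_closed_subset_open h1 h2.isOpen_compl (by
    rintro _ ⟨y, hy, rfl⟩ ⟨z, hz, he⟩
    exact hz (W.isClosedEmbedding_val.injective he ▸ hy))
  refine ⟨U, hU, fun y => ⟨fun hy => ?_, fun hy => hsub ⟨y, hy, rfl⟩⟩⟩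
  by_contra hc
  exact hsup hy ⟨y, hc, rfl⟩

theorem pts_seg_eq {x : W.El} {U : Set ASet} (hU : ∀ y : W.El, y.1 ∈ U ↔ y ≤ x) :
    pts (seg x) = pts W.carrier ∩ U := by
  ext y
  rw [mem_pts, mem_seg]
  exact ⟨fun ⟨h, h'⟩ => ⟨h, (hU ⟨y, h⟩).2 h'⟩, fun ⟨h, h'⟩ => ⟨h, (hU ⟨y, h⟩).1 h'⟩⟩

theorem mem_iter_seg {x y : W.El} {o : Ordinal.{0}} :
    y.1 ∈ iter (pts (seg x)) o ↔ y.1 ∈ iter (pts W.carrier) o ∧ y ≤ x := by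
  obtain ⟨U, hU, hUx⟩ := exists_clopen_seg x
  rw [pts_seg_eq hUx, iter_inter_open _ hU.isOpen]
  exact and_congr_right fun _ => hUx y

theorem scattered_seg (x : W.El) : Scattered (pts (seg x)) :=
  W.scattered.of_embeds (Embeds.of_subset (isInitialSegment_seg x).sub)

theorem finite_of_type_lt_omega0 (h : W.type < Ordinal.omega0) : (pts W.carrier).Finite := by
  obtain ⟨n, hn⟩ := Ordinal.lt_omega0.1 h
  have hx : ∀ x : W.El, ∃ k : Fin n, pos x = (k : ℕ) := by
    intro x
    have hlt := pos_lt_type x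
    rw [hn] at hlt
    obtain ⟨k, hk⟩ := Ordinal.lt_omega0.1 (hlt.trans (Ordinal.natCast_lt_omega0 n))
    rw [hk, Nat.cast_lt] at hlt
    exact ⟨⟨k, hlt⟩, hk⟩
  choose k hk using hx
  have : Finite W.El := Finite.of_injective k fun x y h => pos_injective (by rw [hk, hk, h])
  have hr : pts W.carrier = range (El.val : W.El → ASet) :=
    Set.ext fun x => ⟨fun hx => ⟨⟨x, hx⟩, rfl⟩, fun ⟨y, hy⟩ => hy ▸ y.2⟩
  rw [hr]
  exact finite_range _

theorem type_lt_omega0_of_lt_succ (h : W.type < succ Ordinal.omega0) : W.type < Ordinal.omega0 := by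
  refine lt_of_le_of_ne (lt_succ_iff.1 h) fun he => ?_
  rcases W.type_zero_or_succ with h0 | ⟨s, hs⟩
  · exact Ordinal.omega0_ne_zero (he.symm.trans h0)
  · have hlt : s < Ordinal.omega0 := he ▸ hs ▸ lt_succ s
    have := Ordinal.isSuccLimit_omega0.succ_lt hlt
    rw [← hs, he] at this
    exact lt_irrefl _ this

end WOSet

/-! ### Initial ordinals and cofinality two -/

namespace WOSet

variable {W : WOSet}

/-- The well-ordered set `W` is not equinumerous to any of its proper initial segments. -/
def IsInitial (W : WOSet) : Prop :=
  ∀ S, IsProperInitialSegment W.rel W.carrier S → ¬ CEq W.carrier S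

theorem exists_isGreatest_of_isClosed {C : Set ASet} (hC : IsClosed C) (hCW : C ⊆ pts W.carrier)
    (hne : C.Nonempty) : ∃ d : W.El, d.1 ∈ C ∧ ∀ y : W.El, y.1 ∈ C → y ≤ d := by
  obtain ⟨x, hx⟩ := hne
  obtain ⟨d, hd, h⟩ := exists_isMax _ (hC.preimage W.isClosedEmbedding_val.continuous)
    ⟨⟨x, hCW hx⟩, hx⟩
  exact ⟨d, hd, fun y hy => h hy⟩

theorem exists_isLeast_of_subset {C : Set ASet} (hCW : C ⊆ pts W.carrier)
    (hne : C.Nonempty) : ∃ d : W.El, d.1 ∈ C ∧ ∀ y : W.El, y.1 ∈ C → d ≤ y := by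
  obtain ⟨x, hx⟩ := hne
  obtain ⟨d, hd, h⟩ := exists_isLeast {y : W.El | y.1 ∈ C} ⟨⟨x, hCW hx⟩, hx⟩
  exact ⟨d, hd, fun y hy => h hy⟩

theorem isClosed_top (W : WOSet) : IsClosed (top (pts W.carrier)) :=
  isClosed_iter (isClosed_pts _) _

theorem finite_top (W : WOSet) : (top (pts W.carrier)).Finite :=
  W.scattered.finite_top (isClosed_pts _)

theorem top_subset (W : WOSet) : top (pts W.carrier) ⊆ pts W.carrier := iter_subset _ _

theorem seg_ssubset {x y : W.El} (h : x < y) :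
    IsProperInitialSegment W.rel W.carrier (seg x) :=
  ⟨isInitialSegment_seg x, fun he => not_le_of_gt h (seg_eq_carrier.1 he y)⟩

/-- The maximal element of a well-ordered cardinal belongs to its Cantor-Bendixson degree. -/
theorem IsInitial.max_mem_top (hW : W.IsInitial) {m : W.El} (hm : ∀ y, y ≤ m) :
    m.1 ∈ top (pts W.carrier) := by
  obtain ⟨d, hd, hmax⟩ := exists_isGreatest_of_isClosed W.isClosed_top W.top_subset
    (top_nonempty (isClosed_pts _) ⟨m.1, m.2⟩)
  rcases (hm d).lt_or_eq with hlt | rfl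
  · exfalso
    -- The whole degree lies at or below `d`, so the proper segment up to `d` has the entire degree
    -- in its derivative of the same order, and `W` embeds into it.
    refine hW (seg d) (seg_ssubset hlt) ⟨?_, CLe.of_sub (isInitialSegment_seg d).sub⟩
    rw [cLe_iff_embeds]
    have hf := W.finite_top
    have hpos : 0 < hf.toFinset.card := Finset.card_pos.2 ⟨d.1, hf.mem_toFinset.2 hd⟩
    refine embeds_of_iter_subset_finset (rk (pts W.carrier)) (hf.toFinset.card - 1)
      (s := hf.toFinset) (t := hf.toFinset) ?_ ?_ (by omega) (by omega)
    · rw [Finite.coe_toFinset]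
      exact le_rfl
    · rw [Finite.coe_toFinset]
      intro y hy
      exact (mem_iter_seg (y := ⟨y, W.top_subset hy⟩)).2 ⟨hy, hmax ⟨y, _⟩ hy⟩
  · exact hd

/-! Cofinality -/

/-- Uniqueness comes for free: initial segments of the same `W` are determined by their order types.
-/
theorem cofinalityEq_of {L : ASet} (hL : IsInitialSegment W.rel W.carrier L)
    (hs : IsSumOfSmaller W.carrier L)
    (hmin : ∀ M, ∀ hM : IsInitialSegment W.rel W.carrier M, IsSumOfSmaller W.carrier M →
      (W.sub L hL.sub).type ≤ (W.sub M hM.sub).type) {V : WOSet}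
    (hV : (W.sub L hL.sub).type = V.type) : CofinalityEq W.rel W.carrier V.rel V.carrier := by
  have hcof : IsCofinality W.rel W.carrier L :=
    ⟨hL, hs, fun M hM hMs =>
      (oLe_iff (W := W.sub L hL.sub) (V := W.sub M hM.sub)).2 (hmin M hM hMs)⟩
  have huniq : ∀ M, IsCofinality W.rel W.carrier M → M = L := by
    rintro M ⟨hM, hMs, h⟩
    have h1 := (oLe_iff (W := W.sub M hM.sub) (V := W.sub L hL.sub)).1 (h L hL hs)
    exact ext_iff_mem.2 fun x => ⟨(sub_iff_type_le hM hL).2 h1 x,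
      (sub_iff_type_le hL hM).2 (hmin M hM hMs) x⟩
  refine ⟨⟨L, hcof, huniq⟩, fun M hM => ?_⟩
  rw [huniq M hM]
  exact (oEq_iff (W := W.sub L hL.sub)).2 hV

theorem type_eq_of_cofinalityEq {L : ASet} {V : WOSet}
    (h : CofinalityEq W.rel W.carrier V.rel V.carrier) (hL : IsCofinality W.rel W.carrier L) :
    (W.sub L hL.1.sub).type = V.type :=
  (oEq_iff (W := W.sub L hL.1.sub)).1 (h.2 L hL)

theorem type_eq_type_of_cofinalityEq {V V' : WOSet}
    (h : CofinalityEq W.rel W.carrier V.rel V.carrier)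
    (h' : CofinalityEq W.rel W.carrier V'.rel V'.carrier) : V.type = V'.type := by
  obtain ⟨L, hL, -⟩ := h.1
  exact (type_eq_of_cofinalityEq h hL).symm.trans (type_eq_of_cofinalityEq h' hL)

/-- A nonempty sum over at most one index is a copy of its only summand, which would then be as
large as `W`. -/
theorem two_le_type_of_isSumOfSmaller (hne : (pts W.carrier).Nonempty) {M : ASet}
    (hM : IsInitialSegment W.rel W.carrier M) (hs : IsSumOfSmaller W.carrier M) :
    2 ≤ (W.sub M hM.sub).type := by
  obtain ⟨A, -, hlt, ⟨f, hc, hi, hm⟩, -⟩ := isSumOfSmaller_iff.1 hs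
  by_contra! hlt2
  obtain ⟨x, hx⟩ := hne
  obtain ⟨⟨j, a⟩, ⟨hj, -⟩, -⟩ := hm hx
  have h0 : ∀ i : (W.sub M hM.sub).El, pos i = 0 := fun i => by
    have h2 := pos_lt_type i
    have : (W.sub M hM.sub).type ≤ 1 := by
      rw [← one_add_one_eq_two, ← succ_eq_add_one] at hlt2
      exact lt_succ_iff.1 hlt2
    exact Order.lt_one_iff.1 (h2.trans_le this)
  have huniq : ∀ i ∈ M, i = j := fun i hi' => by
    have := pos_injective ((h0 ⟨i, hi'⟩).trans (h0 ⟨j, hj⟩).symm)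
    exact congrArg El.val this
  have hmem : ∀ z ∈ sumSet M A, ∃ b ∈ A j, z = opair j b := by
    rintro _ ⟨⟨i, b⟩, ⟨hi', hb⟩, rfl⟩
    obtain rfl := huniq i hi'
    exact ⟨b, hb, rfl⟩
  have hemb : CLe W.carrier (A j) := by
    rw [cLe_iff_embeds]
    refine Embeds.trans ⟨f, hc, hi, hm⟩ ⟨osnd, continuousOn_osnd.mono (sumSet_subset_range M A),
      fun y hy z hz hyz => ?_, fun y hy => ?_⟩
    · obtain ⟨b, -, rfl⟩ := hmem y hy
      obtain ⟨c, -, rfl⟩ := hmem z hz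
      rw [osnd_opair, osnd_opair] at hyz
      rw [hyz]
    · obtain ⟨b, hb, rfl⟩ := hmem y hy
      rwa [osnd_opair]
  exact (hlt j hj).2 ⟨(hlt j hj).1, hemb⟩

/-- If the Cantor-Bendixson degree has more than one element, the cofinality is `2`. -/
theorem cofinalityEq_two (hD : (top (pts W.carrier)).Nontrivial) :
    CofinalityEq W.rel W.carrier omegaLe (nOrd 2) := by
  classical
  -- Cutting directly after the least point `d` of the degree leaves `d` on one side and `d'` on the
  -- other.
  obtain ⟨d, hd, hdmin⟩ := exists_isLeast_of_subset W.top_subset hD.nonempty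
  obtain ⟨d', hd', hne⟩ := hD.exists_ne d.1
  have hdd' : d < ⟨d', W.top_subset hd'⟩ :=
    lt_of_le_of_ne (hdmin _ hd') fun h => hne (congrArg El.val h).symm
  have hpos : 0 < pos (⟨d', W.top_subset hd'⟩ : W.El) :=
    (zero_le).trans_lt (pos_lt_pos.2 hdd')
  have hone : 1 < W.type := by
    exact (Order.one_le_iff_pos.2 hpos).trans_lt (pos_lt_type _)
  obtain ⟨x₀, hx₀⟩ := exists_pos_eq (zero_lt_one.trans hone)
  obtain ⟨x₁, hx₁⟩ := exists_pos_eq hone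
  have h01 : x₀.1 ≠ x₁.1 := fun h => by
    have := hx₀.symm.trans ((congrArg pos (El.ext h)).trans hx₁)
    exact zero_ne_one this
  have hmemL : ∀ j, j ∈ seg x₁ ↔ j = x₀.1 ∨ j = x₁.1 := by
    intro j
    rw [mem_seg]
    constructor
    · rintro ⟨hj, hle⟩
      rw [← pos_le_pos, hx₁] at hle
      rcases Order.le_one_iff.1 hle with h | h
      · exact Or.inl (congrArg El.val (pos_injective (h.trans hx₀.symm)))
      · exact Or.inr (congrArg El.val (pos_injective (h.trans hx₁.symm)))
    · rintro (rfl | rfl)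
      · refine ⟨x₀.2, pos_le_pos.1 ?_⟩
        rw [hx₀]
        exact zero_le
      · exact ⟨x₁.2, le_rfl⟩
  have htype : (W.sub (seg x₁) (isInitialSegment_seg x₁).sub).type = 2 := by
    rw [type_seg, hx₁, succ_eq_add_one, one_add_one_eq_two]
  obtain ⟨U, hU, hUd⟩ := exists_clopen_seg d
  have hcl : IsClosed (pts W.carrier ∩ U) := (isClosed_pts _).inter hU.isClosed
  have hcl' : IsClosed (pts W.carrier ∩ Uᶜ) := (isClosed_pts _).inter hU.compl.isClosed
  let A : ASet → ASet := fun j =>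
    if j = x₀.1 then ofSet (pts W.carrier ∩ U) else ofSet (pts W.carrier ∩ Uᶜ)
  have hA₀ : A x₀.1 = ofSet (pts W.carrier ∩ U) := if_pos rfl
  have hA₁ : A x₁.1 = ofSet (pts W.carrier ∩ Uᶜ) := if_neg h01.symm
  have hdU : d.1 ∈ U := (hUd d).2 le_rfl
  have hd'U : d' ∉ U := fun h => not_le_of_gt hdd' ((hUd ⟨d', W.top_subset hd'⟩).1 h)
  -- A clopen piece that misses a point of the degree has strictly fewer points in the derivative of
  -- that order.
  have hsmall : ∀ T : Set ASet, IsClopen T → (∃ z ∈ top (pts W.carrier), z ∉ T) →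
      CLt (ofSet (pts W.carrier ∩ T)) W.carrier := by
    rintro T hT ⟨z, hz, hzT⟩
    have hclT : IsClosed (pts W.carrier ∩ T) := (isClosed_pts _).inter hT.isClosed
    rw [cLt_iff_of_scattered _ W.scattered, pts_ofSet hclT]
    · have hsub : iter (pts W.carrier ∩ T) (rk (pts W.carrier)) ⊂ top (pts W.carrier) := by
        rw [iter_inter_open _ hT.isOpen]
        exact ⟨inter_subset_left, fun h => hzT (h hz).2⟩
      exact cbKey_lt_of_ncard_lt (W.finite_top.subset hsub.subset)
        (ncard_lt_ncard hsub W.finite_top)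
    · rw [pts_ofSet hclT]
      exact W.scattered.of_embeds (Embeds.of_subset inter_subset_left)
  refine cofinalityEq_of (V := twoW) (isInitialSegment_seg x₁) (isSumOfSmaller_iff.2
    ⟨A, ?_, ?_, ?_, ?_⟩) ?_ (htype.trans type_twoW.symm)
  · have hfin : (pts (seg x₁)).Finite :=
      ((finite_singleton x₁.1).insert x₀.1).subset fun j hj => (hmemL j).1 hj
    exact hfin.continuousOn A
  · intro j hj
    rcases (hmemL j).1 hj with rfl | rfl
    · rw [hA₀]
      exact hsmall U hU ⟨d', hd', hd'U⟩
    · rw [hA₁]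
      exact hsmall Uᶜ hU.compl ⟨d.1, hd, fun h => h hdU⟩
  · refine embeds_sumSet (g := fun y => if y ∈ U then x₀.1 else x₁.1) ?_ ?_
    · refine Continuous.continuousOn (continuous_const.if ?_ continuous_const)
      intro a ha
      rw [show {x | x ∈ U} = U from rfl, hU.frontier_eq] at ha
      exact absurd ha (Set.notMem_empty a)
    · intro y hy
      by_cases hyU : y ∈ U
      · rw [if_pos hyU, hA₀, mem_ofSet hcl]
        exact ⟨(hmemL _).2 (Or.inl rfl), hy, hyU⟩
      · rw [if_neg hyU, hA₁, mem_ofSet hcl']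
        exact ⟨(hmemL _).2 (Or.inr rfl), hy, hyU⟩
  · have hmem : ∀ z ∈ sumSet (seg x₁) A, ∃ a ∈ W.carrier, (z = opair x₀.1 a ∧ a ∈ U) ∨
        (z = opair x₁.1 a ∧ a ∉ U) := by
      rintro _ ⟨⟨j, a⟩, ⟨hj, ha⟩, rfl⟩
      dsimp only at hj ha
      rcases (hmemL j).1 hj with rfl | rfl
      · rw [hA₀, mem_ofSet hcl] at ha
        exact ⟨a, ha.1, Or.inl ⟨rfl, ha.2⟩⟩
      · rw [hA₁, mem_ofSet hcl'] at ha
        exact ⟨a, ha.1, Or.inr ⟨rfl, ha.2⟩⟩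
    refine ⟨osnd, continuousOn_osnd.mono (sumSet_subset_range _ A), fun y hy z hz hyz => ?_,
      fun y hy => ?_⟩
    · obtain ⟨a, -, ⟨rfl, ha⟩ | ⟨rfl, ha⟩⟩ := hmem y hy <;>
        obtain ⟨b, -, ⟨rfl, hb⟩ | ⟨rfl, hb⟩⟩ := hmem z hz <;>
        rw [osnd_opair, osnd_opair] at hyz <;> subst hyz
      · rfl
      · exact absurd ha hb
      · exact absurd hb ha
      · rfl
    · obtain ⟨a, ha, ⟨rfl, -⟩ | ⟨rfl, -⟩⟩ := hmem y hy <;> rwa [osnd_opair]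
  · intro M hM hs
    rw [htype]
    exact two_le_type_of_isSumOfSmaller ⟨d.1, d.2⟩ hM hs

end WOSet

/-! The level at which two sets begin to differ -/

/-- The first level at which `y` differs from `m`. -/
noncomputable def level (m y : ASet) : ℕ∞ :=
  open Classical in if h : ∃ n, y.approx n ≠ m.approx n then (Nat.find h : ℕ∞) else ⊤

theorem level_self (m : ASet) : level m m = ⊤ := dif_neg fun ⟨_, h⟩ => h rfl

theorem natCast_lt_level_iff {m y : ASet} {n : ℕ} : (n : ℕ∞) < level m y ↔ y ∈ nbhd n m := by
  classical
  unfold level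
  split_ifs with h
  · rw [Nat.cast_lt]
    constructor
    · exact fun hn => not_not.1 (Nat.find_min h hn)
    · intro hy
      by_contra hle
      exact Nat.find_spec h (approx_eq_of_le (not_lt.1 hle) hy)
  · push Not at h
    exact ⟨fun _ => h n, fun _ => ENat.natCast_lt_top n⟩

theorem level_eq_top_iff {m y : ASet} : level m y = ⊤ ↔ y = m := by
  refine ⟨fun h => ASet.ext (funext fun n => ?_), fun h => h ▸ level_self m⟩
  exact natCast_lt_level_iff.1 (h ▸ ENat.natCast_lt_top n)

theorem continuous_level (m : ASet) : Continuous (level m) := by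
  refine continuous_iff_continuousAt.2 fun y => ?_
  by_cases hy : level m y = ⊤
  · rw [ContinuousAt, hy, tendsto_order]
    refine ⟨fun i hi => ?_, fun i hi => absurd hi not_top_lt⟩
    obtain ⟨n, rfl⟩ := ENat.ne_top_iff_exists.1 hi.ne
    rw [level_eq_top_iff.1 hy]
    filter_upwards [nbhd_mem_nhds n m] with z hz
    exact natCast_lt_level_iff.2 hz
  · obtain ⟨n, hn⟩ := ENat.ne_top_iff_exists.1 hy
    have hev : level m =ᶠ[𝓝 y] fun _ => level m y := by
      filter_upwards [nbhd_mem_nhds n y] with z hz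
      have key : ∀ k ≤ n, ((k : ℕ∞) < level m z ↔ (k : ℕ∞) < level m y) := fun k hk => by
        rw [natCast_lt_level_iff, natCast_lt_level_iff]
        have : z.approx k = y.approx k := approx_eq_of_le hk hz
        change _ = _ ↔ _ = _
        rw [this]
      rw [← hn]
      refine le_antisymm (not_lt.1 fun h => ?_) ?_
      · rw [key n le_rfl, ← hn] at h
        exact lt_irrefl _ h
      · by_contra! hlt
        obtain ⟨k, hk⟩ := ENat.ne_top_iff_exists.1 hlt.ne_top
        rw [← hk, Nat.cast_lt] at hlt
        have := (key k hlt.le).2 (by rw [← hn]; exact_mod_cast hlt)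
        rw [← hk] at this
        exact lt_irrefl _ this
    exact (continuousAt_const).congr hev.symm

/-! ### Cofinality `ω` -/

namespace WOSet

variable {W : WOSet}

theorem nonempty_of_rk_pos (h : 0 < rk (pts W.carrier)) : (pts W.carrier).Nonempty := by
  by_contra hne
  have h0 : rk (pts W.carrier) ≤ 0 := rk_le (by
    rw [iter_zero, not_nonempty_iff_eq_empty.1 hne]
    exact derivedSet_eq_empty_of_finite finite_empty)
  exact not_lt_of_ge h0 h

theorem infinite_of_rk_pos (h : 0 < rk (pts W.carrier)) : (pts W.carrier).Infinite := by
  simpa using infinite_iter_of_lt_rk h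

/-- An initial segment of order type `ω + 1` is enumerated by the extended natural numbers. -/
theorem exists_enumeration {L : ASet} (hL : Sub L W.carrier)
    (hT : (W.sub L hL).type = succ Ordinal.omega0) :
    ∃ E : ℕ∞ → ASet, Continuous E ∧ Function.Injective E ∧ range E = pts L := by
  obtain ⟨e⟩ := Ordinal.type_eq.1 (type_omegaW.trans hT.symm)
  let e : omegaW.El ≃o (W.sub L hL).El := OrderIso.ofRelIsoLT e
  let f : ℕ∞ → omegaW.El := fun i => ⟨omegaMap i, mem_omega.2 ⟨i, rfl⟩⟩
  have hf : Continuous f := omegaW.isClosedEmbedding_val.isInducing.continuous_iff.2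
    continuous_omegaMap
  refine ⟨fun i => (e (f i)).val,
    (W.sub L hL).isClosedEmbedding_val.continuous.comp (e.continuous.comp hf), ?_, ?_⟩
  · intro i j h
    exact omegaMap_injective (congrArg El.val (e.injective (El.ext h)) :)
  · ext x
    constructor
    · rintro ⟨i, rfl⟩
      exact (e (f i)).mem
    · intro hx
      obtain ⟨i, hi⟩ := mem_omega.1 (e.symm ⟨x, hx⟩).mem
      refine ⟨i, ?_⟩
      have : f i = e.symm ⟨x, hx⟩ := El.ext hi.symm
      dsimp only
      rw [this, e.apply_symm_apply]

/-- Slice `W` by the level at which its points leave `m`. The slices are small because `m` is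
isolated in each of them, and their sum again has at most one point in the derivative of order `rk`.
-/
theorem isSumOfSmaller_of_type_eq {m : ASet} (hD : top (pts W.carrier) = {m})
    (hrk : 0 < rk (pts W.carrier)) {L : ASet} (hL : Sub L W.carrier)
    (hT : (W.sub L hL).type = succ Ordinal.omega0) : IsSumOfSmaller W.carrier L := by
  obtain ⟨E, hEc, hEi, hEr⟩ := exists_enumeration hL hT
  have hmK : m ∈ pts W.carrier := W.top_subset (hD ▸ mem_singleton m)
  have hE : IsClosedEmbedding E := hEc.isClosedEmbedding hEi
  have hclB : ∀ i, IsClosed {y | y ∈ pts W.carrier ∧ (y = m ∨ level m y = i)} := fun i =>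
    (isClosed_pts _).inter (isClosed_singleton.union
      (isClosed_singleton.preimage (continuous_level m)))
  -- The point `m` is added to every slice because an empty slice would be far from the limit `B ⊤ =
  -- {m}` and destroy continuity at `⊤`.
  let B : ℕ∞ → ASet := fun i => ofSet {y | y ∈ pts W.carrier ∧ (y = m ∨ level m y = i)}
  have hB : ∀ i, pts (B i) = {y | y ∈ pts W.carrier ∧ (y = m ∨ level m y = i)} := fun i =>
    pts_ofSet (hclB i)
  have hBsub : ∀ i, pts (B i) ⊆ pts W.carrier := fun i => by
    rw [hB]
    exact fun y hy => hy.1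
  have hBtop : pts (B ⊤) = {m} := by
    rw [hB]
    ext y
    refine ⟨fun hy => hy.2.elim id level_eq_top_iff.1, ?_⟩
    rintro rfl
    exact ⟨hmK, Or.inl rfl⟩
  have hBc : Continuous B := by
    refine continuous_iff_continuousAt.2 fun i => ?_
    induction i using ENat.recTopCoe with
    | coe n =>
      rw [ContinuousAt, ENat.nhds_natCast]
      exact tendsto_pure_nhds _ _
    | top =>
      intro U hU
      obtain ⟨k, hk⟩ := mem_nhds_iff_nbhd.1 hU
      refine mem_map.2 (mem_of_superset (Ioi_mem_nhds (ENat.natCast_lt_top k)) fun i hi => hk ?_)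
      cases k with
      | zero => rfl
      | succ k =>
        change ((B i).approx (k + 1)).elems = ((B ⊤).approx (k + 1)).elems
        rw [elems_approx_succ, elems_approx_succ, hBtop, image_singleton]
        ext a
        constructor
        · rintro ⟨y, hy, rfl⟩
          rw [hB] at hy
          rcases hy.2 with rfl | hy
          · rfl
          · refine natCast_lt_level_iff.1 ?_
            rw [hy]
            exact lt_trans (by exact_mod_cast Nat.lt_succ_self k) (mem_Ioi.1 hi)
        · rintro rfl
          refine ⟨m, ?_, rfl⟩
          rw [hB]
          exact ⟨hmK, Or.inl rfl⟩
  have hBiter : ∀ i, iter (pts (B i)) (rk (pts W.carrier)) = ∅ := by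
    refine fun i => eq_empty_of_forall_notMem fun y hy => ?_
    have hym : y = m := by
      have : y ∈ top (pts W.carrier) := map_mem_iter continuousOn_id (injOn_id _)
        (fun z hz => hBsub i hz) _ y hy
      rwa [hD] at this
    subst hym
    -- Positive rank makes a surviving `m` an accumulation point of its slice, but the other points
    -- of a slice stay at a constant finite level.
    have hacc := (mem_iter.1 hy).2 0 hrk
    rw [iter_zero, mem_derivedSet, accPt_iff_nhds] at hacc
    induction i using ENat.recTopCoe with
    | top =>
      obtain ⟨z, ⟨-, hz⟩, hne⟩ := hacc univ univ_mem
      rw [hBtop] at hz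
      exact hne hz
    | coe n =>
      obtain ⟨z, ⟨hzn, hz⟩, hne⟩ := hacc _ (nbhd_mem_nhds n y)
      rw [hB] at hz
      rcases hz.2 with h | h
      · exact hne h
      · have := natCast_lt_level_iff.2 hzn
        rw [h] at this
        exact lt_irrefl _ this
  have hBlt : ∀ i, CLt (B i) W.carrier := by
    intro i
    rw [cLt_iff_of_scattered (W.scattered.of_embeds (Embeds.of_subset (hBsub i))) W.scattered]
    refine cbKey_lt_of_ncard_lt ?_ ?_
    · rw [hBiter]
      exact finite_empty
    · rw [hBiter, hD, ncard_empty, ncard_singleton]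
      exact Nat.one_pos
  let A : ASet → ASet := fun j => B (Function.invFun E j)
  have hAE : ∀ i, A (E i) = B i := fun i => congrArg B (Function.leftInverse_invFun hEi i)
  have hL' : ∀ j, j ∈ L ↔ ∃ i, E i = j := fun j => by
    rw [← mem_pts, ← hEr]
    rfl
  refine isSumOfSmaller_iff.2 ⟨A, ?_, ?_, ?_, ?_⟩
  · refine continuousOn_iff_isClosed.2 fun t ht => ⟨E '' (B ⁻¹' t),
      hE.isClosedMap _ (ht.preimage hBc), ?_⟩
    ext j
    constructor
    · rintro ⟨hj, hjL⟩
      obtain ⟨i, rfl⟩ := (hL' j).1 hjL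
      rw [mem_preimage, hAE] at hj
      exact ⟨⟨i, hj, rfl⟩, hjL⟩
    · rintro ⟨⟨i, hi, rfl⟩, hjL⟩
      refine ⟨?_, hjL⟩
      rw [mem_preimage, hAE]
      exact hi
  · intro j hj
    obtain ⟨i, rfl⟩ := (hL' j).1 hj
    rw [hAE]
    exact hBlt i
  · refine embeds_sumSet (g := fun y => E (level m y))
      (hEc.comp (continuous_level m)).continuousOn fun y hy => ⟨(hL' _).2 ⟨_, rfl⟩, ?_⟩
    rw [hAE, ← mem_pts, hB]
    exact ⟨hy, Or.inr rfl⟩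
  -- Finite indices are isolated, so their summands contribute nothing at this stage; only the one
  -- point over `E ⊤` can survive.
  · refine embeds_of_iter_subset_singleton (rk (pts W.carrier)) (x := opair (E ⊤) m) (p := m) ?_
      (show m ∈ top (pts W.carrier) from hD ▸ mem_singleton m)
    intro z hz
    obtain ⟨⟨j, a⟩, ⟨hj, ha⟩, rfl⟩ := iter_subset _ _ hz
    obtain ⟨i, rfl⟩ := (hL' j).1 hj
    dsimp only at ha hz
    induction i using ENat.recTopCoe with
    | top =>
      rw [hAE, ← mem_pts, hBtop] at ha
      rw [mem_singleton_iff.1 ha]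
      rfl
    | coe n =>
      exfalso
      have hcl : IsClosed (E '' {(n : ℕ∞)}ᶜ) := by
        refine hE.isClosedMap _ (IsOpen.isClosed_compl ?_)
        rw [isOpen_singleton_iff_nhds_eq_pure, ENat.nhds_natCast]
      have := mem_iter_of_opair_mem (U := (E '' {(n : ℕ∞)}ᶜ)ᶜ) hcl.isOpen_compl ?_ ?_ hz
      · rw [hAE, hBiter] at this
        exact this
      · rintro ⟨k, hk, he⟩
        exact hk (hEi he)
      · intro j hj hjU
        obtain ⟨k, rfl⟩ := (hL' j).1 hj
        by_contra hne
        exact hjU ⟨k, fun h => hne (h ▸ rfl), rfl⟩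

/-- A shorter index set is finite, as `ω` is not an order type here. Then all indices are isolated,
and the image of `m` would survive to stage `rk` in one smaller summand. -/
theorem succ_omega0_le_type_of_isSumOfSmaller {m : ASet} (hD : top (pts W.carrier) = {m})
    {M : ASet} (hM : IsInitialSegment W.rel W.carrier M)
    (hs : IsSumOfSmaller W.carrier M) : succ Ordinal.omega0 ≤ (W.sub M hM.sub).type := by
  by_contra! hlt
  have hfin : (pts M).Finite := finite_of_type_lt_omega0 (type_lt_omega0_of_lt_succ hlt)
  obtain ⟨A, -, hA, ⟨f, hc, hi, hm⟩, -⟩ := isSumOfSmaller_iff.1 hs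
  have hmem := map_mem_iter hc hi hm (rk (pts W.carrier)) m
    (show m ∈ top (pts W.carrier) from hD ▸ mem_singleton m)
  obtain ⟨⟨j, a⟩, ⟨hj, ha⟩, he⟩ := iter_subset _ _ hmem
  rw [← he] at hmem
  obtain ⟨U, hU, hjU, hiso⟩ := exists_clopen_separating hfin.toFinset j
  have hsc : Scattered (pts (A j)) := W.scattered.of_embeds (cLe_iff_embeds.1 (hA j hj).1)
  have := mem_iter_of_opair_mem hU.isOpen hjU
    (fun i hi hiU => hiso i (hfin.mem_toFinset.2 hi) hiU) hmem
  rw [iter_eq_empty_of_cbKey_lt (isClosed_pts _) hsc hD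
    ((cLt_iff_of_scattered hsc W.scattered).1 (hA j hj))] at this
  exact this

/-- If the Cantor-Bendixson degree has exactly one element and the rank is positive, the cofinality
is `ω`. -/
theorem cofinalityEq_omega {m : ASet} (hD : top (pts W.carrier) = {m})
    (hrk : 0 < rk (pts W.carrier)) : CofinalityEq W.rel W.carrier omegaLe omega := by
  have hω : Ordinal.omega0 < W.type := by
    by_contra! hle
    exact infinite_of_rk_pos hrk
      (finite_of_type_lt_omega0 (type_lt_omega0_of_lt_succ (lt_succ_iff.2 hle)))
  obtain ⟨x, hx⟩ := exists_pos_eq hω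
  have hT : (W.sub (seg x) (isInitialSegment_seg x).sub).type = succ Ordinal.omega0 := by
    rw [type_seg, hx]
  refine cofinalityEq_of (V := omegaW) (isInitialSegment_seg x)
    (isSumOfSmaller_of_type_eq hD hrk _ hT) ?_ (hT.trans type_omegaW.symm)
  intro M hM hs
  rw [hT]
  exact succ_omega0_le_type_of_isSumOfSmaller hD hM hs

theorem rk_pos_of_top_eq {m : ASet} (hD : top (pts W.carrier) = {m})
    (hK : (pts W.carrier).Nontrivial) : 0 < rk (pts W.carrier) := by
  refine pos_of_ne_zero fun h0 => ?_
  rw [top, h0, iter_zero] at hD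
  rw [hD] at hK
  exact hK.not_subsingleton subsingleton_singleton

theorem type_le_of_isCofinality {L : ASet} (hL : IsCofinality W.rel W.carrier L) :
    (W.sub L hL.1.sub).type ≤ succ Ordinal.omega0 := by
  by_cases hK : (pts W.carrier).Nontrivial
  · by_cases hD : (top (pts W.carrier)).Nontrivial
    · rw [type_eq_of_cofinalityEq (V := twoW) (cofinalityEq_two hD) hL, type_twoW]
      refine le_of_lt (lt_of_lt_of_le ?_ (le_succ _))
      exact_mod_cast Ordinal.natCast_lt_omega0 2
    · obtain ⟨m, hm⟩ := exists_eq_singleton_iff_nonempty_subsingleton.2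
        ⟨top_nonempty (isClosed_pts _) hK.nonempty, not_nontrivial_iff.1 hD⟩
      rw [type_eq_of_cofinalityEq (V := omegaW)
        (cofinalityEq_omega hm (rk_pos_of_top_eq hm hK)) hL, type_omegaW]
  -- With at most one element, `κ` has no initial segment of order type above `1`.
  · have hsub := not_nontrivial_iff.1 hK
    by_contra! hlt
    have h1 : (1 : Ordinal.{0}) < (W.sub L hL.1.sub).type :=
      Ordinal.one_lt_omega0.trans ((lt_succ _).trans hlt)
    obtain ⟨x, hx⟩ := exists_pos_eq (zero_lt_one.trans h1)
    obtain ⟨y, hy⟩ := exists_pos_eq h1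
    have hxy : x = y := El.ext (hsub (hL.1.sub _ x.2) (hL.1.sub _ y.2))
    exact zero_ne_one (hx.symm.trans ((congrArg pos hxy).trans hy))

end WOSet

/-! ### Successor and limit cardinals -/

theorem Scattered.of_cLt {A B : ASet} (hB : Scattered (pts B)) (h : CLt A B) :
    Scattered (pts A) := hB.of_embeds (cLe_iff_embeds.1 h.1)

namespace WOSet

variable {W : WOSet}

/-- The shortest initial segment with a property of cardinalities that the empty set does not have
is a well-ordered cardinal. -/
theorem exists_isCardinal_seg {Q : Set ASet → Prop} (hmono : ∀ {X Y}, Embeds X Y → Q X → Q Y)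
    (h0 : ¬ Q ∅) {x : W.El} (hx : Q (pts (seg x))) :
    ∃ y ≤ x, Q (pts (seg y)) ∧ IsCardinal (seg y) := by
  obtain ⟨y, hy, hmin⟩ := exists_isLeast {y : W.El | Q (pts (seg y))} ⟨x, hx⟩
  refine ⟨y, hmin hx, hy, Or.inl ⟨(W.sub (seg y) (isInitialSegment_seg y).sub).toOrd.rel,
    (W.sub (seg y) (isInitialSegment_seg y).sub).toOrd.wellOrders, fun S hS hc => ?_⟩⟩
  have hSW : IsInitialSegment W.rel W.carrier S := by
    refine ⟨fun z hz => (isInitialSegment_seg y).sub z (hS.isInitialSegment.sub z hz), ?_⟩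
    intro a b ha hb hlt
    have ha' := hS.isInitialSegment.sub a ha
    have hb' := (isInitialSegment_seg y).mem_of_lt ha' hb hlt
    exact hS.isInitialSegment.mem_of_lt ha hb' ⟨rel_toOrd.2 ⟨hlt.1, hb', ha'⟩, hlt.2⟩
  have hQ : Q (pts S) := hmono (cLe_iff_embeds.1 hc.1) hy
  rcases eq_seg_of_isInitialSegment hSW with rfl | ⟨z, rfl⟩
  · exact h0 (pts_empty ▸ hQ)
  · refine hS.2 (ext_iff_mem.2 fun a => ⟨hS.isInitialSegment.sub a, fun ha => ?_⟩)
    obtain ⟨ha, hle⟩ := mem_seg.1 ha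
    exact mem_seg.2 ⟨ha, hle.trans (hmin hQ)⟩

/-- A well-ordered cardinal whose Cantor-Bendixson degree has more than one element is a
successor. -/
theorem IsInitial.exists_isCardPred (hW : W.IsInitial) (hD : (top (pts W.carrier)).Nontrivial) :
    ∃ μ, IsCardPred μ W.carrier := by
  obtain ⟨m, -, hm⟩ := exists_isMax (univ : Set W.El) isClosed_univ
    (by obtain ⟨x, hx⟩ := hD.nonempty; exact ⟨⟨x, W.top_subset hx⟩, trivial⟩)
  have hmD : m.1 ∈ top (pts W.carrier) := hW.max_mem_top fun y => hm trivial
  obtain ⟨d', hd', hne⟩ := hD.exists_ne m.1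
  -- The segment up to the second largest point of the degree loses exactly the point `m`, so it has
  -- the same rank and one point less.
  obtain ⟨d, ⟨hd, hdm⟩, hmax⟩ := exists_isGreatest_of_isClosed
    (C := top (pts W.carrier) \ {m.1}) (W.finite_top.sdiff).isClosed
    (sdiff_subset.trans W.top_subset) ⟨d', hd', hne⟩
  have hiter : iter (pts (seg d)) (rk (pts W.carrier)) = top (pts W.carrier) \ {m.1} := by
    ext y
    constructor
    · intro hy
      have hyW : y ∈ W.carrier := (isInitialSegment_seg d).sub y (iter_subset _ _ hy)
      obtain ⟨h1, h2⟩ := (mem_iter_seg (y := ⟨y, hyW⟩)).1 hy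
      refine ⟨h1, ?_⟩
      rintro rfl
      exact hdm (congrArg El.val (le_antisymm (hm trivial) h2))
    · intro hy
      exact (mem_iter_seg (y := ⟨y, W.top_subset hy.1⟩)).2 ⟨hy.1, hmax ⟨y, W.top_subset hy.1⟩ hy⟩
  have hfin : (iter (pts (seg d)) (rk (pts W.carrier))).Finite := hiter ▸ W.finite_top.sdiff
  have hrk : rk (pts (seg d)) = rk (pts W.carrier) :=
    le_antisymm (rk_le (derivedSet_eq_empty_of_finite hfin))
      (le_rk_of_nonempty (isClosed_pts _) (scattered_seg d) ⟨d.1, hiter ▸ ⟨hd, hdm⟩⟩)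
  have hcard : (top (pts (seg d))).ncard + 1 = (top (pts W.carrier)).ncard := by
    rw [top, hrk, hiter]
    exact ncard_sdiff_singleton_add_one hmD W.finite_top
  -- The segment up to `d` need not be a cardinal; the shortest segment of at least its cardinality
  -- is.
  obtain ⟨x, hxd, hx, hxc⟩ := exists_isCardinal_seg (W := W) (Q := fun Y => Embeds (pts (seg d)) Y)
    (fun h h' => h'.trans h) (fun ⟨_, _, _, h⟩ => h (mem_seg_self d)) (Embeds.refl _)
  have hkey : cbKey (pts (seg x)) = cbKey (pts (seg d)) := by
    refine le_antisymm ?_ ?_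
    · refine (embeds_iff (isClosed_pts _) (isClosed_pts _) (scattered_seg x) (scattered_seg d)).1
        (Embeds.of_subset fun y hy => ?_)
      obtain ⟨hyW, hle⟩ := mem_seg.1 hy
      exact mem_seg.2 ⟨hyW, hle.trans hxd⟩
    · exact (embeds_iff (isClosed_pts _) (isClosed_pts _) (scattered_seg d) (scattered_seg x)).1 hx
  refine ⟨seg x, hxc, ?_, ?_⟩
  · rw [cLt_iff_of_scattered (scattered_seg x) W.scattered, hkey]
    rw [cbKey, cbKey, Prod.Lex.toLex_lt_toLex]
    exact Or.inr ⟨hrk, by dsimp only; omega⟩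
  -- The two keys have equal rank and consecutive second components, so nothing lies strictly
  -- between them.
  · rintro ⟨ν, -, h1, h2⟩
    have sν := W.scattered.of_cLt h2
    rw [cLt_iff_of_scattered (scattered_seg x) sν, hkey, cbKey, cbKey,
      Prod.Lex.toLex_lt_toLex] at h1
    rw [cLt_iff_of_scattered sν W.scattered, cbKey, cbKey, Prod.Lex.toLex_lt_toLex] at h2
    dsimp only at h1 h2
    rw [hrk] at h1
    rcases h1 with h1 | ⟨h1, h1'⟩ <;> rcases h2 with h2 | ⟨h2, h2'⟩
    · exact lt_asymm h1 h2
    · exact absurd h1 h2.not_gt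
    · exact absurd h2 h1.not_gt
    · omega

/-- An infinite well-ordered cardinal whose Cantor-Bendixson degree has only one element is not a
successor. -/
theorem IsInitial.not_exists_isCardPred (hW : W.IsInitial) {m : ASet}
    (hD : top (pts W.carrier) = {m}) (hrk : 0 < rk (pts W.carrier)) :
    ¬ ∃ μ, IsCardPred μ W.carrier := by
  rintro ⟨μ, -, hlt, hno⟩
  have sμ := W.scattered.of_cLt hlt
  have hμrk : rk (pts μ) < rk (pts W.carrier) := by
    have h := (cLt_iff_of_scattered sμ W.scattered).1 hlt
    have hempty := iter_eq_empty_of_cbKey_lt (isClosed_pts μ) sμ hD h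
    by_contra! hle
    rcases (pts μ).eq_empty_or_nonempty with h0 | hne
    · have : rk (pts μ) ≤ 0 := rk_le (by
        rw [iter_zero, h0]
        exact derivedSet_eq_empty_of_finite finite_empty)
      exact absurd (hrk.trans_le hle) (not_lt_of_ge this)
    · have := nonempty_iter_of_le_rk (isClosed_pts μ) hne hle
      rw [hempty] at this
      exact not_nonempty_empty this
  obtain ⟨x₀, hx₀⟩ := nonempty_of_rk_pos hrk
  obtain ⟨M, -, hM⟩ := exists_isMax (univ : Set W.El) isClosed_univ ⟨⟨x₀, hx₀⟩, trivial⟩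
  -- One point more than the degree of `μ` can receive at this stage. The maximum is left out so
  -- that the segment covering these points is proper.
  obtain ⟨t, ht, htc⟩ := ((infinite_iter_of_lt_rk hμrk).sdiff
    (finite_singleton M.1)).exists_subset_card_eq ((top (pts μ)).ncard + 1)
  have htW : (t : Set ASet) ⊆ pts W.carrier := fun y hy => iter_subset _ _ (ht hy).1
  have hne : (t : Set ASet).Nonempty := Finset.card_pos.1 (by omega)
  obtain ⟨x, hxt, hmax⟩ := exists_isGreatest_of_isClosed t.finite_toSet.isClosed htW hne
  have hxM : x < M := lt_of_le_of_ne (hM trivial) fun h => (ht hxt).2 (congrArg El.val h)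
  have hx : ¬ Embeds (pts (seg x)) (pts μ) := by
    rintro ⟨f, hc, hi, hm⟩
    have hsub : (t : Set ASet) ⊆ iter (pts (seg x)) (rk (pts μ)) := fun y hy =>
      (mem_iter_seg (y := ⟨y, htW hy⟩)).2 ⟨(ht hy).1, hmax ⟨y, htW hy⟩ hy⟩
    have hle : (f '' t).ncard ≤ (top (pts μ)).ncard :=
      ncard_le_ncard (image_subset_iff.2 fun y hy => map_mem_iter hc hi hm _ y (hsub hy))
        (sμ.finite_top (isClosed_pts μ))
    rw [(hi.mono (hsub.trans (iter_subset _ _))).ncard_image, ncard_coe_finset] at hle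
    omega
  -- The shortest segment not embeddable in `μ` is a cardinal above `μ`, and it is below `κ` because
  -- `κ` is initial.
  obtain ⟨y, hyx, hy, hyc⟩ := exists_isCardinal_seg (W := W) (Q := fun Y => ¬ Embeds Y (pts μ))
    (fun h h' h'' => h' (h.trans h'')) (fun h => h ⟨id, continuousOn_id, injOn_id _,
      mapsTo_empty _ _⟩) hx
  refine hno ⟨seg y, hyc, ?_, CLe.of_sub (isInitialSegment_seg y).sub,
    fun h => hW _ (seg_ssubset (hyx.trans_lt hxM)) ⟨h.2, h.1⟩⟩
  rw [cLt_iff_of_scattered sμ (scattered_seg y)]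
  rw [embeds_iff (isClosed_pts _) (isClosed_pts _) (scattered_seg y) sμ] at hy
  exact not_le.1 hy

end WOSet

end AS

/-! ### The theorem -/

theorem theorem11p13 (κ R : ASet) (hκ : AS.IsWOCardinal R κ) :
    -- the cofinality, if it exists, is at most `ω`
    (∀ L, AS.IsCofinality R κ L → AS.OLe R L AS.omegaLe AS.omega) ∧
    -- the Cantor-Bendixson degree is well defined
    (∃! D, AS.IsCBDegree κ D) ∧
    -- it decides whether the cofinality is `2` or `ω`
    (AS.CLt (AS.nOrd 1) κ → ∀ D, AS.IsCBDegree κ D →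
      (AS.CLt (AS.nOrd 1) D → AS.CofinalityEq R κ AS.omegaLe (AS.nOrd 2)) ∧
      (AS.CEq D (AS.nOrd 1) → AS.CofinalityEq R κ AS.omegaLe AS.omega)) ∧
    -- limit cardinals are the infinite cardinals of cofinality `ω`
    (AS.IsInfinite κ →
      (AS.IsLimitCardinal κ ↔ AS.CofinalityEq R κ AS.omegaLe AS.omega)) := by
  let W : AS.WOSet := ⟨κ, R, κ, fun _ h => h, hκ.1⟩
  have hW : W.IsInitial := hκ.2
  refine ⟨fun L hL => ?_, AS.existsUnique_isCBDegree W, fun h1 D hD => ?_, fun hinf => ?_⟩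
  · refine (AS.WOSet.oLe_iff (W := W.sub L hL.1.1) (V := AS.omegaW)).2 ?_
    rw [AS.type_omegaW]
    exact AS.WOSet.type_le_of_isCofinality (W := W) hL
  · have hD' := (AS.isCBDegree_iff W).1 hD
    rw [AS.nOrd_one_cLt_iff, AS.cEq_nOrd_one_iff, hD']
    exact ⟨AS.WOSet.cofinalityEq_two, fun ⟨m, hm⟩ =>
      AS.WOSet.cofinalityEq_omega hm (AS.WOSet.rk_pos_of_top_eq hm (AS.nOrd_one_cLt_iff.1 h1))⟩
  · have hK : (AS.pts W.carrier).Infinite := AS.infinite_of_isInfinite hinf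
    have hne := AS.top_nonempty (AS.isClosed_pts W.carrier) hK.nonempty
    constructor
    · rintro ⟨-, -, hno⟩
      have hs : (AS.top (AS.pts W.carrier)).Subsingleton := by
        rw [← Set.not_nontrivial_iff]
        exact fun h => hno (hW.exists_isCardPred h)
      obtain ⟨m, hm⟩ := Set.exists_eq_singleton_iff_nonempty_subsingleton.2 ⟨hne, hs⟩
      exact AS.WOSet.cofinalityEq_omega hm (AS.WOSet.rk_pos_of_top_eq hm hK.nontrivial)
    · intro hcf
      have hs : (AS.top (AS.pts W.carrier)).Subsingleton := by
        rw [← Set.not_nontrivial_iff]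
        intro h
        -- A degree with two points would make the cofinality `2` as well as `ω`, although the order
        -- types `2` and `ω + 1` differ.
        have := AS.WOSet.type_eq_type_of_cofinalityEq (W := W) (V := AS.twoW) (V' := AS.omegaW)
          (AS.WOSet.cofinalityEq_two h) hcf
        rw [AS.type_twoW, AS.type_omegaW] at this
        have hlt : (2 : Ordinal.{0}) < Order.succ Ordinal.omega0 :=
          lt_of_lt_of_le (by exact_mod_cast Ordinal.natCast_lt_omega0 2) (Order.le_succ _)
        exact hlt.ne this
      obtain ⟨m, hm⟩ := Set.exists_eq_singleton_iff_nonempty_subsingleton.2 ⟨hne, hs⟩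
      exact ⟨Or.inl ⟨R, hκ⟩, hK.nonempty, hW.not_exists_isCardPred hm
        (AS.WOSet.rk_pos_of_top_eq hm hK.nontrivial)⟩
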